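/- An instance of \textsc{Strong Triadic Closure} (STC) is a finite simple undirected graph $G=(V,E)$ with an integer $k$. A labeling is a partition of $E$ into strong and weak edges; it is an STC-labeling if there are no two distinct strong edges $\{u,v\},\{v,w\}$ with $\{u,w\}\notin E$. The instance $(G,k)$ is a yes-instance if $G$ has an STC-labeling with at most $k$ weak edges (so it is a no-instance if $k<0$). A critical clique of $G$ is a clique $K$ whose vertices all have the same neighbours in $V\setminus K$ and which is inclusion-maximal with this property. In the critical clique graph $\mathcal C$ two different critical cliques are adjacent if all edges between them are present in $G$. Let $\mathcal N(K)$ (respectively $\mathcal N^2(K)$) be the union of the critical cliques adjacent to $K$ (respectively at distance exactly two from $K$) in $\mathcal C$, and let $c(K)$ be the number of edges of $G$ between $\mathcal N(K)$ and $\mathcal N^2(K)$. The critical clique $K$ is closed if $\mathcal N(K)$ is a clique in $G$. Consider the Reduction rule: if $G$ has a closed critical clique $K$ with $|K|>c(K)$, delete $K\cup\mathcal N(K)$ from $G$ and decrease $k$ by $c(K)$. Theorem. STC parameterized by $k$ has a problem kernel with at most $4k$ vertices, computable in $O(nm)$ time, where $n=|V|$ and $m=|E|$. Precisely: (1) If exhaustive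 application of the rule to $(G,k)$, in any order, ends in $(G[A],l)$, then $(G,k)$ is a yes-instance if and only if $(G[A],l)$ is, $l\le k$, and if $(G[A],l)$ is a yes-instance then $|A|\le 4l$. (2) There are a random access machine program (unit-cost addition, truncated subtraction, comparison and indirect addressing, on words of $O(\log(n+m+k))$ bits) and a constant $C$ such that for every instance $(G,k)$ with $k\ge 0$, given by adjacency lists together with $n$, $m$ and $k$, the program halts after at most $C\cdot(nm+1)$ steps with an instance $(G',k')$, $k'\ge 0$, in the same format such that: $(G,k)$ is a yes-instance if and only if $(G',k')$ is; $G'$ has at most $4k'$ vertices; and $k'\le\max(k,1)$ (so $G'$ has at most $4k$ vertices whenever $k\ge1$). Moreover, some exhaustive application of the rule to $(G,k)$ ends in an instance $(G[A],l)$ such that either $k'=l$ and $G'$ is isomorphic to $G[A]$, or $|A|>4l$ (in which case $(G,k)$ is a no-instance, by (1)). -/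

import Mathlib

namespace STC

section Graphs

variable {V : Type*}

/-- A labeling of `G`: a partition of the edge set into strong and weak edges. -/
structure Labeling (G : SimpleGraph V) where
  strong : Set (Sym2 V)
  weak : Set (Sym2 V)
  union_eq : strong ∪ weak = G.edgeSet
  disjoint : Disjoint strong weak

/-- No two (distinct) strong edges `{u,v}`, `{v,w}` with `{u,w}` not an edge. -/
def Labeling.IsSTC {G : SimpleGraph V} (L : Labeling G) : Prop :=
  ∀ u v w : V, u ≠ w → s(u, v) ∈ L.strong → s(v, w) ∈ L.strong → G.Adj u w

/-- `(G, k)` is a yes-instance of Strong Triadic Closure. The parameter is an integer, so that it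
can be decreased without truncation; a negative parameter gives a no-instance. -/
def HasSTCLabeling (G : SimpleGraph V) (k : ℤ) : Prop :=
  ∃ L : Labeling G, L.IsSTC ∧ (L.weak.ncard : ℤ) ≤ k

/-- `K` is a critical clique: a clique whose vertices all have the same neighbours outside `K`,
inclusion-maximal with this property. -/
def IsCriticalClique (G : SimpleGraph V) (K : Set V) : Prop :=
  Maximal (fun K : Set V =>
    G.IsClique K ∧ ∀ u ∈ K, ∀ v ∈ K, ∀ w ∉ K, (G.Adj u w ↔ G.Adj v w)) K

abbrev CriticalClique (G : SimpleGraph V) : Type _ := {K : Set V // IsCriticalClique G K}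

/-- The critical clique graph. -/
def criticalCliqueGraph (G : SimpleGraph V) : SimpleGraph (CriticalClique G) where
  Adj K K' := K ≠ K' ∧ ∀ u ∈ K.1, ∀ v ∈ K'.1, G.Adj u v
  symm := ⟨fun _ _ h => ⟨h.1.symm, fun u hu v hv => (h.2 v hv u hu).symm⟩⟩
  loopless := ⟨fun _ h => h.1 rfl⟩

/-- `𝒩(K)`: the union of the neighbours of `K` in the critical clique graph. -/
def nbhd {G : SimpleGraph V} (K : CriticalClique G) : Set V :=
  {v | ∃ K' : CriticalClique G, (criticalCliqueGraph G).Adj K K' ∧ v ∈ K'.1}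

/-- `𝒩²(K)`: the union of the critical cliques at distance exactly two from `K` in the critical
clique graph. -/
def nbhd2 {G : SimpleGraph V} (K : CriticalClique G) : Set V :=
  {v | ∃ K' : CriticalClique G, (criticalCliqueGraph G).dist K K' = 2 ∧ v ∈ K'.1}

/-- `K` is closed: `𝒩(K)` is a clique. -/
def CriticalClique.Closed {G : SimpleGraph V} (K : CriticalClique G) : Prop :=
  G.IsClique (nbhd K)

/-- `E_G(A, B)`. -/
def edgesBetween (G : SimpleGraph V) (A B : Set V) : Set (Sym2 V) :=
  {e | e ∈ G.edgeSet ∧ ∃ a ∈ A, ∃ b ∈ B, e = s(a, b)}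

/-- `|E_G(𝒩(K), 𝒩²(K))|`. -/
noncomputable def cutSize {G : SimpleGraph V} (K : CriticalClique G) : ℕ :=
  (edgesBetween G (nbhd K) (nbhd2 K)).ncard

/-- The reduction rule can be applied to `K`. -/
def CriticalClique.Removable {G : SimpleGraph V} (K : CriticalClique G) : Prop :=
  K.Closed ∧ cutSize K < K.1.ncard

/-- One application of the rule to the instance `(G[A], k)`, with result `(G[B], l)`. -/
def RuleStep (G : SimpleGraph V) (I J : Set V × ℤ) : Prop :=
  ∃ K : CriticalClique (G.induce I.1), K.Removable ∧
    J.1 = I.1 \ (Subtype.val '' (K.1 ∪ nbhd K)) ∧ J.2 = I.2 - cutSize K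

/-- The rule cannot be applied to `G`. -/
def Reduced (G : SimpleGraph V) : Prop :=
  ∀ K : CriticalClique G, ¬ K.Removable

/-- Some exhaustive application of the rule to `(G, k)` ends in `(G[A], l)`. -/
def ReducesTo (G : SimpleGraph V) (k : ℤ) (A : Set V) (l : ℤ) : Prop :=
  Relation.ReflTransGen (RuleStep G) (Set.univ, k) (A, l) ∧ Reduced (G.induce A)

end Graphs

/-! The machine: a random access machine with unit-cost addition, truncated subtraction,
comparison and indirect addressing, programmed with sequencing, branching and loops. A program
is a finite object and mentions only finitely many registers and arrays. -/

/-- A memory content: registers and arrays of natural numbers. -/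
structure State where
  reg : ℕ → ℕ
  arr : ℕ → ℕ → ℕ

def State.setReg (s : State) (x v : ℕ) : State :=
  { s with reg := Function.update s.reg x v }

def State.setArr (s : State) (a i v : ℕ) : State :=
  { s with arr := Function.update s.arr a (Function.update (s.arr a) i v) }

/-- `read a i` is the entry of array `a` at index `i`. -/
inductive Expr where
  | const (c : ℕ)
  | reg (x : ℕ)
  | read (a : ℕ) (i : Expr)
  | add (e f : Expr)
  | sub (e f : Expr)

def Expr.eval (s : State) : Expr → ℕ
  | .const c => c
  | .reg x => s.reg x
  | .read a i => s.arr a (i.eval s)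
  | .add e f => e.eval s + f.eval s
  | .sub e f => e.eval s - f.eval s

/-- The number of unit-cost operations needed to evaluate an expression. -/
def Expr.cost : Expr → ℕ
  | .const _ => 1
  | .reg _ => 1
  | .read _ i => i.cost + 1
  | .add e f => e.cost + f.cost + 1
  | .sub e f => e.cost + f.cost + 1

inductive Test where
  | lt (e f : Expr)
  | eq (e f : Expr)
  | not (b : Test)
  | and (b c : Test)

def Test.holds (s : State) : Test → Prop
  | .lt e f => e.eval s < f.eval s
  | .eq e f => e.eval s = f.eval s
  | .not b => ¬ b.holds s
  | .and b c => b.holds s ∧ c.holds s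

def Test.cost : Test → ℕ
  | .lt e f => e.cost + f.cost + 1
  | .eq e f => e.cost + f.cost + 1
  | .not b => b.cost + 1
  | .and b c => b.cost + c.cost + 1

inductive Program where
  | skip
  | assign (x : ℕ) (e : Expr)
  | write (a : ℕ) (i e : Expr)
  | seq (p q : Program)
  | ite (b : Test) (p q : Program)
  | loop (b : Test) (p : Program)

/-- `Exec W p s s' t`: on a machine whose memory cells hold numbers of size at most `W`, the
program `p` started in `s` halts in `s'` after `t` unit-cost operations. Storing a number larger
than `W`, or at an address larger than `W`, is an error: the run then has no result. -/
inductive Exec (W : ℕ) : Program → State → State → ℕ → Prop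
  | skip (s : State) : Exec W .skip s s 1
  | assign (s : State) (x : ℕ) (e : Expr) (he : e.eval s ≤ W) :
      Exec W (.assign x e) s (s.setReg x (e.eval s)) (e.cost + 1)
  | write (s : State) (a : ℕ) (i e : Expr) (hi : i.eval s ≤ W) (he : e.eval s ≤ W) :
      Exec W (.write a i e) s (s.setArr a (i.eval s) (e.eval s)) (i.cost + e.cost + 1)
  | seq {p q : Program} {s s₁ s₂ : State} {t₁ t₂ : ℕ}
      (hp : Exec W p s s₁ t₁) (hq : Exec W q s₁ s₂ t₂) : Exec W (.seq p q) s s₂ (t₁ + t₂)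
  | ite_true {b : Test} {p q : Program} {s s' : State} {t : ℕ}
      (hb : b.holds s) (hp : Exec W p s s' t) : Exec W (.ite b p q) s s' (b.cost + t + 1)
  | ite_false {b : Test} {p q : Program} {s s' : State} {t : ℕ}
      (hb : ¬ b.holds s) (hq : Exec W q s s' t) : Exec W (.ite b p q) s s' (b.cost + t + 1)
  | loop_done {b : Test} {p : Program} {s : State}
      (hb : ¬ b.holds s) : Exec W (.loop b p) s s (b.cost + 1)
  | loop_step {b : Test} {p : Program} {s s₁ s₂ : State} {t₁ t₂ : ℕ}
      (hb : b.holds s) (hp : Exec W p s s₁ t₁) (hl : Exec W (.loop b p) s₁ s₂ t₂) :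
      Exec W (.loop b p) s s₂ (b.cost + t₁ + t₂ + 1)

/-- The memory holds the instance `(G, k)` as adjacency lists: registers `0`, `1`, `2` hold the
number of vertices, the number of edges and `k`; array `1`, from index `off v` to index
`off (v + 1) - 1`, lists the neighbours of `v` in some order without repetition, where `off` is
array `0`. Nothing is said about the other cells. -/
structure Encodes (s : State) {n : ℕ} (G : SimpleGraph (Fin n)) (k : ℕ) : Prop where
  vertices : s.reg 0 = n
  edges : s.reg 1 = G.edgeSet.ncard
  parameter : s.reg 2 = k
  off_zero : s.arr 0 0 = 0
  off_succ : ∀ v : Fin n, s.arr 0 (v + 1) = s.arr 0 v + (G.neighborSet v).ncard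
  adj_iff : ∀ (v : Fin n) (x : ℕ),
    (∃ i, s.arr 0 v ≤ i ∧ i < s.arr 0 (v + 1) ∧ s.arr 1 i = x) ↔
      ∃ w : Fin n, (w : ℕ) = x ∧ G.Adj v w

/-- An input memory for `(G, k)`: it holds the instance, and all other cells are `0`. -/
structure IsInput (s : State) {n : ℕ} (G : SimpleGraph (Fin n)) (k : ℕ) : Prop
    extends Encodes s G k where
  reg_zero : ∀ x, 3 ≤ x → s.reg x = 0
  off_rest : ∀ i, n < i → s.arr 0 i = 0
  adj_rest : ∀ i, 2 * G.edgeSet.ncard ≤ i → s.arr 1 i = 0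
  arr_zero : ∀ a, 2 ≤ a → ∀ i, s.arr a i = 0

end STC

/-! Critical cliques are the classes of true twins, so the rule can be stated at a single vertex v
of K: K together with 𝒩(K) is the closed neighbourhood C = N[v], K is closed exactly when v is
simplicial, and c(K) is the number of edges leaving C (`ruleStep_iff`).

Safeness. A labeling of G - C extends to G by making all edges inside C strong and all edges leaving
C weak, at the price of c(K). Conversely, every STC-labeling has at least c(K) weak edges touching C
(`RemovableAt.boundary_ncard_le`). This is clear if all edges leaving C are weak. If an edge ab with
a in C and b outside is strong, then ua is weak for every twin u of v, since u is not adjacent to b;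
these are |K| > c(K) edges.

Kernel size (`card_le_of_reduced`). Take an STC-labeling of a reduced graph with w weak edges. At
most 2w vertices meet a weak edge. A vertex x that meets none has a clique N[x] as closed
neighbourhood, all edges leaving N[x] are weak, and two such neighbourhoods are equal or disjoint.
As the rule does not apply, at most as many of these vertices share the neighbourhood N[x] as there
are edges leaving it. Summing over the distinct neighbourhoods counts every weak edge at most twice,
once per end, which gives another 2w vertices.

Running time. Let A be the current vertex set. For a simplicial v, N[v] is contained in N[u] for
each neighbour u, so c(K) is the sum of deg u - deg v over the neighbours, and |K| - 1 is the number
of neighbours of the same degree (`removableAt_induce_iff`). Hence one scan of the edges computes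
all degrees, one more tests the inequality at all vertices, and a few scans decide whether one given
vertex is simplicial. Simpliciality is remembered: it survives deletions, and a vertex that is not
simplicial can become so only when a neighbour is deleted. Deleting N[v] touches at most c(K) <
|N[v]| further vertices, whose status becomes unknown. So the number of vertices plus the number of
vertices of unknown status drops in every round, whether it tests or deletes (`StatusRep.delete`).
There are O(n) rounds of O(m) steps each (`runs_reduceLoop`).

The edges are kept as 2m darts (ordered pairs). Isolated vertices are deleted at the start, which
costs nothing in k; afterwards every vertex is an end of a dart and scans of the darts reach
everything. If the final instance has more than 4l vertices it is a no-instance and is replaced by a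
fixed one with four vertices and parameter 1. -/

namespace STC

/-! ### True twins, and the reduction rule at one vertex -/

section GraphTheory

variable {V : Type*}

/-- The closed neighbourhood of `v`. -/
def closedNbhd (G : SimpleGraph V) (v : V) : Set V := {u | u = v ∨ G.Adj v u}

/-- The true twins of `v`, including `v`. -/
def twins (G : SimpleGraph V) (v : V) : Set V := {u | closedNbhd G u = closedNbhd G v}

/-- The edges leaving `C`. -/
def boundary (G : SimpleGraph V) (C : Set V) : Set (Sym2 V) :=
  {e | ∃ a ∈ C, ∃ b ∉ C, G.Adj a b ∧ e = s(a, b)}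

theorem mem_closedNbhd {G : SimpleGraph V} {v u : V} :
    u ∈ closedNbhd G v ↔ u = v ∨ G.Adj v u := Iff.rfl

theorem self_mem_closedNbhd (G : SimpleGraph V) (v : V) : v ∈ closedNbhd G v := Or.inl rfl

theorem mem_closedNbhd_comm {G : SimpleGraph V} {v u : V} :
    u ∈ closedNbhd G v ↔ v ∈ closedNbhd G u := by
  simp only [mem_closedNbhd, G.adj_comm v u, eq_comm]

theorem self_mem_twins (G : SimpleGraph V) (v : V) : v ∈ twins G v := rfl

theorem twins_subset_closedNbhd (G : SimpleGraph V) (v : V) : twins G v ⊆ closedNbhd G v := by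
  intro u hu
  have hu : closedNbhd G u = closedNbhd G v := hu
  rw [← hu]; exact self_mem_closedNbhd G u

theorem twins_homogeneous (G : SimpleGraph V) (v : V) :
    G.IsClique (twins G v) ∧
      ∀ a ∈ twins G v, ∀ b ∈ twins G v, ∀ w ∉ twins G v, (G.Adj a w ↔ G.Adj b w) := by
  have key : ∀ a ∈ twins G v, ∀ w, w ≠ a → (G.Adj a w ↔ w ∈ closedNbhd G v) := by
    intro a ha w hw
    have ha : closedNbhd G a = closedNbhd G v := ha
    rw [← ha, mem_closedNbhd]; simp [hw]
  constructor
  · intro a ha b hb hab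
    exact (key a ha b hab.symm).2 (twins_subset_closedNbhd G v hb)
  · intro a ha b hb w hw
    rw [key a ha w (by rintro rfl; exact hw ha), key b hb w (by rintro rfl; exact hw hb)]

/-- Any two members of a homogeneous clique have the same closed neighbourhood: inside `K` because
it is a clique, outside by homogeneity. With `twins_homogeneous`, this makes the twin classes the
maximal such sets. -/
theorem subset_twins {G : SimpleGraph V} {K : Set V} (hc : G.IsClique K)
    (hh : ∀ a ∈ K, ∀ b ∈ K, ∀ w ∉ K, (G.Adj a w ↔ G.Adj b w)) {v : V} (hv : v ∈ K) :
    K ⊆ twins G v := by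
  have key : ∀ a ∈ K, ∀ b ∈ K, closedNbhd G a ⊆ closedNbhd G b := by
    intro a ha b hb x hx
    by_cases hxK : x ∈ K
    · by_cases h : x = b
      · exact Or.inl h
      · exact Or.inr (hc hb hxK (Ne.symm h))
    · rcases hx with rfl | hx
      · exact absurd ha hxK
      · exact Or.inr ((hh a ha b hb x hxK).1 hx)
  intro u hu
  exact Set.Subset.antisymm (key u hu v hv) (key v hv u hu)

theorem isCriticalClique_twins (G : SimpleGraph V) (v : V) : IsCriticalClique G (twins G v) :=
  ⟨twins_homogeneous G v, fun _ hK hle => subset_twins hK.1 hK.2 (hle (self_mem_twins G v))⟩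

theorem IsCriticalClique.eq_twins {G : SimpleGraph V} {K : Set V} (hK : IsCriticalClique G K)
    {v : V} (hv : v ∈ K) : K = twins G v :=
  have h := subset_twins hK.1.1 hK.1.2 hv
  Set.Subset.antisymm h (hK.2 (twins_homogeneous G v) h)

/-- The critical clique of `v`. -/
def criticalCliqueOf (G : SimpleGraph V) (v : V) : CriticalClique G :=
  ⟨twins G v, isCriticalClique_twins G v⟩

theorem adj_criticalCliqueOf {G : SimpleGraph V} {v w : V} (hvw : G.Adj v w)
    (hne : w ∉ twins G v) :
    (criticalCliqueGraph G).Adj (criticalCliqueOf G v) (criticalCliqueOf G w) := by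
  refine ⟨?_, ?_⟩
  · intro h
    have h : twins G v = twins G w := congrArg Subtype.val h
    exact hne (h ▸ self_mem_twins G w)
  · intro a ha b hb
    have ha : closedNbhd G a = closedNbhd G v := ha
    have hb : closedNbhd G b = closedNbhd G w := hb
    have h1 : w ∈ closedNbhd G a := ha ▸ Or.inr hvw
    have h2 : a ∈ closedNbhd G b := hb ▸ mem_closedNbhd_comm.1 h1
    rcases h2 with rfl | h2
    · exact absurd (hb.symm.trans ha) hne
    · exact h2.symm

theorem mem_nbhd_criticalCliqueOf {G : SimpleGraph V} {v w : V} :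
    w ∈ nbhd (criticalCliqueOf G v) ↔ G.Adj v w ∧ w ∉ twins G v := by
  constructor
  · rintro ⟨K', ⟨hne, hadj⟩, hw⟩
    refine ⟨hadj v (self_mem_twins G v) w hw, fun h => hne (Subtype.ext ?_)⟩
    rw [K'.2.eq_twins hw]
    exact (isCriticalClique_twins G v).eq_twins h
  · rintro ⟨h1, h2⟩
    exact ⟨criticalCliqueOf G w, adj_criticalCliqueOf h1 h2, self_mem_twins G w⟩

theorem twins_union_nbhd (G : SimpleGraph V) (v : V) :
    twins G v ∪ nbhd (criticalCliqueOf G v) = closedNbhd G v := by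
  ext w
  rw [Set.mem_union, mem_nbhd_criticalCliqueOf]
  constructor
  · rintro (h | h)
    · exact twins_subset_closedNbhd G v h
    · exact Or.inr h.1
  · rintro (rfl | h)
    · exact Or.inl (self_mem_twins G w)
    · by_cases h' : w ∈ twins G v
      · exact Or.inl h'
      · exact Or.inr ⟨h, h'⟩

/-- The critical clique of `w` is at distance at most two by way of that of `a`. Distances zero and
one mean that `w` is a twin or a neighbour of `v`. -/
theorem mem_nbhd2_criticalCliqueOf {G : SimpleGraph V} {v a w : V}
    (ha : a ∈ nbhd (criticalCliqueOf G v)) (haw : G.Adj a w) :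
    w ∈ nbhd2 (criticalCliqueOf G v) ↔ w ∉ closedNbhd G v := by
  obtain ⟨hva, hat⟩ := mem_nbhd_criticalCliqueOf.1 ha
  constructor
  · rintro ⟨K', hd, hw⟩ hwv
    rw [← twins_union_nbhd] at hwv
    rcases hwv with h | ⟨K'', hK'', hwK''⟩
    · have : criticalCliqueOf G v = K' := Subtype.ext
        (((isCriticalClique_twins G v).eq_twins h).trans (K'.2.eq_twins hw).symm)
      rw [this] at hd; simp at hd
    · have : K'' = K' := Subtype.ext
        ((K''.2.eq_twins hwK'').trans (K'.2.eq_twins hw).symm)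
      rw [← this, SimpleGraph.dist_eq_one_iff_adj.2 hK''] at hd
      simp at hd
  · intro hw
    have hwa : w ∉ twins G a := by
      intro h
      have h : closedNbhd G w = closedNbhd G a := h
      exact hw (mem_closedNbhd_comm.1 (h ▸ (Or.inr hva.symm)))
    have h1 := adj_criticalCliqueOf hva hat
    have h2 := adj_criticalCliqueOf haw hwa
    refine ⟨criticalCliqueOf G w, ?_, self_mem_twins G w⟩
    have hle : (criticalCliqueGraph G).dist (criticalCliqueOf G v) (criticalCliqueOf G w) ≤ 2 :=
      SimpleGraph.dist_le (.cons h1 (.cons h2 .nil))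
    have hr : (criticalCliqueGraph G).Reachable (criticalCliqueOf G v) (criticalCliqueOf G w) :=
      ⟨.cons h1 (.cons h2 .nil)⟩
    -- `dist` is also 0 between unreachable vertices, so `hr` is needed to turn distance 0 into
    -- equality.
    have h0 : (criticalCliqueGraph G).dist (criticalCliqueOf G v) (criticalCliqueOf G w) ≠ 0 := by
      intro h
      have h : twins G v = twins G w := congrArg Subtype.val (hr.dist_eq_zero_iff.1 h)
      exact hw (twins_subset_closedNbhd G v (h ▸ self_mem_twins G w))
    have h1' : (criticalCliqueGraph G).dist (criticalCliqueOf G v) (criticalCliqueOf G w) ≠ 1 := by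
      intro h
      have h := (SimpleGraph.dist_eq_one_iff_adj.1 h).2 v (self_mem_twins G v) w (self_mem_twins G w)
      exact hw (Or.inr h)
    omega

/-- A twin of `v` has no neighbour outside the closed neighbourhood of `v`, so every edge leaving
this set starts in 𝒩(K); its other end is then in 𝒩²(K) by `mem_nbhd2_criticalCliqueOf`. -/
theorem edgesBetween_nbhd_nbhd2 (G : SimpleGraph V) (v : V) :
    edgesBetween G (nbhd (criticalCliqueOf G v)) (nbhd2 (criticalCliqueOf G v)) =
      boundary G (closedNbhd G v) := by
  ext e
  constructor
  · rintro ⟨he, a, ha, b, hb, rfl⟩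
    have hab : G.Adj a b := he
    exact ⟨a, Or.inr (mem_nbhd_criticalCliqueOf.1 ha).1, b,
      (mem_nbhd2_criticalCliqueOf ha hab).1 hb, hab, rfl⟩
  · rintro ⟨a, ha, b, hb, hab, rfl⟩
    have ha' : a ∈ nbhd (criticalCliqueOf G v) := by
      rw [← twins_union_nbhd] at ha
      refine ha.resolve_left fun h => hb ?_
      have h : closedNbhd G a = closedNbhd G v := h
      exact h ▸ Or.inr hab
    exact ⟨hab, a, ha', b, (mem_nbhd2_criticalCliqueOf ha' hab).2 hb, rfl⟩

theorem cutSize_criticalCliqueOf (G : SimpleGraph V) (v : V) :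
    cutSize (criticalCliqueOf G v) = (boundary G (closedNbhd G v)).ncard := by
  rw [cutSize, edgesBetween_nbhd_nbhd2]

/-- A twin of `v` is adjacent to everything else in the closed neighbourhood, so adding K to the
clique 𝒩(K) leaves a clique: closed means that `v` is simplicial. -/
theorem closed_criticalCliqueOf (G : SimpleGraph V) (v : V) :
    (criticalCliqueOf G v).Closed ↔ G.IsClique (closedNbhd G v) := by
  constructor
  · intro h
    have h : G.IsClique (nbhd (criticalCliqueOf G v)) := h
    have htw : ∀ a ∈ twins G v, ∀ b ∈ closedNbhd G v, a ≠ b → G.Adj a b := by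
      intro a ha b hb hab
      have ha : closedNbhd G a = closedNbhd G v := ha
      rw [← ha] at hb
      exact hb.resolve_left hab.symm
    intro a ha b hb hab
    have ha' := ha
    have hb' := hb
    rw [← twins_union_nbhd] at ha' hb'
    rcases ha' with ha' | ha'
    · exact htw a ha' b hb hab
    · rcases hb' with hb' | hb'
      · exact (htw b hb' a ha hab.symm).symm
      · exact h ha' hb' hab
  · intro h
    refine h.subset ?_
    rw [← twins_union_nbhd]
    exact Set.subset_union_right

/-- The critical clique of `v` is closed and larger than its cut. -/
def RemovableAt (G : SimpleGraph V) (v : V) : Prop :=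
  G.IsClique (closedNbhd G v) ∧ (boundary G (closedNbhd G v)).ncard < (twins G v).ncard

theorem removable_criticalCliqueOf (G : SimpleGraph V) (v : V) :
    (criticalCliqueOf G v).Removable ↔ RemovableAt G v := by
  rw [CriticalClique.Removable, closed_criticalCliqueOf, cutSize_criticalCliqueOf]; rfl

/-- The empty set is a critical clique of the graph without vertices; the strict inequality in the
rule excludes it and provides a representative vertex. -/
theorem CriticalClique.Removable.exists_eq {G : SimpleGraph V} {K : CriticalClique G}
    (hK : K.Removable) : ∃ v, K = criticalCliqueOf G v := by
  have hne : K.1.ncard ≠ 0 := by have := hK.2; omega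
  obtain ⟨v, hv⟩ : K.1.Nonempty := by
    rw [Set.nonempty_iff_ne_empty]; intro h; rw [h] at hne; simp at hne
  exact ⟨v, Subtype.ext (K.2.eq_twins hv)⟩

theorem reduced_iff (G : SimpleGraph V) : Reduced G ↔ ∀ v, ¬ RemovableAt G v := by
  constructor
  · intro h v hv
    exact h _ ((removable_criticalCliqueOf G v).2 hv)
  · intro h K hK
    obtain ⟨v, rfl⟩ := hK.exists_eq
    exact h v ((removable_criticalCliqueOf G v).1 hK)

theorem ruleStep_iff (G : SimpleGraph V) (A B : Set V) (k l : ℤ) :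
    RuleStep G (A, k) (B, l) ↔ ∃ v : A, RemovableAt (G.induce A) v ∧
      B = A \ (Subtype.val '' closedNbhd (G.induce A) v) ∧
      l = k - (boundary (G.induce A) (closedNbhd (G.induce A) v)).ncard := by
  constructor
  · rintro ⟨K, hK, h1, h2⟩
    obtain ⟨v, rfl⟩ := hK.exists_eq
    refine ⟨v, (removable_criticalCliqueOf _ v).1 hK, ?_, ?_⟩
    · rw [← twins_union_nbhd]; exact h1
    · rw [← cutSize_criticalCliqueOf]; exact h2
  · rintro ⟨v, hv, h1, h2⟩
    refine ⟨criticalCliqueOf _ v, (removable_criticalCliqueOf _ v).2 hv, ?_, ?_⟩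
    · rw [← twins_union_nbhd] at h1; exact h1
    · rw [← cutSize_criticalCliqueOf] at h2; exact h2

/-- A yes-instance in terms of the set of strong edges alone. -/
theorem hasSTCLabeling_iff (G : SimpleGraph V) (k : ℤ) :
    HasSTCLabeling G k ↔ ∃ S ⊆ G.edgeSet,
      (∀ u v w, u ≠ w → s(u, v) ∈ S → s(v, w) ∈ S → G.Adj u w) ∧
      ((G.edgeSet \ S).ncard : ℤ) ≤ k := by
  constructor
  · rintro ⟨L, hL, hk⟩
    refine ⟨L.strong, by rw [← L.union_eq]; exact Set.subset_union_left, hL, ?_⟩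
    rwa [← L.union_eq, Set.union_sdiff_cancel_left (Set.disjoint_iff.1 L.disjoint)]
  · rintro ⟨S, hS, h, hk⟩
    exact ⟨⟨S, G.edgeSet \ S, Set.union_sdiff_cancel hS, Set.disjoint_sdiff_right⟩, h, hk⟩

theorem HasSTCLabeling.of_iso {W : Type*} {G : SimpleGraph V} {H : SimpleGraph W} (e : G ≃g H)
    {k : ℤ} (h : HasSTCLabeling G k) : HasSTCLabeling H k := by
  rw [hasSTCLabeling_iff] at h ⊢
  obtain ⟨S, hS, h, hk⟩ := h
  have hadj : ∀ a b, G.Adj (e.symm a) (e.symm b) ↔ H.Adj a b := fun a b => e.symm.map_adj_iff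
  have hmem : ∀ x : Sym2 W, Sym2.map e.symm x ∈ G.edgeSet ↔ x ∈ H.edgeSet := by
    intro x; induction x with | _ a b => ?_
    exact hadj a b
  refine ⟨Sym2.map e.symm ⁻¹' S, fun x hx => (hmem x).1 (hS hx), ?_, ?_⟩
  · intro u v w huw h1 h2
    exact (hadj u w).1 (h (e.symm u) (e.symm v) (e.symm w) (by simpa using huw) h1 h2)
  · have : H.edgeSet \ Sym2.map e.symm ⁻¹' S = Sym2.map e.symm ⁻¹' (G.edgeSet \ S) := by
      ext x; simp only [Set.mem_sdiff, Set.mem_preimage, hmem]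
    rw [this]
    have hs : Function.Surjective (Sym2.map e.symm) := by
      intro x; induction x with | _ a b => ?_
      exact ⟨s(e a, e b), by simp⟩
    rw [Set.ncard_preimage_of_injective_subset_range (Sym2.map.injective e.symm.injective)
      (by simp [hs.range_eq])]
    exact hk

theorem hasSTCLabeling_congr {W : Type*} {G : SimpleGraph V} {H : SimpleGraph W} (e : G ≃g H)
    (k : ℤ) : HasSTCLabeling G k ↔ HasSTCLabeling H k :=
  ⟨fun h => h.of_iso e, fun h => h.of_iso e.symm⟩

end GraphTheory
end STC

namespace STC

/-! ### Safeness of the rule and the bound on reduced yes-instances -/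

section Kernel

variable {V : Type*}

/-- A simplicial vertex whose critical clique is larger than its cut forces at least as many weak
edges around its neighbourhood as there are edges in the cut. -/
theorem RemovableAt.boundary_ncard_le [Finite V] {G : SimpleGraph V} {v : V}
    (hv : RemovableAt G v) {S : Set (Sym2 V)} (hSE : S ⊆ G.edgeSet)
    (hS : ∀ u v w, u ≠ w → s(u, v) ∈ S → s(v, w) ∈ S → G.Adj u w) :
    (boundary G (closedNbhd G v)).ncard ≤
      {e | e ∈ G.edgeSet \ S ∧ ∃ x ∈ closedNbhd G v, x ∈ e}.ncard := by
  by_cases hc : ∃ a ∈ closedNbhd G v, ∃ b ∉ closedNbhd G v, s(a, b) ∈ S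
  · obtain ⟨a, ha, b, hb, hab⟩ := hc
    -- A strong edge from a twin `u` to `a` would, with the strong edge `ab`, make `u` adjacent to
    -- `b`. So `u ↦ ua` embeds the twin class into the weak edges, and `u = a` cannot occur because
    -- `a` has the neighbour `b` outside.
    refine hv.2.le.trans (Set.ncard_le_ncard_of_injOn (fun u => s(u, a)) ?_ ?_ (Set.toFinite _))
    · intro u hu
      have huv : closedNbhd G u = closedNbhd G v := hu
      have hub : u ≠ b := by
        rintro rfl; exact hb (twins_subset_closedNbhd G v hu)
      refine ⟨⟨?_, fun h => hb (huv ▸ Or.inr (hS u a b hub h hab))⟩, a, ha, by simp⟩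
      refine ((huv ▸ ha : a ∈ closedNbhd G u).resolve_left ?_ : G.Adj u a)
      rintro rfl
      exact hb (huv ▸ Or.inr (hSE hab))
    · intro u _ w _ h
      have h : s(u, a) = s(w, a) := h
      rw [Sym2.eq_iff] at h
      rcases h with h | h
      · exact h.1
      · exact h.1.trans h.2
  · push Not at hc
    refine Set.ncard_le_ncard ?_ (Set.toFinite _)
    rintro e ⟨a, ha, b, hb, hab, rfl⟩
    exact ⟨⟨hab, hc a ha b hb⟩, a, ha, by simp⟩

theorem map_val_mem_edgeSet {G : SimpleGraph V} {A : Set V} (e : Sym2 A) :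
    Sym2.map Subtype.val e ∈ G.edgeSet ↔ e ∈ (G.induce A).edgeSet := by
  induction e with | _ a b => ?_
  simp

theorem map_val_not_touch {C : Set V} (e : Sym2 (Cᶜ : Set V)) {x : V}
    (h : x ∈ Sym2.map Subtype.val e) : x ∉ C := by
  obtain ⟨y, _, rfl⟩ := Sym2.mem_map.1 h
  exact y.2

/-- Restrict the labeling. The weak edges lost are those touching the deleted set, and
`boundary_ncard_le` says that there are at least as many as cut edges. -/
theorem RemovableAt.hasSTCLabeling_compl [Finite V] {G : SimpleGraph V} {v : V}
    (hv : RemovableAt G v) {k : ℤ} (h : HasSTCLabeling G k) :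
    HasSTCLabeling (G.induce (closedNbhd G v)ᶜ)
      (k - (boundary G (closedNbhd G v)).ncard) := by
  rw [hasSTCLabeling_iff] at h ⊢
  obtain ⟨S, hSE, hS, hk⟩ := h
  set C := closedNbhd G v with hC
  refine ⟨Sym2.map Subtype.val ⁻¹' S, fun e he => (map_val_mem_edgeSet e).1 (hSE he), ?_, ?_⟩
  · intro a b c hac h1 h2
    exact hS a b c (fun h => hac (Subtype.ext h)) h1 h2
  · have h1 := hv.boundary_ncard_le hSE hS
    have h2 : ((G.induce Cᶜ).edgeSet \ Sym2.map Subtype.val ⁻¹' S).ncard =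
        (Sym2.map Subtype.val '' ((G.induce Cᶜ).edgeSet \ Sym2.map Subtype.val ⁻¹' S)).ncard :=
      (Set.ncard_image_of_injective _ (Sym2.map.injective Subtype.val_injective)).symm
    have h3 := Set.ncard_union_eq (s := {e | e ∈ G.edgeSet \ S ∧ ∃ x ∈ C, x ∈ e})
      (t := Sym2.map Subtype.val '' ((G.induce Cᶜ).edgeSet \ Sym2.map Subtype.val ⁻¹' S)) (by
        rw [Set.disjoint_left]
        rintro e ⟨_, x, hx, hxe⟩ ⟨e', _, rfl⟩
        exact map_val_not_touch e' hxe hx) (Set.toFinite _) (Set.toFinite _)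
    have h4 : ({e | e ∈ G.edgeSet \ S ∧ ∃ x ∈ C, x ∈ e} ∪
        Sym2.map Subtype.val '' ((G.induce Cᶜ).edgeSet \ Sym2.map Subtype.val ⁻¹' S)).ncard ≤
        (G.edgeSet \ S).ncard := by
      refine Set.ncard_le_ncard ?_ (Set.toFinite _)
      rintro e (he | ⟨e', he', rfl⟩)
      · exact he.1
      · exact ⟨(map_val_mem_edgeSet e').2 he'.1, he'.2⟩
    rw [← hC] at h1
    omega

/-- Make all edges inside the closed neighbourhood strong and all edges leaving it weak. Two strong
edges that meet are then both outside, or both inside a clique. -/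
theorem RemovableAt.hasSTCLabeling_of_compl [Finite V] {G : SimpleGraph V} {v : V}
    (hv : RemovableAt G v) {k : ℤ}
    (h : HasSTCLabeling (G.induce (closedNbhd G v)ᶜ)
      (k - (boundary G (closedNbhd G v)).ncard)) : HasSTCLabeling G k := by
  set C := closedNbhd G v with hC
  rw [hasSTCLabeling_iff] at h ⊢
  obtain ⟨S, hSE, hS, hk⟩ := h
  have hmap : ∀ a b, s(a, b) ∈ Sym2.map Subtype.val '' S →
      ∃ (ha : a ∉ C) (hb : b ∉ C), s((⟨a, ha⟩ : (Cᶜ : Set V)), (⟨b, hb⟩ : (Cᶜ : Set V))) ∈ S := by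
    rintro a b ⟨e, he, heq⟩
    induction e with | _ x y => ?_
    rw [Sym2.map_mk, Sym2.eq_iff] at heq
    rcases heq with ⟨rfl, rfl⟩ | ⟨rfl, rfl⟩
    · exact ⟨x.2, y.2, he⟩
    · exact ⟨y.2, x.2, by rw [Sym2.eq_swap]; exact he⟩
  refine ⟨Sym2.map Subtype.val '' S ∪ {e | e ∈ G.edgeSet ∧ ∀ x ∈ e, x ∈ C}, ?_, ?_, ?_⟩
  · rintro e (⟨e', he', rfl⟩ | he)
    · exact (map_val_mem_edgeSet e').2 (hSE he')
    · exact he.1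
  · rintro a b c hac (h1 | h1) (h2 | h2)
    · obtain ⟨ha, hb, h1⟩ := hmap a b h1
      obtain ⟨hb, hc, h2⟩ := hmap b c h2
      exact hS _ _ _ (fun h => hac (congrArg Subtype.val h)) h1 h2
    · obtain ⟨ha, hb, h1⟩ := hmap a b h1
      exact absurd (h2.2 b (by simp)) hb
    · obtain ⟨hb, hc, h2⟩ := hmap b c h2
      exact absurd (h1.2 b (by simp)) hb
    · exact hv.1 (h1.2 a (by simp)) (h2.2 c (by simp)) hac
  · have h1 : G.edgeSet \ (Sym2.map Subtype.val '' S ∪ {e | e ∈ G.edgeSet ∧ ∀ x ∈ e, x ∈ C}) ⊆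
        Sym2.map Subtype.val '' ((G.induce Cᶜ).edgeSet \ S) ∪ boundary G C := by
      rintro e ⟨he, hne⟩
      induction e with | _ a b => ?_
      have hab : G.Adj a b := he
      by_cases ha : a ∈ C <;> by_cases hb : b ∈ C
      · exact absurd (Or.inr ⟨he, by simp [ha, hb]⟩) hne
      · exact Or.inr ⟨a, ha, b, hb, hab, rfl⟩
      · exact Or.inr ⟨b, hb, a, ha, hab.symm, Sym2.eq_swap⟩
      · refine Or.inl ⟨s(⟨a, ha⟩, ⟨b, hb⟩), ⟨hab, fun h => hne (Or.inl ⟨_, h, rfl⟩)⟩, rfl⟩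
    have h2 := (Set.ncard_le_ncard h1 (Set.toFinite _)).trans (Set.ncard_union_le _ _)
    rw [Set.ncard_image_of_injective _ (Sym2.map.injective Subtype.val_injective)] at h2
    omega

/-- Inducing on a set of vertices of an induced subgraph. -/
def induceInduceIso (G : SimpleGraph V) (A : Set V) (C : Set A) :
    (G.induce A).induce Cᶜ ≃g G.induce (A \ (Subtype.val '' C)) where
  toFun x := ⟨x.1.1, x.1.2, by
    rintro ⟨y, hy, h⟩
    exact x.2 (Subtype.ext h ▸ hy)⟩
  invFun x := ⟨⟨x.1, x.2.1⟩, fun h => x.2.2 ⟨_, h, rfl⟩⟩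
  left_inv _ := rfl
  right_inv _ := rfl
  map_rel_iff' := Iff.rfl

theorem RuleStep.hasSTCLabeling_iff [Finite V] {G : SimpleGraph V} {I J : Set V × ℤ}
    (h : RuleStep G I J) :
    HasSTCLabeling (G.induce I.1) I.2 ↔ HasSTCLabeling (G.induce J.1) J.2 := by
  obtain ⟨A, k⟩ := I
  obtain ⟨B, l⟩ := J
  obtain ⟨v, hv, rfl, rfl⟩ := (ruleStep_iff G A B k l).1 h
  rw [← hasSTCLabeling_congr (induceInduceIso G A (closedNbhd (G.induce A) v))]
  exact ⟨hv.hasSTCLabeling_compl, hv.hasSTCLabeling_of_compl⟩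

theorem reflTransGen_hasSTCLabeling_iff [Finite V] {G : SimpleGraph V} {I J : Set V × ℤ}
    (h : Relation.ReflTransGen (RuleStep G) I J) :
    (HasSTCLabeling (G.induce I.1) I.2 ↔ HasSTCLabeling (G.induce J.1) J.2) ∧ J.2 ≤ I.2 := by
  induction h with
  | refl => exact ⟨Iff.rfl, le_rfl⟩
  | tail _ hs ih =>
    refine ⟨ih.1.trans hs.hasSTCLabeling_iff, le_trans ?_ ih.2⟩
    obtain ⟨K, _, _, h⟩ := hs
    omega

theorem card_pairs_le [Fintype V] [DecidableEq V] (W : Finset (Sym2 V)) :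
    (Finset.univ.filter fun p : V × V => s(p.1, p.2) ∈ W).card ≤ 2 * W.card := by
  have hmaps : ∀ p ∈ Finset.univ.filter fun p : V × V => s(p.1, p.2) ∈ W, s(p.1, p.2) ∈ W :=
    fun p hp => (Finset.mem_filter.1 hp).2
  refine Finset.card_le_mul_card_image_of_maps_to hmaps 2 ?_
  intro e _
  induction e with | _ a b => ?_
  refine (Finset.card_le_card (t := {(a, b), (b, a)}) ?_).trans Finset.card_le_two
  rintro ⟨x, y⟩ h
  have := (Finset.mem_filter.1 h).2
  rw [Sym2.eq_iff] at this
  simpa [Prod.ext_iff] using this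

/-- A vertex all of whose edges are strong. -/
def AllStrong (G : SimpleGraph V) (S : Set (Sym2 V)) (x : V) : Prop := ∀ y, G.Adj x y → s(x, y) ∈ S

theorem AllStrong.isClique_closedNbhd {G : SimpleGraph V} {S : Set (Sym2 V)}
    (hS : ∀ u v w, u ≠ w → s(u, v) ∈ S → s(v, w) ∈ S → G.Adj u w) {x : V}
    (hx : AllStrong G S x) : G.IsClique (closedNbhd G x) := by
  rintro a (rfl | ha) b (rfl | hb) hab
  · exact absurd rfl hab
  · exact hb
  · exact ha.symm
  · exact hS a x b hab (by rw [Sym2.eq_swap]; exact hx a ha) (hx b hb)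

/-- If `a ≠ x`, the edge `xa` is strong, so a strong `ab` would make `b` a neighbour of `x`. -/
theorem AllStrong.not_strong_of_boundary {G : SimpleGraph V} {S : Set (Sym2 V)}
    (hS : ∀ u v w, u ≠ w → s(u, v) ∈ S → s(v, w) ∈ S → G.Adj u w) {x a b : V}
    (hx : AllStrong G S x) (ha : a ∈ closedNbhd G x) (hb : b ∉ closedNbhd G x)
    (hab : G.Adj a b) : s(a, b) ∉ S := by
  intro h
  rcases ha with rfl | ha
  · exact hb (Or.inr hab)
  · by_cases hxb : x = b
    · exact hb (Or.inl hxb.symm)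
    · exact hb (Or.inr (hS x a b hxb (hx a ha) h))

/-- A common element `a` is joined to `x` and `y` by strong edges (or is one of them), so `y` lies
in the clique around `x`, all of which is then in the closed neighbourhood of `y`. By symmetry, such
neighbourhoods are equal or disjoint. -/
theorem AllStrong.closedNbhd_subset {G : SimpleGraph V} {S : Set (Sym2 V)}
    (hS : ∀ u v w, u ≠ w → s(u, v) ∈ S → s(v, w) ∈ S → G.Adj u w) {x y a : V}
    (hx : AllStrong G S x) (hy : AllStrong G S y) (hax : a ∈ closedNbhd G x)
    (hay : a ∈ closedNbhd G y) : closedNbhd G x ⊆ closedNbhd G y := by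
  have hyx : y ∈ closedNbhd G x := by
    rcases hay with rfl | hay
    · exact hax
    · rcases hax with rfl | hax
      · exact Or.inr hay.symm
      · by_cases h : x = y
        · exact Or.inl h.symm
        · exact Or.inr (hS x a y h (hx a hax) (by rw [Sym2.eq_swap]; exact hy a hay))
  intro z hz
  by_cases h : z = y
  · exact Or.inl h
  · exact Or.inr (hx.isClique_closedNbhd hS hyx hz (Ne.symm h))

/-- `D` consists of the weak edges, each in both orientations. The vertices outside `X` are first
entries of pairs in `D`. The vertices in `X` are grouped by closed neighbourhood: a group is part of
a twin class, hence no larger than the cut, and the cut edges oriented outwards are pairs of `D`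
with first entry in that neighbourhood; different groups use disjoint sets of pairs. So both kinds
number at most `D.card`. -/
theorem card_le_of_reduced [Fintype V] {G : SimpleGraph V} (hred : ∀ v, ¬ RemovableAt G v)
    {S : Set (Sym2 V)}
    (hS : ∀ u v w, u ≠ w → s(u, v) ∈ S → s(v, w) ∈ S → G.Adj u w) :
    Fintype.card V ≤ 4 * (G.edgeSet \ S).ncard := by
  classical
  set W : Finset (Sym2 V) := (G.edgeSet \ S).toFinset with hW
  have hWc : (G.edgeSet \ S).ncard = W.card := by rw [Set.ncard_eq_toFinset_card']
  set D := Finset.univ.filter fun p : V × V => s(p.1, p.2) ∈ W with hD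
  have hmemD : ∀ a b, (a, b) ∈ D ↔ G.Adj a b ∧ s(a, b) ∉ S := by
    intro a b; simp [hD, hW]
  have hDc : D.card ≤ 2 * W.card := card_pairs_le W
  set X := Finset.univ.filter fun x : V => AllStrong G S x with hX
  have hXc : (Xᶜ).card ≤ D.card := by
    refine (Finset.card_le_card (t := D.image Prod.fst) ?_).trans Finset.card_image_le
    intro x hx
    have hx : ¬ AllStrong G S x := by simpa [hX] using hx
    unfold AllStrong at hx
    push Not at hx
    obtain ⟨y, hxy, hs⟩ := hx
    exact Finset.mem_image.2 ⟨(x, y), (hmemD x y).2 ⟨hxy, hs⟩, rfl⟩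
  have hXD : X.card ≤ D.card := by
    let F : Set V → Finset (V × V) := fun C => D.filter fun p => p.1 ∈ C ∧ p.2 ∉ C
    have hdisj : Set.PairwiseDisjoint (X.image (closedNbhd G) : Set (Set V)) F := by
      intro C hC C' hC' hne
      obtain ⟨x, hx, rfl⟩ := Finset.mem_image.1 hC
      obtain ⟨y, hy, rfl⟩ := Finset.mem_image.1 hC'
      have hx : AllStrong G S x := (Finset.mem_filter.1 hx).2
      have hy : AllStrong G S y := (Finset.mem_filter.1 hy).2
      refine Finset.disjoint_left.2 ?_
      rintro ⟨a, b⟩ h1 h2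
      have h1 := (Finset.mem_filter.1 h1).2.1
      have h2 := (Finset.mem_filter.1 h2).2.1
      exact hne ((hx.closedNbhd_subset hS hy h1 h2).antisymm (hy.closedNbhd_subset hS hx h2 h1))
    calc X.card = ∑ C ∈ X.image (closedNbhd G), (X.filter fun x => closedNbhd G x = C).card :=
          Finset.card_eq_sum_card_image _ _
      _ ≤ ∑ C ∈ X.image (closedNbhd G), (F C).card := by
          refine Finset.sum_le_sum fun C hC => ?_
          obtain ⟨x, hx, rfl⟩ := Finset.mem_image.1 hC
          have hx : AllStrong G S x := (Finset.mem_filter.1 hx).2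
          have h1 : (X.filter fun y => closedNbhd G y = closedNbhd G x).card ≤
              (twins G x).ncard := by
            rw [← Set.ncard_coe_finset]
            refine Set.ncard_le_ncard ?_ (Set.toFinite _)
            intro y hy
            exact (Finset.mem_filter.1 hy).2
          have h2 : (twins G x).ncard ≤ (boundary G (closedNbhd G x)).ncard := by
            by_contra h
            exact hred x ⟨hx.isClique_closedNbhd hS, not_le.1 h⟩
          have h3 : (boundary G (closedNbhd G x)).ncard ≤ (F (closedNbhd G x)).card := by
            refine le_trans ?_ (Finset.card_image_le (f := fun p : V × V => s(p.1, p.2)))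
            rw [← Set.ncard_coe_finset]
            refine Set.ncard_le_ncard ?_ (Set.toFinite _)
            rintro e ⟨a, ha, b, hb, hab, rfl⟩
            rw [Finset.mem_coe]
            exact Finset.mem_image.2 ⟨(a, b), Finset.mem_filter.2
              ⟨(hmemD a b).2 ⟨hab, hx.not_strong_of_boundary hS ha hb hab⟩, ha, hb⟩, rfl⟩
          omega
      _ = ((X.image (closedNbhd G)).biUnion F).card := (Finset.card_biUnion hdisj).symm
      _ ≤ D.card := Finset.card_le_card (Finset.biUnion_subset.2 fun C _ => Finset.filter_subset _ _)
  have := Finset.card_add_card_compl X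
  omega

theorem kernel_properties [Finite V] {G : SimpleGraph V} {k l : ℤ} {A : Set V}
    (h : ReducesTo G k A l) :
    (HasSTCLabeling G k ↔ HasSTCLabeling (G.induce A) l) ∧ l ≤ k ∧
      (HasSTCLabeling (G.induce A) l → (A.ncard : ℤ) ≤ 4 * l) := by
  obtain ⟨h1, h2⟩ := reflTransGen_hasSTCLabeling_iff h.1
  refine ⟨?_, h2, ?_⟩
  · rw [← h1]
    exact (hasSTCLabeling_congr (SimpleGraph.induceUnivIso G) k).symm
  · intro hL
    rw [hasSTCLabeling_iff] at hL
    obtain ⟨S, _, hS, hk⟩ := hL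
    have := Fintype.ofFinite A
    have hc := card_le_of_reduced ((reduced_iff _).1 h.2) hS
    rw [← Nat.card_eq_fintype_card, Nat.card_coe_set_eq] at hc
    omega

end Kernel
end STC

namespace STC

/-! ### The rule inside G[A], read off from degrees -/

section Alive

open scoped Classical in
/-- The neighbours of `v` in `A`. -/
noncomputable def nbhdIn {V : Type*} (G : SimpleGraph V) (A : Finset V) (v : V) : Finset V :=
  A.filter (G.Adj v)

open scoped Classical in
/-- The closed neighbourhood of `v` in `A`. -/
noncomputable def closedNbhdIn {V : Type*} (G : SimpleGraph V) (A : Finset V) (v : V) : Finset V :=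
  insert v (nbhdIn G A v)

/-- The degree of `v` into `A`. -/
noncomputable def degIn {V : Type*} (G : SimpleGraph V) (A : Finset V) (v : V) : ℕ :=
  (nbhdIn G A v).card

/-- `v` is simplicial in `G[A]`. -/
def SimplicialIn {V : Type*} (G : SimpleGraph V) (A : Finset V) (v : V) : Prop :=
  ∀ a ∈ closedNbhdIn G A v, ∀ b ∈ closedNbhdIn G A v, a ≠ b → G.Adj a b

/-- The sum of the degree excesses of the neighbours of `v`. -/
noncomputable def excess {V : Type*} (G : SimpleGraph V) (A : Finset V) (v : V) : ℕ :=
  ∑ u ∈ nbhdIn G A v, (degIn G A u - degIn G A v)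

/-- The number of neighbours of `v` of the same degree. -/
noncomputable def equalDeg {V : Type*} (G : SimpleGraph V) (A : Finset V) (v : V) : ℕ :=
  ((nbhdIn G A v).filter fun u => degIn G A u = degIn G A v).card

variable {V : Type*} {G : SimpleGraph V} {A : Finset V} {v : V}

theorem mem_nbhdIn {u : V} : u ∈ nbhdIn G A v ↔ u ∈ A ∧ G.Adj v u := by
  simp [nbhdIn]

theorem mem_closedNbhdIn {u : V} : u ∈ closedNbhdIn G A v ↔ u = v ∨ u ∈ A ∧ G.Adj v u := by
  simp [closedNbhdIn, mem_nbhdIn]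

theorem self_mem_closedNbhdIn : v ∈ closedNbhdIn G A v := mem_closedNbhdIn.2 (Or.inl rfl)

theorem closedNbhdIn_subset (hv : v ∈ A) : closedNbhdIn G A v ⊆ A := by
  intro u hu
  rcases mem_closedNbhdIn.1 hu with rfl | h
  · exact hv
  · exact h.1

theorem card_closedNbhdIn : (closedNbhdIn G A v).card = degIn G A v + 1 := by
  classical
  rw [closedNbhdIn, Finset.card_insert_of_notMem, degIn]
  simp [mem_nbhdIn]

/-- Deletion only shrinks neighbourhoods; this is why a vertex once found simplicial is never tested
again. -/
theorem SimplicialIn.mono {B : Finset V} (h : SimplicialIn G A v) (hB : B ⊆ A) :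
    SimplicialIn G B v := by
  have : closedNbhdIn G B v ⊆ closedNbhdIn G A v := by
    intro u hu
    rw [mem_closedNbhdIn] at hu ⊢
    exact hu.imp_right fun h => ⟨hB h.1, h.2⟩
  exact fun a ha b hb => h a (this ha) b (this hb)

theorem SimplicialIn.subset (h : SimplicialIn G A v) (hv : v ∈ A) {u : V}
    (hu : u ∈ closedNbhdIn G A v) : closedNbhdIn G A v ⊆ closedNbhdIn G A u := by
  intro w hw
  by_cases hwu : w = u
  · exact mem_closedNbhdIn.2 (Or.inl hwu)
  · exact mem_closedNbhdIn.2 (Or.inr ⟨closedNbhdIn_subset hv hw, h u hu w hw (Ne.symm hwu)⟩)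

theorem mem_closedNbhd_induce {u w : (A : Set V)} :
    w ∈ closedNbhd (G.induce A) u ↔ w.1 ∈ closedNbhdIn G A u.1 := by
  have hw : w.1 ∈ A := w.2
  rw [mem_closedNbhd, mem_closedNbhdIn, Subtype.ext_iff]
  simp [hw]

theorem image_closedNbhd_induce (u : (A : Set V)) :
    Subtype.val '' closedNbhd (G.induce A) u = (closedNbhdIn G A u.1 : Set V) := by
  ext w
  constructor
  · rintro ⟨x, hx, rfl⟩
    exact mem_closedNbhd_induce.1 hx
  · intro hw
    exact ⟨⟨w, closedNbhdIn_subset u.2 hw⟩, mem_closedNbhd_induce.2 hw, rfl⟩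

theorem isClique_closedNbhd_induce (u : (A : Set V)) :
    (G.induce A).IsClique (closedNbhd (G.induce A) u) ↔ SimplicialIn G A u.1 := by
  constructor
  · intro h a ha b hb hab
    have ha' := closedNbhdIn_subset u.2 ha
    have hb' := closedNbhdIn_subset u.2 hb
    exact @h ⟨a, ha'⟩ (mem_closedNbhd_induce.2 ha) ⟨b, hb'⟩ (mem_closedNbhd_induce.2 hb)
      (fun h => hab (congrArg Subtype.val h))
  · intro h a ha b hb hab
    exact h a (mem_closedNbhd_induce.1 ha) b (mem_closedNbhd_induce.1 hb)
      (fun h => hab (Subtype.ext h))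

/-- Since `v` is simplicial, the closed neighbourhood of `u` contains that of `v`, and the
neighbours of `u` outside are counted by a difference of cardinalities; the truncated subtraction is
exact. -/
theorem card_outside (h : SimplicialIn G A v) (hv : v ∈ A) {u : V}
    (hu : u ∈ closedNbhdIn G A v) [DecidableEq V] [DecidableRel G.Adj] :
    ((A \ closedNbhdIn G A v).filter (G.Adj u)).card = degIn G A u - degIn G A v := by
  have : (A \ closedNbhdIn G A v).filter (G.Adj u) = closedNbhdIn G A u \ closedNbhdIn G A v := by
    ext w
    rw [Finset.mem_filter, Finset.mem_sdiff, Finset.mem_sdiff, mem_closedNbhdIn (v := u)]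
    constructor
    · rintro ⟨⟨h1, h2⟩, h3⟩
      exact ⟨Or.inr ⟨h1, h3⟩, h2⟩
    · rintro ⟨rfl | h1, h2⟩
      · exact absurd hu h2
      · exact ⟨⟨h1.1, h2⟩, h1.2⟩
  rw [this, Finset.card_sdiff_of_subset (h.subset hv hu), card_closedNbhdIn, card_closedNbhdIn]
  omega

theorem sum_closedNbhdIn_eq_excess :
    ∑ u ∈ closedNbhdIn G A v, (degIn G A u - degIn G A v) = excess G A v := by
  classical
  rw [closedNbhdIn, Finset.sum_insert (by simp [mem_nbhdIn]), excess]
  simp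

/-- A cut edge has exactly one end inside, so it is one pair (inner end, outer end); for a fixed
inner end the pairs are counted by `card_outside`. -/
theorem ncard_boundary_induce (h : SimplicialIn G A v) (hv : v ∈ A) :
    (boundary (G.induce A) (closedNbhd (G.induce A) ⟨v, hv⟩)).ncard = excess G A v := by
  classical
  set T := (closedNbhdIn G A v).sigma fun a => (A \ closedNbhdIn G A v).filter (G.Adj a) with hT
  have hTc : T.card = excess G A v := by
    rw [hT, Finset.card_sigma, ← sum_closedNbhdIn_eq_excess]
    exact Finset.sum_congr rfl fun u hu => card_outside h hv hu
  have himg : Sym2.map Subtype.val '' (boundary (G.induce A) (closedNbhd (G.induce A) ⟨v, hv⟩)) =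
      (fun p : (_ : V) × V => s(p.1, p.2)) '' (T : Set ((_ : V) × V)) := by
    ext e
    constructor
    · rintro ⟨_, ⟨a, ha, b, hb, hab, rfl⟩, rfl⟩
      refine ⟨⟨a, b⟩, ?_, rfl⟩
      rw [Finset.mem_coe, hT, Finset.mem_sigma, Finset.mem_filter, Finset.mem_sdiff]
      exact ⟨mem_closedNbhd_induce.1 ha, ⟨b.2, fun h => hb (mem_closedNbhd_induce.2 h)⟩, hab⟩
    · rintro ⟨⟨a, b⟩, hp, rfl⟩
      rw [Finset.mem_coe, hT, Finset.mem_sigma, Finset.mem_filter, Finset.mem_sdiff] at hp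
      obtain ⟨ha, ⟨hb, hb'⟩, hab⟩ := hp
      refine ⟨s(⟨a, closedNbhdIn_subset hv ha⟩, ⟨b, hb⟩), ⟨_, mem_closedNbhd_induce.2 ha, _,
        fun h => hb' (mem_closedNbhd_induce.1 h), SimpleGraph.induce_adj.2 hab, rfl⟩, rfl⟩
  rw [← Set.ncard_image_of_injective _ (Sym2.map.injective Subtype.val_injective), himg,
    Set.InjOn.ncard_image, Set.ncard_coe_finset, hTc]
  rintro ⟨a, b⟩ hp ⟨c, d⟩ hq heq
  rw [Finset.mem_coe, hT, Finset.mem_sigma, Finset.mem_filter, Finset.mem_sdiff] at hp hq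
  rcases Sym2.eq_iff.1 heq with ⟨h1, h2⟩ | ⟨h1, h2⟩
  · dsimp only at h1 h2; rw [h1, h2]
  · dsimp only at h1 h2 hp hq
    exact absurd (h1 ▸ hp.1) hq.2.1.2

/-- For simplicial `v`, the inclusion of closed neighbourhoods at a neighbour is an equality exactly
when the degrees agree. The summand 1 is `v` itself. -/
theorem ncard_twins_induce (h : SimplicialIn G A v) (hv : v ∈ A) :
    (twins (G.induce A) ⟨v, hv⟩).ncard = equalDeg G A v + 1 := by
  classical
  have himg : Subtype.val '' (twins (G.induce A) ⟨v, hv⟩) =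
      (insert v ((nbhdIn G A v).filter fun u => degIn G A u = degIn G A v) : Finset V) := by
    ext u
    have key : ∀ hu : u ∈ A, (⟨u, hu⟩ : (A : Set V)) ∈ twins (G.induce A) ⟨v, hv⟩ ↔
        closedNbhdIn G A u = closedNbhdIn G A v := by
      intro hu
      have : (⟨u, hu⟩ : (A : Set V)) ∈ twins (G.induce A) ⟨v, hv⟩ ↔
        closedNbhd (G.induce A) ⟨u, hu⟩ = closedNbhd (G.induce A) ⟨v, hv⟩ := Iff.rfl
      rw [this, ← (Set.image_injective.2 Subtype.val_injective).eq_iff,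
        image_closedNbhd_induce, image_closedNbhd_induce, Finset.coe_inj]
    rw [Finset.mem_coe, Finset.mem_insert, Finset.mem_filter]
    constructor
    · rintro ⟨⟨x, hx⟩, hxt, rfl⟩
      rw [key] at hxt
      have hx' : x ∈ closedNbhdIn G A v := hxt ▸ self_mem_closedNbhdIn
      rcases mem_closedNbhdIn.1 hx' with h | h
      · exact Or.inl h
      · refine Or.inr ⟨mem_nbhdIn.2 h, ?_⟩
        have := congrArg Finset.card hxt
        rw [card_closedNbhdIn, card_closedNbhdIn] at this
        dsimp only at this ⊢
        omega
    · rintro (rfl | ⟨h1, h2⟩)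
      · exact ⟨⟨u, hv⟩, self_mem_twins _ _, rfl⟩
      · have hu := mem_nbhdIn.1 h1
        refine ⟨⟨u, hu.1⟩, (key hu.1).2 ?_, rfl⟩
        refine (Finset.eq_of_subset_of_card_le (h.subset hv (mem_closedNbhdIn.2 (Or.inr hu))) ?_).symm
        rw [card_closedNbhdIn, card_closedNbhdIn, h2]
  rw [← Set.ncard_image_of_injective _ Subtype.val_injective, himg, Set.ncard_coe_finset,
    Finset.card_insert_of_notMem (by simp [mem_nbhdIn]), equalDeg]

/-- The strict inequality of the rule becomes `≤` because `equalDeg` leaves out `v`. -/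
theorem removableAt_induce_iff (hv : v ∈ A) :
    RemovableAt (G.induce A) ⟨v, hv⟩ ↔ SimplicialIn G A v ∧ excess G A v ≤ equalDeg G A v := by
  rw [RemovableAt, isClique_closedNbhd_induce]
  refine and_congr_right fun h => ?_
  rw [ncard_boundary_induce h hv, ncard_twins_induce h hv, Nat.lt_succ_iff]

theorem ruleStep_closedNbhdIn [DecidableEq V] (hv : v ∈ A) (h : SimplicialIn G A v)
    (hle : excess G A v ≤ equalDeg G A v) (k : ℤ) :
    RuleStep G (A, k) ((A \ closedNbhdIn G A v : Finset V), k - excess G A v) := by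
  rw [ruleStep_iff]
  refine ⟨⟨v, hv⟩, (removableAt_induce_iff hv).2 ⟨h, hle⟩, ?_, ?_⟩
  · rw [image_closedNbhd_induce, Finset.coe_sdiff]
  · rw [ncard_boundary_induce h hv]

theorem reduced_induce_of (h : ∀ v ∈ A, SimplicialIn G A v → equalDeg G A v < excess G A v) :
    Reduced (G.induce A) := by
  rw [reduced_iff]
  rintro ⟨v, hv⟩ hr
  obtain ⟨h1, h2⟩ := (removableAt_induce_iff hv).1 hr
  exact absurd h2 (not_le.2 (h v hv h1))

/-- At most `excess` vertices outside the closed neighbourhood of `v` touch it. -/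
theorem card_touching_le [DecidableEq V] [DecidableRel G.Adj] (hv : v ∈ A)
    (h : SimplicialIn G A v) :
    ((A \ closedNbhdIn G A v).filter fun w => ∃ u ∈ closedNbhdIn G A v, G.Adj u w).card ≤
      excess G A v := by
  have : ((A \ closedNbhdIn G A v).filter fun w => ∃ u ∈ closedNbhdIn G A v, G.Adj u w) =
      (closedNbhdIn G A v).biUnion fun u => (A \ closedNbhdIn G A v).filter (G.Adj u) := by
    ext w; simp only [Finset.mem_filter, Finset.mem_biUnion]; tauto
  rw [this, ← sum_closedNbhdIn_eq_excess]
  exact Finset.card_biUnion_le.trans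
    (Finset.sum_le_sum fun u hu => (card_outside h hv hu).le)

theorem equalDeg_le_degIn : equalDeg G A v ≤ degIn G A v := Finset.card_filter_le _ _

/-- Isolated vertices can be deleted by the rule. -/
theorem reflTransGen_of_isolated [DecidableEq V] (k : ℤ) (I : Finset V) (B : Finset V)
    (hI : ∀ v ∈ I, ∀ w, ¬ G.Adj v w) :
    Relation.ReflTransGen (RuleStep G) (B, k) ((B \ I : Finset V), k) := by
  induction I using Finset.induction_on with
  | empty => simpa using Relation.ReflTransGen.refl
  | insert v I hvI ih =>
    have ih := ih fun x hx => hI x (Finset.mem_insert_of_mem hx)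
    have hv : ∀ w, ¬ G.Adj v w := hI v (Finset.mem_insert_self v I)
    by_cases hvB : v ∈ B
    · refine ih.tail ?_
      -- An isolated vertex is its own closed neighbourhood and has an empty cut: the rule applies
      -- and `k` stays the same.
      have h0 : nbhdIn G (B \ I) v = ∅ := by
        ext w; simp [mem_nbhdIn, hv]
      have hc : closedNbhdIn G (B \ I) v = {v} := by
        ext w; simp [mem_closedNbhdIn, hv]
      have := ruleStep_closedNbhdIn (G := G) (A := B \ I) (v := v) (by simp [hvB, hvI])
        (by intro a ha b hb hab; simp [hc] at ha hb; exact absurd (ha.trans hb.symm) hab)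
        (by simp [excess, h0]) k
      have he : excess G (B \ I) v = 0 := by simp [excess, h0]
      rw [he, hc] at this
      have hset : B \ insert v I = (B \ I) \ {v} := by
        ext w; simp; tauto
      rw [hset]
      simpa using this
    · have : B \ insert v I = B \ I := by
        ext w; simp only [Finset.mem_sdiff, Finset.mem_insert]
        constructor
        · tauto
        · rintro ⟨h1, h2⟩
          exact ⟨h1, by rintro (rfl | h) <;> tauto⟩
      rw [this]; exact ih

end Alive
end STC

namespace STC

/-! ### Reasoning about programs and their running time -/

section Machine

namespace State

@[simp] theorem setReg_reg (s : State) (x v y : ℕ) :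
    (s.setReg x v).reg y = if y = x then v else s.reg y := by
  simp [setReg, Function.update_apply]

@[simp] theorem setReg_arr (s : State) (x v : ℕ) : (s.setReg x v).arr = s.arr := rfl

@[simp] theorem setArr_reg (s : State) (a i v : ℕ) : (s.setArr a i v).reg = s.reg := rfl

@[simp] theorem setArr_arr (s : State) (a i v b j : ℕ) :
    (s.setArr a i v).arr b j = if b = a then (if j = i then v else s.arr a j) else s.arr b j := by
  by_cases h : b = a
  · subst h; simp [setArr, Function.update_apply]
  · simp [setArr, h]

theorem setArr_arr_of_ne (s : State) {a b : ℕ} (i v : ℕ) (h : b ≠ a) :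
    (s.setArr a i v).arr b = s.arr b := by
  simp [setArr, h]

end State

attribute [simp] Expr.eval Test.holds

/-- The registers written by a program. -/
def Program.modR : Program → List ℕ
  | .skip => []
  | .assign x _ => [x]
  | .write _ _ _ => []
  | .seq p q => p.modR ++ q.modR
  | .ite _ p q => p.modR ++ q.modR
  | .loop _ p => p.modR

/-- The arrays written by a program. -/
def Program.modA : Program → List ℕ
  | .skip => []
  | .assign _ _ => []
  | .write a _ _ => [a]
  | .seq p q => p.modA ++ q.modA
  | .ite _ p q => p.modA ++ q.modA
  | .loop _ p => p.modA

/-- The states agree outside the registers `R` and the arrays `A`. -/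
def Frame (R A : List ℕ) (s s' : State) : Prop :=
  (∀ x, x ∉ R → s'.reg x = s.reg x) ∧ ∀ a, a ∉ A → s'.arr a = s.arr a

theorem Frame.refl (R A : List ℕ) (s : State) : Frame R A s s :=
  ⟨fun _ _ => rfl, fun _ _ => rfl⟩

theorem Frame.trans {R A : List ℕ} {s₁ s₂ s₃ : State} (h : Frame R A s₁ s₂)
    (h' : Frame R A s₂ s₃) : Frame R A s₁ s₃ :=
  ⟨fun x hx => (h'.1 x hx).trans (h.1 x hx), fun a ha => (h'.2 a ha).trans (h.2 a ha)⟩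

theorem Frame.mono {R A R' A' : List ℕ} {s s' : State} (h : Frame R A s s') (hR : R ⊆ R')
    (hA : A ⊆ A') : Frame R' A' s s' :=
  ⟨fun x hx => h.1 x fun h' => hx (hR h'), fun a ha => h.2 a fun h' => ha (hA h')⟩

theorem Exec.frame {W : ℕ} {p : Program} {s s' : State} {t : ℕ} (h : Exec W p s s' t) :
    Frame p.modR p.modA s s' := by
  induction h with
  | skip => exact Frame.refl _ _ _
  | assign s x e =>
    refine ⟨fun y hy => ?_, fun _ _ => rfl⟩
    have hy : y ≠ x := by simpa [Program.modR] using hy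
    simp [hy]
  | write s a i e =>
    refine ⟨fun _ _ => rfl, fun b hb => ?_⟩
    have hb : b ≠ a := by simpa [Program.modA] using hb
    exact State.setArr_arr_of_ne s _ _ hb
  | seq _ _ ih1 ih2 =>
    exact (ih1.mono (List.subset_append_left _ _) (List.subset_append_left _ _)).trans
      (ih2.mono (List.subset_append_right _ _) (List.subset_append_right _ _))
  | ite_true _ _ ih => exact ih.mono (List.subset_append_left _ _) (List.subset_append_left _ _)
  | ite_false _ _ ih => exact ih.mono (List.subset_append_right _ _) (List.subset_append_right _ _)
  | loop_done => exact Frame.refl _ _ _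
  | loop_step _ _ _ ih1 ih2 => exact ih1.trans ih2

/-- The program halts within `B` operations in a state satisfying `Q`. -/
def Runs (W : ℕ) (p : Program) (s : State) (B : ℕ) (Q : State → Prop) : Prop :=
  ∃ s' t, Exec W p s s' t ∧ t ≤ B ∧ Q s'

variable {W : ℕ} {p q : Program} {s : State} {B : ℕ} {Q : State → Prop}

theorem Runs.mono {B' : ℕ} {Q' : State → Prop} (h : Runs W p s B Q) (hB : B ≤ B')
    (hQ : ∀ s', Q s' → Q' s') : Runs W p s B' Q' := by
  obtain ⟨s', t, h1, h2, h3⟩ := h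
  exact ⟨s', t, h1, h2.trans hB, hQ s' h3⟩

theorem Runs.frame (h : Runs W p s B Q) :
    Runs W p s B fun s' => Q s' ∧ Frame p.modR p.modA s s' := by
  obtain ⟨s', t, h1, h2, h3⟩ := h
  exact ⟨s', t, h1, h2, h3, h1.frame⟩

/-- The second program also receives the frame of the first, so intermediate assertions need not
mention cells that were not written. -/
theorem Runs.seq {B' : ℕ} {R : State → Prop} (h : Runs W p s B R)
    (h' : ∀ s', R s' → Frame p.modR p.modA s s' → Runs W q s' B' Q) :
    Runs W (.seq p q) s (B + B') Q := by
  obtain ⟨s₁, t₁, h1, h2, h3⟩ := h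
  obtain ⟨s₂, t₂, h4, h5, h6⟩ := h' s₁ h3 h1.frame
  exact ⟨s₂, _, .seq h1 h4, Nat.add_le_add h2 h5, h6⟩

theorem Runs.ite {b : Test} (h : b.holds s → Runs W p s B Q) (h' : ¬ b.holds s → Runs W q s B Q) :
    Runs W (.ite b p q) s (b.cost + B + 1) Q := by
  by_cases hb : b.holds s
  · obtain ⟨s', t, h1, h2, h3⟩ := h hb
    exact ⟨s', _, .ite_true hb h1, by omega, h3⟩
  · obtain ⟨s', t, h1, h2, h3⟩ := h' hb
    exact ⟨s', _, .ite_false hb h1, by omega, h3⟩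

/-- The weakest precondition of a loop-free program. -/
def wlp (W : ℕ) : Program → (State → Prop) → State → Prop
  | .skip, Q, s => Q s
  | .assign x e, Q, s => e.eval s ≤ W ∧ Q (s.setReg x (e.eval s))
  | .write a i e, Q, s =>
    i.eval s ≤ W ∧ e.eval s ≤ W ∧ Q (s.setArr a (i.eval s) (e.eval s))
  | .seq p q, Q, s => wlp W p (wlp W q Q) s
  | .ite b p q, Q, s => (b.holds s → wlp W p Q s) ∧ (¬ b.holds s → wlp W q Q s)
  | .loop _ _, _, _ => False

/-- The cost of a loop-free program. -/
def Program.maxCost : Program → ℕ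
  | .skip => 1
  | .assign _ e => e.cost + 1
  | .write _ i e => i.cost + e.cost + 1
  | .seq p q => p.maxCost + q.maxCost
  | .ite b p q => b.cost + max p.maxCost q.maxCost + 1
  | .loop _ _ => 0

theorem Runs.of_wlp (h : wlp W p Q s) : Runs W p s p.maxCost Q := by
  induction p generalizing s Q with
  | skip => exact ⟨s, 1, .skip s, le_rfl, h⟩
  | assign x e => exact ⟨_, _, .assign s x e h.1, le_rfl, h.2⟩
  | write a i e => exact ⟨_, _, .write s a i e h.1 h.2.1, le_rfl, h.2.2⟩
  | seq p q ihp ihq => exact Runs.seq (ihp h) fun s' h' _ => ihq h'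
  | ite b p q ihp ihq =>
    exact Runs.ite (fun hb => (ihp (h.1 hb)).mono (le_max_left _ _) fun _ h => h)
      (fun hb => (ihq (h.2 hb)).mono (le_max_right _ _) fun _ h => h)
  | loop => exact h.elim

/-- The index of the invariant is a potential: each pass lowers it, so there are at most `j` passes
and one failing test. -/
theorem Runs.loop {b : Test} {j : ℕ} (Inv : ℕ → State → Prop)
    (h : ∀ j s, Inv j s → b.holds s → Runs W p s B fun s' => ∃ j' < j, Inv j' s')
    (h0 : Inv j s) :
    Runs W (.loop b p) s ((j + 1) * (B + b.cost + 1))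
      fun s' => (∃ j', Inv j' s') ∧ ¬ b.holds s' := by
  induction j using Nat.strong_induction_on generalizing s with
  | _ j ih =>
    by_cases hb : b.holds s
    · obtain ⟨s₁, t₁, h1, h2, j', hj', h3⟩ := h j s h0 hb
      obtain ⟨s₂, t₂, h4, h5, h6⟩ := ih j' hj' h3
      refine ⟨s₂, _, .loop_step hb h1 h4, ?_, h6⟩
      have : (j' + 1) * (B + b.cost + 1) ≤ j * (B + b.cost + 1) := Nat.mul_le_mul_right _ hj'
      have : (j + 1) * (B + b.cost + 1) = j * (B + b.cost + 1) + (B + b.cost + 1) := by ring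
      omega
    · refine ⟨s, _, .loop_done hb, ?_, ⟨j, h0⟩, hb⟩
      have : (j + 1) * (B + b.cost + 1) = j * (B + b.cost + 1) + (B + b.cost + 1) := by ring
      omega

/-- Run `body` with register `x` equal to `0, 1, …, N - 1`, where `N` is in register `y`. -/
def Program.forLoop (x y : ℕ) (body : Program) : Program :=
  .seq (.assign x (.const 0))
    (.loop (.lt (.reg x) (.reg y)) (.seq body (.assign x (.add (.reg x) (.const 1)))))

/-- In each iteration the test and the increment cost 4 each, whence the 8; the initial assignment
and the last test cost 6 and are covered by the extra iteration in `N + 1`. Using `wlp` restricts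
the body to loop-free programs. -/
theorem Runs.forLoop {x y N : ℕ} {body : Program} (Inv : ℕ → State → Prop)
    (hNdef : s.reg y = N) (hN : N ≤ W) (hxy : y ≠ x) (hxb : x ∉ body.modR) (hyb : y ∉ body.modR)
    (h0 : Inv 0 (s.setReg x 0))
    (hstep : ∀ i s₁, i < N → Frame (x :: body.modR) body.modA s s₁ → s₁.reg x = i →
      Inv i s₁ → wlp W body (fun s₂ => Inv (i + 1) (s₂.setReg x (i + 1))) s₁) :
    Runs W (.forLoop x y body) s ((N + 1) * (body.maxCost + 8)) fun s' => Inv N s' := by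
  have key : ∀ j i s₁, i + j = N → Frame (x :: body.modR) body.modA s s₁ → s₁.reg x = i →
      Inv i s₁ → Runs W (.loop (.lt (.reg x) (.reg y))
        (.seq body (.assign x (.add (.reg x) (.const 1))))) s₁ (j * (body.maxCost + 8) + 4)
        fun s' => Inv N s' := by
    intro j
    induction j with
    | zero =>
      intro i s₁ hi hf hx hI
      have hiN : i = N := by omega
      have hy : s₁.reg y = N := by rw [hf.1 y (by simp [hxy, hyb]), hNdef]
      exact ⟨s₁, _, .loop_done (by simp [hx, hy, hiN]), by simp [Test.cost, Expr.cost], hiN ▸ hI⟩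
    | succ j ih =>
      intro i s₁ hi hf hx hI
      have hy : s₁.reg y = N := by rw [hf.1 y (by simp [hxy, hyb]), hNdef]
      obtain ⟨s₂, t₂, h1, h2, h3⟩ := Runs.of_wlp (hstep i s₁ (by omega) hf hx hI)
      have hx2 : s₂.reg x = i := by rw [h1.frame.1 x hxb, hx]
      have hev : (Expr.add (.reg x) (.const 1)).eval s₂ = i + 1 := by simp [hx2]
      have hass := Exec.assign (W := W) s₂ x (.add (.reg x) (.const 1)) (by rw [hev]; omega)
      rw [hev] at hass
      have hf2 : Frame (x :: body.modR) body.modA s (s₂.setReg x (i + 1)) := by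
        refine hf.trans ((h1.frame.mono (List.subset_cons_self _ _) (List.Subset.refl _)).trans ?_)
        refine ⟨fun z hz => ?_, fun _ _ => rfl⟩
        have hz : z ≠ x := fun h => hz (by simp [h])
        simp [hz]
      obtain ⟨s₃, t₃, h4, h5, h6⟩ := ih (i + 1) _ (by omega) hf2 (by simp) h3
      refine ⟨s₃, _, .loop_step (by simp [hx, hy]; omega) (.seq h1 hass) h4, ?_, h6⟩
      have : (j + 1) * (body.maxCost + 8) = j * (body.maxCost + 8) + (body.maxCost + 8) := by ring
      simp only [Test.cost, Expr.cost]
      omega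
  obtain ⟨s', t, h1, h2, h3⟩ := key N 0 (s.setReg x 0) (by omega)
    ⟨fun z hz => by
      have hz : z ≠ x := fun h => hz (by simp [h])
      simp [hz], fun _ _ => rfl⟩ (by simp) h0
  refine ⟨s', _, .seq (.assign s x (.const 0) (by simp)) h1, ?_, h3⟩
  have : (N + 1) * (body.maxCost + 8) = N * (body.maxCost + 8) + (body.maxCost + 8) := by ring
  simp only [Expr.cost]
  omega

end Machine
end STC

namespace STC

/-! ### Scans over the darts -/

section Phases

open Program (forLoop)

/-- The source of the dart numbered by register `4`. -/
def dartSrc : Expr := .read 2 (.reg 4)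

/-- The target of the dart numbered by register `4`. -/
def dartTgt : Expr := .read 1 (.reg 4)

@[simp] theorem dartSrc_eval (s : State) : dartSrc.eval s = s.arr 2 (s.reg 4) := rfl

@[simp] theorem dartTgt_eval (s : State) : dartTgt.eval s = s.arr 1 (s.reg 4) := rfl

/-- Register `3` holds the number of darts; arrays `2` and `1` hold their sources and targets. -/
structure DartState (W : ℕ) (s : State) : Prop where
  size_le : s.reg 3 * s.reg 3 + s.reg 3 + 3 ≤ W
  tgt_le : ∀ p < s.reg 3, s.arr 1 p ≤ W
  src_le : ∀ p < s.reg 3, s.arr 2 p ≤ W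
  src_eq_tgt : ∀ p < s.reg 3, ∃ q < s.reg 3, s.arr 1 q = s.arr 2 p

variable {W : ℕ} {s : State}

theorem DartState.num_le (h : DartState W s) : s.reg 3 + 3 ≤ W := by
  have := h.size_le
  nlinarith [Nat.zero_le (s.reg 3 * s.reg 3)]

theorem DartState.of_frame {s' : State} (h : DartState W s) {R A : List ℕ}
    (hf : Frame R A s s') (h3 : 3 ∉ R) (h1 : 1 ∉ A) (h2 : 2 ∉ A) : DartState W s' := by
  have e3 := hf.1 3 h3
  have e1 := hf.2 1 h1
  have e2 := hf.2 2 h2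
  constructor
  · rw [e3]; exact h.size_le
  · rw [e3, e1]; exact h.tgt_le
  · rw [e3, e2]; exact h.src_le
  · rw [e3, e2, e1]; exact h.src_eq_tgt

/-- A loop over the darts. -/
theorem Runs.dartLoop (hD : DartState W s) {body : Program} (Inv : ℕ → State → Prop)
    (h4 : 4 ∉ body.modR) (h3 : 3 ∉ body.modR) (h1 : 1 ∉ body.modA) (h2 : 2 ∉ body.modA)
    (h0 : Inv 0 (s.setReg 4 0))
    (hstep : ∀ i s₁, i < s.reg 3 → Frame (4 :: body.modR) body.modA s s₁ → s₁.reg 4 = i →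
      s₁.arr 1 = s.arr 1 → s₁.arr 2 = s.arr 2 → s.arr 1 i ≤ W → s.arr 2 i ≤ W →
      Inv i s₁ → wlp W body (fun s₂ => Inv (i + 1) (s₂.setReg 4 (i + 1))) s₁) :
    Runs W (Program.forLoop 4 3 body) s ((s.reg 3 + 1) * (body.maxCost + 8))
      fun s' => Inv (s.reg 3) s' :=
  Runs.forLoop Inv rfl (by have := hD.num_le; omega) (by decide) h4 h3 h0
    fun i s₁ hi hf hx hI => hstep i s₁ hi hf hx (hf.2 1 h1) (hf.2 2 h2) (hD.tgt_le i hi)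
      (hD.src_le i hi) hI

/-- Find a dart whose target passes the test. -/
def search (b : Test) : Program :=
  .seq (.assign 6 (.const 0))
    (forLoop 4 3 (.ite b (.seq (.assign 6 (.const 1)) (.assign 5 dartTgt)) .skip))

/-- The scan never stops early; register 5 ends with the last match, but only the fact that it is a
match is used. -/
theorem runs_search (hD : DartState W s) {b : Test} (c : ℕ → Prop)
    (hb : ∀ s₁ : State, Frame [4, 5, 6] [] s s₁ → (b.holds s₁ ↔ c (s₁.arr 1 (s₁.reg 4)))) :
    Runs W (search b) s ((s.reg 3 + 1) * (b.cost + 20)) fun s' =>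
      (s'.reg 6 = 0 ∧ ∀ p < s.reg 3, ¬ c (s.arr 1 p)) ∨
      (s'.reg 6 = 1 ∧ c (s'.reg 5) ∧ ∃ p < s.reg 3, s.arr 1 p = s'.reg 5) := by
  have hW := hD.num_le
  have key : Runs W (search b) s _ _ :=
    Runs.seq (Runs.of_wlp (Q := fun s' => s'.reg 6 = 0) (by simp [wlp]))
    (fun s₁ h6 hf => Runs.forLoop (N := s.reg 3) (fun i s' =>
      (s'.reg 6 = 0 ∧ ∀ p < i, ¬ c (s.arr 1 p)) ∨
      (s'.reg 6 = 1 ∧ c (s'.reg 5) ∧ ∃ p < i, s.arr 1 p = s'.reg 5))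
      (hf.1 3 (by decide)) (by omega) (by decide) (by simp [Program.modR])
      (by simp [Program.modR]) (by simp [h6]) ?_)
  · refine key.mono ?_ fun _ h => h
    simp [Program.maxCost, Expr.cost, dartTgt]
    nlinarith
  · intro i s₂ hi hf2 h4 hI
    have hf3 : Frame [4, 5, 6] [] s s₂ :=
      (hf.mono (by simp [Program.modR]) (by simp [Program.modA])).trans
        (hf2.mono (by simp [Program.modR]) (by simp [Program.modA]))
    have hb2 := hb s₂ hf3
    have ht : s₂.arr 1 = s.arr 1 := hf3.2 1 (by decide)
    rw [ht, h4] at hb2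
    have hle := hD.tgt_le i hi
    simp only [wlp, hb2]
    refine ⟨fun hc => ?_, fun hc => ?_⟩
    · simp [h4, ht, hle, hc]
      exact ⟨by omega, i, by omega, rfl⟩
    · simp
      rcases hI with ⟨h1, h2⟩ | ⟨h1, h2, p, hp, h3⟩
      · refine Or.inl ⟨h1, fun p hp => ?_⟩
        rcases Nat.lt_succ_iff_lt_or_eq.1 (Nat.lt_succ_of_le hp) with h | rfl
        · exact h2 p h
        · exact hc
      · exact Or.inr ⟨h1, h2, p, by omega, h3⟩

/-- Clear three arrays at all vertices that are not isolated. -/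
def clearScratch : Program :=
  forLoop 4 3 (.seq (.write 5 dartTgt (.const 0))
    (.seq (.write 6 dartTgt (.const 0)) (.write 7 dartTgt (.const 0))))

theorem runs_clearScratch (hD : DartState W s) :
    Runs W clearScratch s ((s.reg 3 + 1) * 100) fun s' =>
      ∀ p < s.reg 3, s'.arr 5 (s.arr 1 p) = 0 ∧ s'.arr 6 (s.arr 1 p) = 0 ∧
        s'.arr 7 (s.arr 1 p) = 0 := by
  refine Runs.mono (Runs.dartLoop hD (fun i s' => ∀ p < i, s'.arr 5 (s.arr 1 p) = 0 ∧
    s'.arr 6 (s.arr 1 p) = 0 ∧ s'.arr 7 (s.arr 1 p) = 0)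
    (by decide) (by decide) (by decide) (by decide) (by simp) ?_) ?_ fun _ h => h
  · intro i s₁ hi hf h4 ht hs hle1 hle2 hI
    simp [wlp, h4, ht, hle1]
    intro p hp
    rcases Nat.lt_succ_iff_lt_or_eq.1 (Nat.lt_succ_of_le hp) with h | rfl
    · obtain ⟨h1, h2, h3⟩ := hI p h
      simp [h1, h2, h3]
    · simp
  · exact Nat.mul_le_mul_left _ (by decide)

open scoped Classical in
/-- Count, at their sources, the darts passing a test. -/
theorem runs_countDarts (hD : DartState W s) {b : Test} (c : ℕ → ℕ → Prop)
    (hb : ∀ s₁ : State, Frame [4] [5] s s₁ →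
      (b.holds s₁ ↔ c (s₁.arr 2 (s₁.reg 4)) (s₁.arr 1 (s₁.reg 4))))
    (h0 : ∀ p < s.reg 3, s.arr 5 (s.arr 1 p) = 0) :
    Runs W (forLoop 4 3 (.ite b (.write 5 dartSrc (.add (.read 5 dartSrc) (.const 1))) .skip)) s
      ((s.reg 3 + 1) * (b.cost + 30)) fun s' =>
      ∀ p < s.reg 3, s'.arr 5 (s.arr 1 p) =
        Nat.count (fun q => s.arr 2 q = s.arr 1 p ∧ c (s.arr 2 q) (s.arr 1 q)) (s.reg 3) := by
  have hW := hD.num_le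
  refine Runs.mono (Runs.dartLoop hD (fun i s' => ∀ p < s.reg 3, s'.arr 5 (s.arr 1 p) =
        Nat.count (fun q => s.arr 2 q = s.arr 1 p ∧ c (s.arr 2 q) (s.arr 1 q)) i)
    (by simp [Program.modR]) (by simp [Program.modR]) (by simp [Program.modA])
    (by simp [Program.modA]) (by simpa using h0) ?_) ?_ fun _ h => h
  · intro i s₁ hi hf h4 ht hs hle1 hle2 hI
    have hb2 := hb s₁ (hf.mono (by simp [Program.modR]) (by simp [Program.modA]))
    rw [ht, hs, h4] at hb2
    simp only [wlp, hb2]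
    refine ⟨fun hc => ?_, fun hc => ?_⟩
    -- The counters are known at targets of darts only; the source to be incremented is also the
    -- target of some dart.
    · obtain ⟨q, hq, hqe⟩ := hD.src_eq_tgt i hi
      have hv := hI q hq
      have hle := Nat.count_le
        (p := fun q' => s.arr 2 q' = s.arr 1 q ∧ c (s.arr 2 q') (s.arr 1 q')) (n := i)
      rw [hqe] at hv hle
      simp only [dartSrc_eval, Expr.eval, hs, h4, hle2, true_and, State.setReg_arr,
        State.setArr_arr, if_true]
      refine ⟨by omega, fun p hp => ?_⟩
      rw [Nat.count_succ]
      by_cases h : s.arr 1 p = s.arr 2 i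
      · rw [if_pos h, hv, if_pos ⟨h.symm, hc⟩, h]
      · rw [if_neg h, hI p hp, if_neg fun h' => h h'.1.symm]; rfl
    · intro p hp
      rw [State.setReg_arr, Nat.count_succ, if_neg fun h' => hc h'.2]
      exact hI p hp
  · refine Nat.mul_le_mul_left _ ?_
    simp [Program.maxCost, Expr.cost, dartSrc]

/-- Mark the vertex `v` in register `5` and its living neighbours; count the latter in
register `7`. -/
def markNbhd : Program :=
  .seq (forLoop 4 3 (.seq (.write 4 dartTgt (.const 0)) (.write 5 dartTgt (.const 0))))
  (.seq (.seq (.write 4 (.reg 5) (.const 1)) (.assign 7 (.const 0)))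
  (forLoop 4 3 (.ite (.and (.eq dartSrc (.reg 5)) (.not (.eq (.read 3 dartTgt) (.const 3))))
    (.seq (.write 4 dartTgt (.const 1)) (.assign 7 (.add (.reg 7) (.const 1)))) .skip)))

open scoped Classical in
theorem runs_markNbhd (hD : DartState W s) (hv : s.reg 5 ≤ W) :
    Runs W markNbhd s ((s.reg 3 + 1) * 100) fun s' =>
      (∀ p < s.reg 3, s'.arr 4 (s.arr 1 p) = 1 ↔ s.arr 1 p = s.reg 5 ∨
        ∃ q < s.reg 3, s.arr 2 q = s.reg 5 ∧ s.arr 1 q = s.arr 1 p ∧ s.arr 3 (s.arr 1 q) ≠ 3) ∧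
      (∀ p < s.reg 3, s'.arr 5 (s.arr 1 p) = 0) ∧
      s'.reg 7 = Nat.count (fun q => s.arr 2 q = s.reg 5 ∧ s.arr 3 (s.arr 1 q) ≠ 3) (s.reg 3) := by
  have hW := hD.num_le
  refine Runs.mono (Runs.seq (Runs.dartLoop hD (fun i s' => ∀ p < i, s'.arr 4 (s.arr 1 p) = 0 ∧
    s'.arr 5 (s.arr 1 p) = 0) (by decide) (by decide) (by decide) (by decide) (by simp) ?_)
    fun s₁ h1 hf1 => Runs.seq (Runs.of_wlp (Q := fun s' => s'.reg 7 = 0 ∧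
      ∀ p < s.reg 3, s'.arr 4 (s.arr 1 p) = (if s.arr 1 p = s.reg 5 then 1 else 0) ∧
      s'.arr 5 (s.arr 1 p) = 0) ?_) fun s₂ h2 hf2 => Runs.forLoop (N := s.reg 3) (fun i s' =>
      (∀ p < s.reg 3, s'.arr 4 (s.arr 1 p) = 1 ↔ s.arr 1 p = s.reg 5 ∨
        ∃ q < i, s.arr 2 q = s.reg 5 ∧ s.arr 1 q = s.arr 1 p ∧ s.arr 3 (s.arr 1 q) ≠ 3) ∧
      (∀ p < s.reg 3, s'.arr 5 (s.arr 1 p) = 0) ∧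
      s'.reg 7 = Nat.count (fun q => s.arr 2 q = s.reg 5 ∧ s.arr 3 (s.arr 1 q) ≠ 3) i)
      ?_ (by omega) (by decide) (by decide) (by decide) ?_ ?_) ?_ fun _ h => h
  · intro i s₁ hi hf h4 ht hs hle1 hle2 hI
    simp [wlp, h4, ht, hle1]
    intro p hp
    rcases Nat.lt_succ_iff_lt_or_eq.1 (Nat.lt_succ_of_le hp) with h | rfl
    · obtain ⟨h1, h2⟩ := hI p h
      simp [h1, h2]
    · simp
  · have h5 : s₁.reg 5 = s.reg 5 := hf1.1 5 (by decide)
    simp [wlp, h5, hv]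
    refine ⟨by omega, fun p hp => ?_⟩
    obtain ⟨h3, h4⟩ := h1 p hp
    simp [h3, h4]
  · exact (hf2.1 3 (by decide)).trans (hf1.1 3 (by decide))
  · simp only [State.setReg_arr, State.setReg_reg]
    refine ⟨fun p hp => ?_, fun p hp => (h2.2 p hp).2, ?_⟩
    · rw [(h2.2 p hp).1]; split <;> simp_all
    · simp [h2.1]
  · intro i s₃ hi hf3 h4 hI
    have hf := ((hf1.mono (R' := [4, 7]) (A' := [4, 5]) (by decide) (by decide)).trans
      (hf2.mono (by decide) (by decide))).trans (hf3.mono (by decide) (by decide))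
    have e1 := hf.2 1 (by decide)
    have e2 := hf.2 2 (by decide)
    have e3 := hf.2 3 (by decide)
    have e5 := hf.1 5 (by decide)
    obtain ⟨hI1, hI2, hI3⟩ := hI
    have hle := Nat.count_le
      (p := fun q => s.arr 2 q = s.reg 5 ∧ s.arr 3 (s.arr 1 q) ≠ 3) (n := i)
    have hle1 := hD.tgt_le i hi
    simp only [wlp, Test.holds, dartSrc_eval, dartTgt_eval, Expr.eval, h4, e1, e2, e3, e5,
      State.setArr_arr, State.setArr_reg, State.setReg_arr, State.setReg_reg, hI3]
    refine ⟨fun hc => ⟨hle1, by omega, by omega, ?_, ?_, ?_⟩, fun hc => ⟨?_, ?_, ?_⟩⟩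
    · intro p hp
      simp only [if_true]
      by_cases h : s.arr 1 p = s.arr 1 i
      · simp only [h, if_true, true_iff]
        exact Or.inr ⟨i, by omega, hc.1, rfl, hc.2⟩
      · rw [if_neg h, hI1 p hp]
        refine or_congr_right ⟨?_, ?_⟩
        · rintro ⟨q, hq, h1⟩; exact ⟨q, by omega, h1⟩
        · rintro ⟨q, hq, h1⟩
          refine ⟨q, ?_, h1⟩
          rcases Nat.lt_succ_iff_lt_or_eq.1 hq with h' | rfl
          · exact h'
          · exact absurd h1.2.1.symm h
    · intro p hp; simpa using hI2 p hp
    · simp only [Nat.count_succ, if_pos hc]; simp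
    · intro p hp
      rw [hI1 p hp]
      refine or_congr_right ⟨?_, ?_⟩
      · rintro ⟨q, hq, h1⟩; exact ⟨q, by omega, h1⟩
      · rintro ⟨q, hq, h1⟩
        refine ⟨q, ?_, h1⟩
        rcases Nat.lt_succ_iff_lt_or_eq.1 hq with h' | rfl
        · exact h'
        · exact absurd ⟨h1.1, h1.2.2⟩ hc
    · exact hI2
    · simp only [Nat.count_succ, if_neg hc]; simp
  · simp [Program.maxCost, Expr.cost, Test.cost, dartTgt, dartSrc]
    nlinarith

end Phases
end STC

namespace STC

/-! ### Testing simpliciality; degrees and excesses -/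

section Phases

open Program (forLoop)

variable {W : ℕ} {s : State}

theorem count_congr_of_lt {M : ℕ} {P Q : ℕ → Prop} {_ : DecidablePred P} {_ : DecidablePred Q}
    (h : ∀ q < M, P q ↔ Q q) : Nat.count P M = Nat.count Q M := by
  rw [Nat.count_eq_card_filter_range, Nat.count_eq_card_filter_range]
  exact congrArg Finset.card (Finset.filter_congr fun q hq => h q (Finset.mem_range.1 hq))

/-- The darts and the status of the vertices, as stored in a memory. -/
structure DartData where
  num : ℕ
  src : ℕ → ℕ
  tgt : ℕ → ℕ
  status : ℕ → ℕ

/-- The dart data stored in `s`. -/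
def State.darts (s : State) : DartData := ⟨s.reg 3, s.arr 2, s.arr 1, s.arr 3⟩

theorem State.darts_eq_of_frame {s' : State} {R A : List ℕ} (hf : Frame R A s s') (h3 : 3 ∉ R)
    (h1 : 1 ∉ A) (h2 : 2 ∉ A) (ha : 3 ∉ A) : s'.darts = s.darts := by
  simp only [State.darts, hf.1 3 h3, hf.2 1 h1, hf.2 2 h2, hf.2 3 ha]

/-- `u` is `v` or one of its living neighbours. -/
def Marked (D : DartData) (v u : ℕ) : Prop :=
  u = v ∨ ∃ q < D.num, D.src q = v ∧ D.tgt q = u ∧ D.status u ≠ 3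

open scoped Classical in
/-- The number of living neighbours of `v`. -/
noncomputable def livingDeg (D : DartData) (v : ℕ) : ℕ :=
  Nat.count (fun q => D.src q = v ∧ D.status (D.tgt q) ≠ 3) D.num

/-- What `markNbhd`, started in `s`, achieves. -/
structure MarkPost (s s' : State) : Prop where
  tgt : ∀ p < s.reg 3, s'.arr 4 (s.arr 1 p) = 1 ↔ Marked s.darts (s.reg 5) (s.arr 1 p)
  src : ∀ p < s.reg 3, s'.arr 4 (s.arr 2 p) = 1 ↔ Marked s.darts (s.reg 5) (s.arr 2 p)
  clear : ∀ p < s.reg 3, s'.arr 5 (s.arr 1 p) = 0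
  deg : s'.reg 7 = livingDeg s.darts (s.reg 5)

theorem runs_markNbhd_markPost (hD : DartState W s) (hv : s.reg 5 ≤ W) :
    Runs W markNbhd s ((s.reg 3 + 1) * 100) (MarkPost s) := by
  refine Runs.mono (runs_markNbhd hD hv) le_rfl ?_
  rintro s' ⟨h1, h2, h3⟩
  have key : ∀ p < s.reg 3, s'.arr 4 (s.arr 1 p) = 1 ↔ Marked s.darts (s.reg 5) (s.arr 1 p) := by
    intro p hp
    rw [h1 p hp, Marked]
    refine or_congr_right (exists_congr fun q => and_congr_right fun _ => and_congr_right fun _ => ?_)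
    constructor <;> rintro ⟨h, h'⟩
    · exact ⟨h, h ▸ h'⟩
    · exact ⟨h, by rw [show s.arr 1 q = s.arr 1 p from h]; exact h'⟩
  refine ⟨key, fun p hp => ?_, h2, h3⟩
  obtain ⟨q, hq, hqp⟩ := hD.src_eq_tgt p hp
  rw [← hqp]; exact key q hq

/-- Both ends of the current dart are marked. -/
def bothMarked : Test := .and (.eq (.read 4 dartSrc) (.const 1)) (.eq (.read 4 dartTgt) (.const 1))

/-- Decide whether the closed neighbourhood of the vertex in register `5` is a clique. -/
def recheck : Program :=
  .seq markNbhd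
  (.seq (forLoop 4 3 (.ite bothMarked
    (.write 5 dartSrc (.add (.read 5 dartSrc) (.const 1))) .skip))
  (.seq (.assign 6 (.const 2))
  (.seq (forLoop 4 3 (.ite (.and (.eq (.read 4 dartSrc) (.const 1))
    (.lt (.read 5 dartSrc) (.reg 7))) (.assign 6 (.const 1)) .skip))
  (.write 3 (.reg 5) (.reg 6)))))

open scoped Classical in
/-- Each vertex marked by `v` has sufficiently many marked neighbours. -/
def MarkedClique (D : DartData) (v : ℕ) : Prop :=
  ∀ p < D.num, Marked D v (D.src p) → livingDeg D v ≤
    Nat.count (fun q => D.src q = D.src p ∧ Marked D v (D.src q) ∧ Marked D v (D.tgt q)) D.num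

/-- Register 6 starts with the verdict 2 and is set to 1 at any marked vertex with fewer marked
neighbours than the degree of `v`; the verdict becomes the status. That this test detects cliques is
`simplicialIn_iff_card`. -/
theorem runs_recheck (hD : DartState W s) (hv : s.reg 5 ≤ W) :
    Runs W recheck s ((s.reg 3 + 1) * 300) fun s' =>
      ∃ x, (x = 2 ∧ MarkedClique s.darts (s.reg 5) ∨ x = 1 ∧ ¬ MarkedClique s.darts (s.reg 5)) ∧
        ∀ u, s'.arr 3 u = if u = s.reg 5 then x else s.arr 3 u := by
  classical
  have hW := hD.num_le
  refine Runs.mono (Runs.seq (runs_markNbhd_markPost hD hv) fun s₁ h1 hf1 =>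
    Runs.seq (B := (s.reg 3 + 1) * 50) (R := fun s₂ => ∀ p < s.reg 3, s₂.arr 5 (s.arr 2 p) =
      Nat.count (fun q => s.arr 2 q = s.arr 2 p ∧ Marked s.darts (s.reg 5) (s.arr 2 q) ∧ Marked s.darts (s.reg 5) (s.arr 1 q))
        (s.reg 3)) ?_ fun s₂ h2 hf2 =>
    Runs.seq (Runs.of_wlp (Q := fun s' => s'.reg 6 = 2) (by simp [wlp]; omega)) fun s₃ h3 hf3 =>
    Runs.seq (Runs.forLoop (N := s.reg 3) (fun i s' => s'.reg 6 = if (∀ p < i, s₂.arr 4 (s.arr 2 p) = 1 →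
      s₂.reg 7 ≤ s₂.arr 5 (s.arr 2 p)) then 2 else 1) ?_ (by omega) (by decide) (by decide)
      (by decide) (by simp [h3]) ?_) fun s₄ h4 hf4 =>
    Runs.of_wlp ?_) ?_ fun _ h => h
  · have hD1 := hD.of_frame hf1 (by decide) (by decide) (by decide)
    have e1 := hf1.2 1 (by decide)
    have e2 := hf1.2 2 (by decide)
    have e3 := hf1.1 3 (by decide)
    refine Runs.mono (runs_countDarts hD1 (b := bothMarked)
      (fun a b => s₁.arr 4 a = 1 ∧ s₁.arr 4 b = 1) ?_ ?_) ?_ ?_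
    · intro s' hf
      simp [bothMarked, hf.2 4 (by decide)]
    · rw [e1, e3]; exact h1.clear
    · rw [e3]; exact Nat.mul_le_mul_left _ (by decide)
    · intro s' h p hp
      obtain ⟨q, hq, hqp⟩ := hD.src_eq_tgt p hp
      rw [e1, e2, e3] at h
      rw [← hqp, h q hq]
      refine count_congr_of_lt fun q' hq' => ?_
      rw [h1.src q' hq', h1.tgt q' hq']
  · exact ((hf3.1 3 (by decide)).trans (hf2.1 3 (by decide))).trans (hf1.1 3 (by decide))
  · intro i s' hi hf h4 hI
    have hf12 := (hf1.mono (R' := [4, 7]) (A' := [4, 5]) (by decide) (by decide)).trans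
      (hf2.mono (by decide) (by decide))
    have e2 : s'.arr 2 = s.arr 2 :=
      ((hf.2 2 (by decide)).trans (hf3.2 2 (by decide))).trans (hf12.2 2 (by decide))
    have e4 : s'.arr 4 = s₂.arr 4 := (hf.2 4 (by decide)).trans (hf3.2 4 (by decide))
    have e5 : s'.arr 5 = s₂.arr 5 := (hf.2 5 (by decide)).trans (hf3.2 5 (by decide))
    have e7 : s'.reg 7 = s₂.reg 7 := (hf.1 7 (by decide)).trans (hf3.1 7 (by decide))
    simp only [wlp, Test.holds, dartSrc_eval, Expr.eval, e2, e4, e5, e7, h4, State.setReg_reg]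
    refine ⟨fun hc => ⟨by omega, ?_⟩, fun hc => ?_⟩
    · rw [if_neg (by decide), if_pos trivial, if_neg]
      intro h
      exact absurd (h i (by omega) hc.1) (by omega)
    · rw [if_neg (by decide), hI]
      refine if_congr ⟨fun h p hp hm => ?_, fun h p hp => h p (by omega)⟩ rfl rfl
      rcases Nat.lt_succ_iff_lt_or_eq.1 hp with h' | rfl
      · exact h p h' hm
      · by_contra h'
        exact hc ⟨hm, by omega⟩
  · have hf14 := (((hf1.mono (R' := [4, 6, 7]) (A' := [4, 5]) (by decide) (by decide)).trans
      (hf2.mono (by decide) (by decide))).trans (hf3.mono (by decide) (by decide))).trans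
      (hf4.mono (by decide) (by decide))
    have e5 : s₄.reg 5 = s.reg 5 := hf14.1 5 (by decide)
    have e3 : s₄.arr 3 = s.arr 3 := hf14.2 3 (by decide)
    have e4 : s₂.arr 4 = s₁.arr 4 := hf2.2 4 (by decide)
    have e7 : s₂.reg 7 = livingDeg s.darts (s.reg 5) := (hf2.1 7 (by decide)).trans h1.deg
    have hiff : (∀ p < s.reg 3, s₂.arr 4 (s.arr 2 p) = 1 → s₂.reg 7 ≤ s₂.arr 5 (s.arr 2 p)) ↔
        MarkedClique s.darts (s.reg 5) := by
      unfold MarkedClique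
      refine forall_congr' fun p => forall_congr' fun hp => ?_
      rw [e4, h1.src p hp, e7, h2 p hp]
      exact Iff.rfl
    simp only [hiff] at h4
    simp only [wlp, Expr.eval, e5, h4, State.setArr_arr, e3, if_true]
    refine ⟨hv, by split <;> omega, _, ?_, fun u => rfl⟩
    split <;> simp_all
  · simp [Program.maxCost, Expr.cost, Test.cost, dartSrc]
    nlinarith

/-- Both ends of the current dart are alive. -/
def bothAlive : Test :=
  .and (.not (.eq (.read 3 dartSrc) (.const 3))) (.not (.eq (.read 3 dartTgt) (.const 3)))

/-- Compute the degrees of the living vertices in array `5`. -/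
def computeDeg : Program :=
  .seq clearScratch (forLoop 4 3 (.ite bothAlive
    (.write 5 dartSrc (.add (.read 5 dartSrc) (.const 1))) .skip))

/-- The dart `q` has two living ends. -/
def LiveDart (D : DartData) (q : ℕ) : Prop := D.status (D.src q) ≠ 3 ∧ D.status (D.tgt q) ≠ 3

open scoped Classical in
/-- The number of living darts at `u`. -/
noncomputable def liveCount (D : DartData) (u : ℕ) : ℕ :=
  Nat.count (fun q => D.src q = u ∧ LiveDart D q) D.num

theorem liveCount_le (D : DartData) (u : ℕ) : liveCount D u ≤ D.num := by
  classical exact Nat.count_le _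

theorem runs_computeDeg (hD : DartState W s) :
    Runs W computeDeg s ((s.reg 3 + 1) * 200) fun s' =>
      ∀ p < s.reg 3, s'.arr 5 (s.arr 1 p) = liveCount s.darts (s.arr 1 p) ∧
        s'.arr 6 (s.arr 1 p) = 0 ∧ s'.arr 7 (s.arr 1 p) = 0 := by
  classical
  refine Runs.mono (Runs.seq (runs_clearScratch hD) fun s₁ h1 hf1 => Runs.mono
    (B' := (s.reg 3 + 1) * 50) (runs_countDarts
    (hD.of_frame hf1 (by decide) (by decide) (by decide)) (b := bothAlive)
    (fun a b => s.arr 3 a ≠ 3 ∧ s.arr 3 b ≠ 3) ?_ ?_).frame ?_ ?_) ?_ fun _ h => h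
  · intro s' hf
    simp [bothAlive, hf.2 3 (by decide), hf1.2 3 (by decide)]
  · rw [hf1.1 3 (by decide), hf1.2 1 (by decide)]
    exact fun p hp => (h1 p hp).1
  · rw [hf1.1 3 (by decide)]
    exact Nat.mul_le_mul_left _ (by decide)
  · rintro s' ⟨h, hf⟩
    rw [hf1.1 3 (by decide), hf1.2 1 (by decide), hf1.2 2 (by decide)] at h
    intro p hp
    refine ⟨h p hp, ?_, ?_⟩
    · rw [hf.2 6 (by decide)]; exact (h1 p hp).2.1
    · rw [hf.2 7 (by decide)]; exact (h1 p hp).2.2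
  · omega

/-- Compute the excesses of the living vertices in array `6` and the numbers of neighbours of the
same degree in array `7`. -/
def computeExcess : Program :=
  forLoop 4 3 (.ite bothAlive
    (.seq (.write 6 dartSrc (.add (.read 6 dartSrc) (.sub (.read 5 dartTgt) (.read 5 dartSrc))))
      (.ite (.eq (.read 5 dartTgt) (.read 5 dartSrc))
        (.write 7 dartSrc (.add (.read 7 dartSrc) (.const 1))) .skip)) .skip)

open scoped Classical in
theorem runs_computeExcess (hD : DartState W s)
    (h5 : ∀ p < s.reg 3, s.arr 5 (s.arr 1 p) ≤ s.reg 3)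
    (h6 : ∀ p < s.reg 3, s.arr 6 (s.arr 1 p) = 0) (h7 : ∀ p < s.reg 3, s.arr 7 (s.arr 1 p) = 0) :
    Runs W computeExcess s ((s.reg 3 + 1) * 100) fun s' =>
      ∀ p < s.reg 3, s'.arr 6 (s.arr 1 p) = (∑ q ∈ Finset.range (s.reg 3),
        if s.arr 2 q = s.arr 1 p ∧ LiveDart s.darts q then
          s.arr 5 (s.arr 1 q) - s.arr 5 (s.arr 2 q) else 0) ∧
        s'.arr 7 (s.arr 1 p) = Nat.count (fun q => s.arr 2 q = s.arr 1 p ∧ LiveDart s.darts q ∧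
          s.arr 5 (s.arr 1 q) = s.arr 5 (s.arr 2 q)) (s.reg 3) := by
  have hW := hD.size_le
  refine Runs.mono (Runs.dartLoop hD (fun i s' => ∀ p < s.reg 3,
      s'.arr 6 (s.arr 1 p) = (∑ q ∈ Finset.range i,
        if s.arr 2 q = s.arr 1 p ∧ LiveDart s.darts q then
          s.arr 5 (s.arr 1 q) - s.arr 5 (s.arr 2 q) else 0) ∧
        s'.arr 7 (s.arr 1 p) = Nat.count (fun q => s.arr 2 q = s.arr 1 p ∧ LiveDart s.darts q ∧
          s.arr 5 (s.arr 1 q) = s.arr 5 (s.arr 2 q)) i)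
    (by decide) (by decide) (by decide) (by decide) ?_ ?_) ?_ fun _ h => h
  · intro p hp
    simp [h6 p hp, h7 p hp]
  · intro i s₁ hi hf h4 ht hs hle1 hle2 hI
    have e3 := hf.2 3 (by decide)
    have e5 := hf.2 5 (by decide)
    obtain ⟨q₀, hq₀, hq₀e⟩ := hD.src_eq_tgt i hi
    obtain ⟨hS, hC⟩ := hI q₀ hq₀
    have hd : s.arr 5 (s.arr 1 i) ≤ s.reg 3 := h5 i hi
    -- A partial excess has `i` summands of size at most the number of darts; this is what requires
    -- the square in `DartState.size_le`.
    have hSle : (∑ q ∈ Finset.range i, if s.arr 2 q = s.arr 1 q₀ ∧ LiveDart s.darts q then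
          s.arr 5 (s.arr 1 q) - s.arr 5 (s.arr 2 q) else 0) ≤ i * s.reg 3 := by
      refine (Finset.sum_le_card_nsmul _ _ (s.reg 3) fun q hq => ?_).trans (by simp)
      have := h5 q ((Finset.mem_range.1 hq).trans hi)
      split <;> omega
    have hCle := Nat.count_le (p := fun q => s.arr 2 q = s.arr 1 q₀ ∧ LiveDart s.darts q ∧
          s.arr 5 (s.arr 1 q) = s.arr 5 (s.arr 2 q)) (n := i)
    rw [← hS] at hSle
    rw [← hC] at hCle
    rw [hq₀e] at hSle hCle hS hC
    have hle3 : i * s.reg 3 + s.reg 3 ≤ s.reg 3 * s.reg 3 := by nlinarith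
    have hL : (s.arr 3 (s.arr 2 i) ≠ 3 ∧ s.arr 3 (s.arr 1 i) ≠ 3) ↔ LiveDart s.darts i := Iff.rfl
    -- Here `x` and `y` are the entries at the target of `p` after the body; all three paths through
    -- the body reduce to this.
    have hmain : ∀ p < s.reg 3, ∀ x y, (s.arr 1 p = s.arr 2 i → LiveDart s.darts i →
          x = s₁.arr 6 (s.arr 2 i) + (s.arr 5 (s.arr 1 i) - s.arr 5 (s.arr 2 i)) ∧
          y = s₁.arr 7 (s.arr 2 i) +
            if s.arr 5 (s.arr 1 i) = s.arr 5 (s.arr 2 i) then 1 else 0) →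
        (¬ (s.arr 1 p = s.arr 2 i ∧ LiveDart s.darts i) →
          x = s₁.arr 6 (s.arr 1 p) ∧ y = s₁.arr 7 (s.arr 1 p)) →
        x = (∑ q ∈ Finset.range (i + 1), if s.arr 2 q = s.arr 1 p ∧ LiveDart s.darts q then
          s.arr 5 (s.arr 1 q) - s.arr 5 (s.arr 2 q) else 0) ∧
        y = Nat.count (fun q => s.arr 2 q = s.arr 1 p ∧ LiveDart s.darts q ∧
          s.arr 5 (s.arr 1 q) = s.arr 5 (s.arr 2 q)) (i + 1) := by
      intro p hp x y ha hb
      rw [Finset.sum_range_succ, Nat.count_succ, ← (hI p hp).1, ← (hI p hp).2]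
      by_cases h : s.arr 1 p = s.arr 2 i ∧ LiveDart s.darts i
      · obtain ⟨hx, hy⟩ := ha h.1 h.2
        rw [hx, hy, h.1]
        simp [h.2]
      · obtain ⟨hx, hy⟩ := hb h
        rw [hx, hy, if_neg fun h' => h ⟨h'.1.symm, h'.2⟩, if_neg fun h' => h ⟨h'.1.symm, h'.2.1⟩]
        exact ⟨rfl, rfl⟩
    simp only [wlp, bothAlive, Test.holds, dartSrc_eval, dartTgt_eval, Expr.eval, e3, ht, hs, h4,
      State.setArr_reg, State.setArr_arr, State.setReg_arr, e5]
    refine ⟨fun hc => ⟨hle2, by omega, fun hc' => ⟨by simp [hle2], ?_, ?_⟩, fun hc' => ?_⟩,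
      fun hc => ?_⟩
    · simp; omega
    · intro p hp
      refine hmain p hp _ _ ?_ ?_
      · intro h1 h2
        simp at hc'
        simp [h1, hc']
      · intro h
        have h : s.arr 1 p ≠ s.arr 2 i := fun h' => h ⟨h', hL.1 hc⟩
        simp [h]
    · intro p hp
      refine hmain p hp _ _ ?_ ?_
      · intro h1 h2
        simp at hc'
        simp [h1, hc']
      · intro h
        have h : s.arr 1 p ≠ s.arr 2 i := fun h' => h ⟨h', hL.1 hc⟩
        simp [h]
    · intro p hp
      refine hmain p hp _ _ ?_ ?_
      · intro h1 h2
        exact absurd (hL.2 h2) hc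
      · intro h
        exact ⟨rfl, rfl⟩
  · refine Nat.mul_le_mul_left _ (by decide)

end Phases
end STC

namespace STC

/-! ### Deleting a neighbourhood; one round -/

section Phases

open Program (forLoop)

variable {W : ℕ} {s : State}

/-- Delete the closed neighbourhood of the vertex in register `5`. -/
def delete : Program :=
  .seq (.assign 9 (.add (.reg 9) (.read 6 (.reg 5))))
  (.seq markNbhd
  (.seq (forLoop 4 3 (.ite (.and (.eq (.read 4 dartSrc) (.const 1)) (.eq (.read 3 dartTgt) (.const 1)))
    (.write 3 dartTgt (.const 0)) .skip))
  (forLoop 4 3 (.ite (.eq (.read 4 dartSrc) (.const 1)) (.write 3 dartSrc (.const 3)) .skip))))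

open scoped Classical in
-- The first scan may also reset vertices that are about to be deleted; the second scan overwrites
-- them, so the value 3 takes precedence.
theorem runs_delete (hD : DartState W s) (hv : s.reg 5 ≤ W) (h9 : s.reg 9 + s.arr 6 (s.reg 5) ≤ W) :
    Runs W delete s ((s.reg 3 + 1) * 200) fun s' =>
      s'.reg 9 = s.reg 9 + s.arr 6 (s.reg 5) ∧
      ∀ u, s'.arr 3 u = if ∃ q < s.reg 3, s.arr 2 q = u ∧ Marked s.darts (s.reg 5) u then 3 else
        if ∃ q < s.reg 3, Marked s.darts (s.reg 5) (s.arr 2 q) ∧ s.arr 1 q = u ∧ s.arr 3 u = 1 then 0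
        else s.arr 3 u := by
  have hW := hD.num_le
  refine Runs.mono (Runs.seq (B := 5) (R := fun s' => s'.reg 9 = s.reg 9 + s.arr 6 (s.reg 5))
    ((Runs.of_wlp (by simpa [wlp] using h9))) fun s₁ h1 hf1 =>
    Runs.seq (B := (s.reg 3 + 1) * 100) (R := fun s' => ∀ p < s.reg 3, s'.arr 4 (s.arr 2 p) = 1 ↔
      Marked s.darts (s.reg 5) (s.arr 2 p)) ?_ fun s₂ h2 hf2 =>
    Runs.seq (Runs.forLoop (N := s.reg 3) (fun i s' => ∀ u, s'.arr 3 u =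
      if ∃ q < i, Marked s.darts (s.reg 5) (s.arr 2 q) ∧ s.arr 1 q = u ∧ s.arr 3 u = 1 then 0
        else s.arr 3 u) ?_ (by omega) (by decide) (by decide) (by decide) ?_ ?_) fun s₃ h3 hf3 =>
    Runs.mono (Runs.frame (Runs.forLoop (N := s.reg 3) (fun i s' => ∀ u, s'.arr 3 u =
      if ∃ q < i, s.arr 2 q = u ∧ Marked s.darts (s.reg 5) u then 3 else s₃.arr 3 u)
      ?_ (by omega) (by decide) (by decide) (by decide) ?_ ?_)) le_rfl ?_) ?_ fun _ h => h
  · have hD1 := hD.of_frame hf1 (by decide) (by decide) (by decide)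
    have e5 := hf1.1 5 (by decide)
    have e3 := hf1.1 3 (by decide)
    refine Runs.mono (runs_markNbhd_markPost hD1 (by rw [e5]; exact hv)) (by rw [e3]) ?_
    intro s' h p hp
    have := h.src p (by rw [e3]; exact hp)
    rw [hf1.2 2 (by decide)] at this
    rw [this]
    rw [e5, State.darts_eq_of_frame hf1 (by decide) (by decide) (by decide) (by decide)]
  · exact (hf2.1 3 (by decide)).trans (hf1.1 3 (by decide))
  · intro u
    simp [hf2.2 3 (by decide), hf1.2 3 (by decide)]
  · intro i s' hi hf h4 hI
    have hf' := ((hf1.mono (R' := [4, 7, 9]) (A' := [3, 4, 5]) (by decide) (by decide)).trans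
      (hf2.mono (by decide) (by decide))).trans (hf.mono (by decide) (by decide))
    have e1 := hf'.2 1 (by decide)
    have e2 := hf'.2 2 (by decide)
    have e4 := hf.2 4 (by decide)
    have hle := hD.tgt_le i hi
    have hIi := hI (s.arr 1 i)
    simp only [wlp, Test.holds, dartSrc_eval, dartTgt_eval, Expr.eval, e1, e2, e4, h4,
      h2 i hi, State.setReg_arr, State.setArr_arr, if_true]
    refine ⟨fun hc => ⟨hle, by omega, fun u => ?_⟩, fun hc u => ?_⟩
    · have h1i : s.arr 3 (s.arr 1 i) = 1 := by
        rw [hc.2] at hIi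
        by_contra hne
        split at hIi <;> omega
      by_cases hu : u = s.arr 1 i
      · rw [if_pos hu, if_pos ⟨i, by omega, hc.1, hu.symm, by rw [hu, h1i]⟩]
      · rw [if_neg hu, hI u]
        refine if_congr ⟨?_, ?_⟩ rfl rfl
        · rintro ⟨q, hq, h⟩; exact ⟨q, by omega, h⟩
        · rintro ⟨q, hq, h⟩
          refine ⟨q, ?_, h⟩
          rcases Nat.lt_succ_iff_lt_or_eq.1 hq with h' | rfl
          · exact h'
          · exact absurd h.2.1.symm hu
    · rw [hI u]
      by_cases hq : ∃ q < i, Marked s.darts (s.reg 5) (s.arr 2 q) ∧ s.arr 1 q = u ∧ s.arr 3 u = 1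
      · obtain ⟨q, hq, h⟩ := hq
        rw [if_pos ⟨q, hq, h⟩, if_pos ⟨q, by omega, h⟩]
      · rw [if_neg hq, if_neg]
        rintro ⟨q, hq', h⟩
        rcases Nat.lt_succ_iff_lt_or_eq.1 hq' with h' | rfl
        · exact hq ⟨q, h', h⟩
        · refine hc ⟨h.1, ?_⟩
          rw [h.2.1, hI u, if_neg hq, h.2.2]
  · exact ((hf3.1 3 (by decide)).trans (hf2.1 3 (by decide))).trans (hf1.1 3 (by decide))
  · intro u; simp
  · intro i s' hi hf h4 hI
    have hf' := (((hf1.mono (R' := [4, 7, 9]) (A' := [3, 4, 5]) (by decide) (by decide)).trans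
      (hf2.mono (by decide) (by decide))).trans (hf3.mono (by decide) (by decide))).trans
      (hf.mono (by decide) (by decide))
    have e2 := hf'.2 2 (by decide)
    have e4 := (hf.2 4 (by decide)).trans (hf3.2 4 (by decide))
    have hle := hD.src_le i hi
    simp only [wlp, Test.holds, dartSrc_eval, Expr.eval, e2, e4, h4,
      h2 i hi, State.setReg_arr, State.setArr_arr, if_true]
    refine ⟨fun hc => ⟨hle, by omega, fun u => ?_⟩, fun hc u => ?_⟩
    · by_cases hu : u = s.arr 2 i
      · rw [if_pos hu, if_pos ⟨i, by omega, hu.symm, hu ▸ hc⟩]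
      · rw [if_neg hu, hI u]
        refine if_congr ⟨?_, ?_⟩ rfl rfl
        · rintro ⟨q, hq, h⟩; exact ⟨q, by omega, h⟩
        · rintro ⟨q, hq, h⟩
          refine ⟨q, ?_, h⟩
          rcases Nat.lt_succ_iff_lt_or_eq.1 hq with h' | rfl
          · exact h'
          · exact absurd h.1.symm hu
    · rw [hI u]
      refine if_congr ⟨?_, ?_⟩ rfl rfl
      · rintro ⟨q, hq, h⟩; exact ⟨q, by omega, h⟩
      · rintro ⟨q, hq, h⟩
        refine ⟨q, ?_, h⟩
        rcases Nat.lt_succ_iff_lt_or_eq.1 hq with h' | rfl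
        · exact h'
        · exact absurd (h.1 ▸ h.2) hc
  · rintro s' ⟨h, hf4⟩
    refine ⟨?_, fun u => ?_⟩
    · rw [hf4.1 9 (by decide), hf3.1 9 (by decide), hf2.1 9 (by decide), h1]
    · rw [h u, h3 u]
  · simp [Program.maxCost, Expr.cost, Test.cost, dartSrc, dartTgt]
    omega

/-- One round: recheck a dirty vertex, or else delete a removable vertex with its neighbourhood,
or else report that none is left. -/
def round : Program :=
  .seq (search (.eq (.read 3 dartTgt) (.const 0)))
  (.ite (.eq (.reg 6) (.const 1)) recheck
  (.seq computeDeg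
  (.seq computeExcess
  (.seq (search (.and (.eq (.read 3 dartTgt) (.const 2))
    (.not (.lt (.read 7 dartTgt) (.read 6 dartTgt)))))
  (.ite (.eq (.reg 6) (.const 1)) delete (.assign 8 (.const 1)))))))

open scoped Classical in
/-- The excess of `u`, computed over the darts. -/
noncomputable def dartExcess (D : DartData) (u : ℕ) : ℕ :=
  ∑ q ∈ Finset.range D.num, if D.src q = u ∧ LiveDart D q then
    liveCount D (D.tgt q) - liveCount D (D.src q) else 0

open scoped Classical in
/-- The number of neighbours of `u` of the same degree, computed over the darts. -/
noncomputable def dartEqualDeg (D : DartData) (u : ℕ) : ℕ :=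
  Nat.count (fun q => D.src q = u ∧ LiveDart D q ∧
    liveCount D (D.tgt q) = liveCount D (D.src q)) D.num

open scoped Classical in
/-- What one round achieves. -/
inductive RoundPost (D : DartData) (s s' : State) : Prop
  | recheck (v x : ℕ) (hv : ∃ p < D.num, D.tgt p = v) (h0 : D.status v = 0)
    (hx : x = 2 ∧ MarkedClique D v ∨ x = 1 ∧ ¬ MarkedClique D v)
    (hst : ∀ u, s'.arr 3 u = if u = v then x else D.status u)
    (h8 : s'.reg 8 = s.reg 8) (h9 : s'.reg 9 = s.reg 9)
  | delete (v : ℕ) (hv : ∃ p < D.num, D.tgt p = v) (h2 : D.status v = 2)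
    (hle : dartExcess D v ≤ dartEqualDeg D v)
    (hst : ∀ u, s'.arr 3 u = if ∃ q < D.num, D.src q = u ∧ Marked D v u then 3 else
        if ∃ q < D.num, Marked D v (D.src q) ∧ D.tgt q = u ∧ D.status u = 1 then 0
        else D.status u)
    (h8 : s'.reg 8 = s.reg 8) (h9 : s'.reg 9 = s.reg 9 + dartExcess D v)
  | settled (h0 : ∀ p < D.num, D.status (D.tgt p) ≠ 0)
    (h : ∀ p < D.num, D.status (D.tgt p) = 2 →
      dartEqualDeg D (D.tgt p) < dartExcess D (D.tgt p))
    (hst : s'.arr 3 = D.status) (h8 : s'.reg 8 = 1) (h9 : s'.reg 9 = s.reg 9)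

theorem runs_round (hD : DartState W s) (h9 : s.reg 9 + s.reg 3 * s.reg 3 ≤ W) :
    Runs W round s ((s.reg 3 + 1) * 1000) (RoundPost s.darts s) := by
  classical
  have hW := hD.size_le
  have hsearch1 : Runs W (search (.eq (.read 3 dartTgt) (.const 0))) s ((s.reg 3 + 1) * 50) _ :=
    Runs.mono (runs_search hD (fun u => s.arr 3 u = 0) (fun s₁ hf => by
      simp [hf.2 3 (by decide)])) (Nat.mul_le_mul_left _ (by decide)) fun _ h => h
  refine Runs.mono (Runs.seq hsearch1 fun s₁ h1 hf1 =>
    Runs.ite (B := (s.reg 3 + 1) * 900) (fun hb => ?_) (fun hb => ?_)) ?_ fun _ h => h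
  · rcases h1 with ⟨h6, _⟩ | ⟨_, h0, hv⟩
    · exact absurd hb (by simp [h6])
    have hD1 := hD.of_frame hf1 (by decide) (by decide) (by decide)
    have e1 := hf1.2 1 (by decide)
    have e2 := hf1.2 2 (by decide)
    have e3 := hf1.2 3 (by decide)
    have r3 := hf1.1 3 (by decide)
    refine Runs.mono (Runs.frame (runs_recheck hD1 ?_)) ?_ ?_
    · obtain ⟨p, hp, h⟩ := hv
      rw [← h]; exact hD.tgt_le p hp
    · rw [r3]; omega
    · rintro s' ⟨⟨x, hx, hst⟩, hf2⟩
      rw [State.darts_eq_of_frame hf1 (by decide) (by decide) (by decide) (by decide)] at hx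
      refine .recheck (s₁.reg 5) x hv h0 hx (fun u => by rw [hst u, e3]; rfl) ?_ ?_
      · rw [hf2.1 8 (by decide), hf1.1 8 (by decide)]
      · rw [hf2.1 9 (by decide), hf1.1 9 (by decide)]
  · rcases h1 with ⟨_, hno⟩ | ⟨h6, _⟩
    swap
    · exact absurd (by simp [h6]) hb
    have hD1 := hD.of_frame hf1 (by decide) (by decide) (by decide)
    have r31 := hf1.1 3 (by decide)
    have hd1 : s₁.darts = s.darts :=
      State.darts_eq_of_frame hf1 (by decide) (by decide) (by decide) (by decide)
    refine Runs.mono (Runs.seq (runs_computeDeg hD1) fun s₂ h2 hf2 =>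
      Runs.seq (B := (s.reg 3 + 1) * 100) (R := fun s' => ∀ p < s.reg 3,
        s'.arr 6 (s.arr 1 p) = dartExcess s.darts (s.arr 1 p) ∧
        s'.arr 7 (s.arr 1 p) = dartEqualDeg s.darts (s.arr 1 p)) ?_ fun s₃ h3 hf3 =>
      Runs.seq (B := (s.reg 3 + 1) * 50) (R := fun s' =>
        (s'.reg 6 = 0 ∧ ∀ p < s.reg 3, ¬ (s.arr 3 (s.arr 1 p) = 2 ∧
          s₃.arr 6 (s.arr 1 p) ≤ s₃.arr 7 (s.arr 1 p))) ∨
        (s'.reg 6 = 1 ∧ (s.arr 3 (s'.reg 5) = 2 ∧ s₃.arr 6 (s'.reg 5) ≤ s₃.arr 7 (s'.reg 5)) ∧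
          ∃ p < s.reg 3, s.arr 1 p = s'.reg 5)) ?_ fun s₄ h4 hf4 =>
      Runs.ite (B := (s.reg 3 + 1) * 200) (fun hb => ?_) (fun hb => ?_)) ?_ fun _ h => h
    · have hD2 := hD1.of_frame hf2 (by decide) (by decide) (by decide)
      have hf12 := (hf1.mono (R' := [4, 5, 6]) (A' := [5, 6, 7]) (by decide) (by decide)).trans
        (hf2.mono (by decide) (by decide))
      have e1 := hf12.2 1 (by decide)
      have e2 := hf12.2 2 (by decide)
      have e3 := hf12.2 3 (by decide)
      have r3 := hf12.1 3 (by decide)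
      rw [r31, hf1.2 1 (by decide), hd1] at h2
      have hd2 : s₂.darts = s.darts :=
        State.darts_eq_of_frame hf12 (by decide) (by decide) (by decide) (by decide)
      refine Runs.mono (runs_computeExcess hD2 ?_ ?_ ?_) ?_ ?_
      · rw [r3, e1]; intro p hp; rw [(h2 p hp).1]; exact liveCount_le s.darts _
      · rw [r3, e1]; exact fun p hp => (h2 p hp).2.1
      · rw [r3, e1]; exact fun p hp => (h2 p hp).2.2
      · rw [r3]
      · intro s' h
        rw [r3, e1, e2, hd2] at h
        have hsrc : ∀ q < s.reg 3, s₂.arr 5 (s.arr 2 q) = liveCount s.darts (s.arr 2 q) := by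
          intro q hq
          obtain ⟨q', hq', hqe⟩ := hD.src_eq_tgt q hq
          rw [← hqe, (h2 q' hq').1]
        intro p hp
        refine ⟨(h p hp).1.trans ?_, (h p hp).2.trans ?_⟩
        · refine Finset.sum_congr rfl fun q hq => ?_
          have hq := Finset.mem_range.1 hq
          rw [(h2 q hq).1, hsrc q hq]
          rfl
        · refine count_congr_of_lt fun q hq => ?_
          rw [(h2 q hq).1, hsrc q hq]
          rfl
    · have hf13 := ((hf1.mono (R' := [4, 5, 6]) (A' := [5, 6, 7]) (by decide) (by decide)).trans
        (hf2.mono (by decide) (by decide))).trans (hf3.mono (by decide) (by decide))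
      have hD3 := hD.of_frame hf13 (by decide) (by decide) (by decide)
      have r3 := hf13.1 3 (by decide)
      refine Runs.mono (runs_search hD3 (fun u => s.arr 3 u = 2 ∧ s₃.arr 6 u ≤ s₃.arr 7 u)
        (fun s' hf => ?_)) ?_ ?_
      · simp [hf.2 3 (by decide), hf13.2 3 (by decide), hf.2 6 (by decide), hf.2 7 (by decide)]
      · rw [r3]; exact Nat.mul_le_mul_left _ (by decide)
      · intro s' h
        rw [r3, hf13.2 1 (by decide)] at h
        exact h
    · rcases h4 with ⟨h6, _⟩ | ⟨_, ⟨hst, hle⟩, p, hp, hpv⟩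
      · exact absurd hb (by simp [h6])
      have hf14 := (((hf1.mono (R' := [4, 5, 6]) (A' := [5, 6, 7]) (by decide) (by decide)).trans
        (hf2.mono (by decide) (by decide))).trans (hf3.mono (by decide) (by decide))).trans
        (hf4.mono (by decide) (by decide))
      have e1 := hf14.2 1 (by decide)
      have e2 := hf14.2 2 (by decide)
      have e3 := hf14.2 3 (by decide)
      have r3 := hf14.1 3 (by decide)
      have e6 : s₄.arr 6 (s₄.reg 5) = dartExcess s.darts (s₄.reg 5) := by
        rw [hf4.2 6 (by decide), ← hpv]; exact (h3 p hp).1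
      rw [← hpv, (h3 p hp).1, (h3 p hp).2, hpv] at hle
      -- The chosen vertex passed the test, so its excess is at most a count of darts, and adding it
      -- to register 9 stays within the word size.
      have hbd : dartExcess s.darts (s₄.reg 5) ≤ s.reg 3 := hle.trans (by
        unfold dartEqualDeg; exact Nat.count_le _)
      refine Runs.mono (Runs.frame (runs_delete
        (hD.of_frame hf14 (by decide) (by decide) (by decide)) ?_ ?_)) ?_ ?_
      · rw [← hpv]; exact hD.tgt_le p hp
      · rw [e6, hf14.1 9 (by decide)]
        have : s.reg 3 ≤ s.reg 3 * s.reg 3 := Nat.le_mul_self _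
        omega
      · rw [r3]
      · rintro s' ⟨⟨h9', hst'⟩, hf5⟩
        refine .delete (s₄.reg 5) ⟨p, hp, hpv⟩ hst hle (fun u => ?_) ?_ ?_
        · rw [hst' u]
          rw [State.darts_eq_of_frame hf14 (by decide) (by decide) (by decide) (by decide), e1, e2,
            e3, r3]
          rfl
        · rw [hf5.1 8 (by decide), hf14.1 8 (by decide)]
        · rw [h9', e6, hf14.1 9 (by decide)]
    · rcases h4 with ⟨_, hno'⟩ | ⟨h6, _⟩
      swap
      · exact absurd (by simp [h6]) hb
      have hf14 := (((hf1.mono (R' := [4, 5, 6]) (A' := [5, 6, 7]) (by decide) (by decide)).trans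
        (hf2.mono (by decide) (by decide))).trans (hf3.mono (by decide) (by decide))).trans
        (hf4.mono (by decide) (by decide))
      refine Runs.mono (Runs.frame (Runs.of_wlp (Q := fun s' => s'.reg 8 = 1)
        (by simp [wlp]; omega))) ?_ ?_
      · simp [Program.maxCost, Expr.cost]; omega
      · rintro s' ⟨h8, hf5⟩
        refine .settled hno (fun p hp h2' => ?_) ?_ h8 ?_
        · by_contra hlt
          refine hno' p hp ⟨h2', ?_⟩
          rw [(h3 p hp).1, (h3 p hp).2]
          exact not_lt.1 hlt
        · rw [hf5.2 3 (by decide), hf14.2 3 (by decide)]; rfl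
        · rw [hf5.1 9 (by decide), hf14.1 9 (by decide)]
    · rw [r31]
      simp [Expr.cost, Test.cost]
      omega
  · simp [Expr.cost, Test.cost]
    omega

end Phases
end STC

namespace STC

/-! ### What the dart data mean for the graph, and why a round is correct -/

section Representation

/-- The darts of `D` are the pairs of adjacent vertices of `G`, each listed once. -/
structure DartRep (D : DartData) {n : ℕ} (G : SimpleGraph (Fin n)) : Prop where
  src_lt : ∀ q < D.num, D.src q < n
  tgt_lt : ∀ q < D.num, D.tgt q < n
  adj_iff : ∀ v w : Fin n, G.Adj v w ↔ ∃ q < D.num, D.src q = v ∧ D.tgt q = w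
  inj : ∀ q < D.num, ∀ q' < D.num, D.src q = D.src q' → D.tgt q = D.tgt q' → q = q'

/-- The status array of `D` describes the vertex set `A`: `3` means deleted, `2` and `1` are known
to be simplicial and not simplicial, and `0` is not known. -/
structure StatusRep (D : DartData) {n : ℕ} (G : SimpleGraph (Fin n)) (A : Finset (Fin n)) :
    Prop where
  mem_iff : ∀ v, v ∈ A ↔ D.status v ≠ 3
  le_two : ∀ v ∈ A, D.status v ≤ 2
  simplicial : ∀ v ∈ A, D.status v = 2 → SimplicialIn G A v
  not_simplicial : ∀ v ∈ A, D.status v = 1 → ¬ SimplicialIn G A v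
  not_isolated : ∀ v ∈ A, ∃ w, G.Adj v w

variable {D : DartData} {n : ℕ} {G : SimpleGraph (Fin n)} {A : Finset (Fin n)}

theorem DartRep.exists_src (h : DartRep D G) {q : ℕ} (hq : q < D.num) :
    ∃ v : Fin n, D.src q = v := ⟨⟨_, h.src_lt q hq⟩, rfl⟩

theorem DartRep.exists_tgt (h : DartRep D G) {q : ℕ} (hq : q < D.num) :
    ∃ v : Fin n, D.tgt q = v := ⟨⟨_, h.tgt_lt q hq⟩, rfl⟩

theorem StatusRep.exists_tgt (hS : StatusRep D G A) (h : DartRep D G) {v : Fin n} (hv : v ∈ A) :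
    ∃ q < D.num, D.tgt q = v := by
  obtain ⟨w, hw⟩ := hS.not_isolated v hv
  obtain ⟨q, hq, _, hq'⟩ := (h.adj_iff w v).1 hw.symm
  exact ⟨q, hq, hq'⟩

theorem StatusRep.exists_src (hS : StatusRep D G A) (h : DartRep D G) {v : Fin n} (hv : v ∈ A) :
    ∃ q < D.num, D.src q = v := by
  obtain ⟨w, hw⟩ := hS.not_isolated v hv
  obtain ⟨q, hq, hq', _⟩ := (h.adj_iff v w).1 hw
  exact ⟨q, hq, hq'⟩

open scoped Classical in
-- Sending a dart at `v` to its target is a bijection onto the neighbours of `v`. The decidability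
-- instance is left free so that the classical instances inside the definitions unify with it.
theorem DartRep.sum_eq (h : DartRep D G) (v : Fin n) (P : ℕ → Prop) (f : ℕ → ℕ)
    {inst : DecidablePred fun q => D.src q = v ∧ P (D.tgt q)} :
    (∑ q ∈ Finset.range D.num, @ite _ (D.src q = v ∧ P (D.tgt q)) (inst q) (f (D.tgt q)) 0) =
      ∑ w ∈ Finset.univ.filter fun w : Fin n => G.Adj v w ∧ P w, f w := by
  rw [← Finset.sum_filter]
  refine Finset.sum_bij (fun q hq => ⟨D.tgt q, h.tgt_lt q (Finset.mem_range.1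
    (Finset.mem_filter.1 hq).1)⟩) ?_ ?_ ?_ ?_
  · intro q hq
    obtain ⟨h1, h2, h3⟩ := Finset.mem_filter.1 hq
    exact Finset.mem_filter.2 ⟨Finset.mem_univ _,
      (h.adj_iff _ _).2 ⟨q, Finset.mem_range.1 h1, h2, rfl⟩, h3⟩
  · intro q hq q' hq' heq
    obtain ⟨h1, h2, h3⟩ := Finset.mem_filter.1 hq
    obtain ⟨h1', h2', h3'⟩ := Finset.mem_filter.1 hq'
    exact h.inj q (Finset.mem_range.1 h1) q' (Finset.mem_range.1 h1') (h2.trans h2'.symm)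
      (congrArg Fin.val heq)
  · intro w hw
    obtain ⟨_, h1, h2⟩ := Finset.mem_filter.1 hw
    obtain ⟨q, hq, hs, ht⟩ := (h.adj_iff v w).1 h1
    exact ⟨q, Finset.mem_filter.2 ⟨Finset.mem_range.2 hq, hs, by rwa [ht]⟩, Fin.ext ht⟩
  · intro q hq
    rfl

open scoped Classical in
theorem DartRep.count_eq (h : DartRep D G) (v : Fin n) (P : ℕ → Prop)
    {inst : DecidablePred fun q => D.src q = v ∧ P (D.tgt q)} :
    @Nat.count (fun q => D.src q = v ∧ P (D.tgt q)) inst D.num =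
      (Finset.univ.filter fun w : Fin n => G.Adj v w ∧ P w).card := by
  rw [Nat.count_eq_card_filter_range, Finset.card_eq_sum_ones, Finset.card_eq_sum_ones,
    Finset.sum_filter]
  exact h.sum_eq v P fun _ => 1

theorem StatusRep.mem_nbhdIn_iff (hS : StatusRep D G A) {v w : Fin n} :
    w ∈ nbhdIn G A v ↔ G.Adj v w ∧ D.status w ≠ 3 := by
  rw [mem_nbhdIn, hS.mem_iff, and_comm]

theorem StatusRep.livingDeg_eq (hS : StatusRep D G A) (h : DartRep D G) (v : Fin n) :
    livingDeg D v = degIn G A v := by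
  refine (h.count_eq v fun w => D.status w ≠ 3).trans (congrArg Finset.card ?_)
  ext w
  simp only [Finset.mem_filter, Finset.mem_univ, true_and, hS.mem_nbhdIn_iff]

theorem StatusRep.liveCount_eq (hS : StatusRep D G A) (h : DartRep D G) {v : Fin n} (hv : v ∈ A) :
    liveCount D v = degIn G A v := by
  rw [← hS.livingDeg_eq h, liveCount, livingDeg]
  refine count_congr_of_lt fun q hq => and_congr_right fun hs => ?_
  have := (hS.mem_iff v).1 hv
  simp [LiveDart, hs, this]

theorem StatusRep.marked_iff (hS : StatusRep D G A) (h : DartRep D G) (v u : Fin n) :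
    Marked D v u ↔ u ∈ closedNbhdIn G A v := by
  rw [Marked, mem_closedNbhdIn, Fin.val_inj]
  refine or_congr_right ?_
  rw [hS.mem_iff, h.adj_iff]
  constructor
  · rintro ⟨q, h1, h2, h3, h4⟩; exact ⟨h4, q, h1, h2, h3⟩
  · rintro ⟨h4, q, h1, h2, h3⟩; exact ⟨q, h1, h2, h3, h4⟩

theorem StatusRep.dartExcess_eq (hS : StatusRep D G A) (h : DartRep D G) {v : Fin n} (hv : v ∈ A) :
    dartExcess D v = excess G A v := by
  classical
  have hv' := (hS.mem_iff v).1 hv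
  rw [dartExcess, excess]
  trans
  · refine Finset.sum_congr (g := fun q => if D.src q = v ∧ D.status (D.tgt q) ≠ 3 then
      liveCount D (D.tgt q) - liveCount D v else 0) rfl fun q _ => ?_
    by_cases hs : D.src q = v
    · simp [LiveDart, hs, hv']
    · simp [hs]
  · refine (h.sum_eq v (fun w => D.status w ≠ 3) fun w => liveCount D w - liveCount D v).trans
      (Finset.sum_congr ?_ fun w hw => ?_)
    · ext w
      simp only [Finset.mem_filter, Finset.mem_univ, true_and, hS.mem_nbhdIn_iff]
    · rw [hS.liveCount_eq h hv, hS.liveCount_eq h (mem_nbhdIn.1 hw).1]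

theorem StatusRep.dartEqualDeg_eq (hS : StatusRep D G A) (h : DartRep D G) {v : Fin n}
    (hv : v ∈ A) : dartEqualDeg D v = equalDeg G A v := by
  classical
  have hv' := (hS.mem_iff v).1 hv
  rw [dartEqualDeg, equalDeg]
  trans
  · refine @count_congr_of_lt _ _ (fun q => D.src q = v ∧ (D.status (D.tgt q) ≠ 3 ∧
      liveCount D (D.tgt q) = liveCount D v)) _ (Classical.decPred _) fun q _ => ?_
    by_cases hs : D.src q = v
    · simp [LiveDart, hs, hv']
    · simp [hs]
  · refine (h.count_eq v fun w => D.status w ≠ 3 ∧ liveCount D w = liveCount D v).trans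
      (congrArg Finset.card ?_)
    ext w
    simp only [Finset.mem_filter, Finset.mem_univ, true_and, hS.mem_nbhdIn_iff, ← and_assoc]
    refine and_congr_right fun hw => ?_
    rw [hS.liveCount_eq h hv, hS.liveCount_eq h ((hS.mem_iff w).2 hw.2)]

/-- The closed neighbourhood has one element more than the degree of `v`, and no vertex is adjacent
to itself; having that many neighbours inside means being adjacent to all the others. -/
theorem simplicialIn_iff_card {v : Fin n} [DecidableRel G.Adj] : SimplicialIn G A v ↔
    ∀ u ∈ closedNbhdIn G A v, degIn G A v ≤ ((closedNbhdIn G A v).filter (G.Adj u)).card := by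
  have hsub : ∀ u, (closedNbhdIn G A v).filter (G.Adj u) ⊆ (closedNbhdIn G A v).erase u := by
    intro u w hw
    obtain ⟨h1, h2⟩ := Finset.mem_filter.1 hw
    exact Finset.mem_erase.2 ⟨h2.ne', h1⟩
  have hc : ∀ u ∈ closedNbhdIn G A v, ((closedNbhdIn G A v).erase u).card = degIn G A v := by
    intro u hu
    rw [Finset.card_erase_of_mem hu, card_closedNbhdIn]; rfl
  constructor
  · intro h u hu
    rw [← hc u hu]
    refine Finset.card_le_card fun w hw => ?_
    obtain ⟨h1, h2⟩ := Finset.mem_erase.1 hw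
    exact Finset.mem_filter.2 ⟨h2, h u hu w h2 h1.symm⟩
  · intro h a ha b hb hab
    have := Finset.eq_of_subset_of_card_le (hsub a) (by rw [hc a ha]; exact h a ha)
    exact (Finset.mem_filter.1 (this ▸ Finset.mem_erase.2 ⟨hab.symm, hb⟩)).2

theorem StatusRep.markedClique_iff (hS : StatusRep D G A) (h : DartRep D G) {v : Fin n}
    (hv : v ∈ A) : MarkedClique D v ↔ SimplicialIn G A v := by
  classical
  rw [simplicialIn_iff_card, MarkedClique, hS.livingDeg_eq h]
  have key : ∀ u ∈ closedNbhdIn G A v,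
      Nat.count (fun q => D.src q = u ∧ Marked D v (D.src q) ∧ Marked D v (D.tgt q)) D.num =
      ((closedNbhdIn G A v).filter (G.Adj u)).card := by
    intro u hu
    trans
    · refine @count_congr_of_lt _ _ (fun q => D.src q = u ∧ Marked D v (D.tgt q)) _
        (Classical.decPred _) fun q _ => ?_
      refine and_congr_right fun hs => ?_
      rw [hs]
      exact and_iff_right ((hS.marked_iff h v u).2 hu)
    · rw [h.count_eq u (Marked D v)]
      refine congrArg Finset.card ?_
      ext w
      simp only [Finset.mem_filter, Finset.mem_univ, true_and, hS.marked_iff h, and_comm]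
  constructor
  · intro hm u hu
    obtain ⟨q, hq, hqu⟩ := hS.exists_src h (closedNbhdIn_subset hv hu)
    have := hm q hq (by rw [hqu]; exact (hS.marked_iff h v u).2 hu)
    rw [hqu] at this
    exact this.trans_eq (key u hu)
  · intro hm q hq hmk
    obtain ⟨u, hu⟩ := h.exists_src hq
    rw [hu] at hmk ⊢
    rw [hS.marked_iff h] at hmk
    exact (hm u hmk).trans_eq (key u hmk).symm

/-- The vertices of unknown status. -/
def dirty (D : DartData) {n : ℕ} (A : Finset (Fin n)) : Finset (Fin n) :=
  A.filter fun v => D.status v = 0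

theorem StatusRep.recheck (hS : StatusRep D G A) (h : DartRep D G) {v : Fin n} {x : ℕ}
    {D' : DartData} (h0 : D.status v = 0) (hx : x = 2 ∧ MarkedClique D v ∨ x = 1 ∧ ¬ MarkedClique D v)
    (hst : ∀ u, D'.status u = if u = (v : ℕ) then x else D.status u) :
    StatusRep D' G A ∧ (dirty D' A).card < (dirty D A).card := by
  have hv : v ∈ A := (hS.mem_iff v).2 (by omega)
  rw [hS.markedClique_iff h hv] at hx
  have hst' : ∀ u : Fin n, D'.status u = if u = v then x else D.status u := by
    intro u; rw [hst]; exact if_congr Fin.val_inj rfl rfl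
  refine ⟨⟨fun u => ?_, fun u hu => ?_, fun u hu h2 => ?_, fun u hu h1 => ?_, hS.not_isolated⟩, ?_⟩
  · rw [hst']; split
    · rename_i huv; subst huv; exact iff_of_true hv (by omega)
    · exact hS.mem_iff u
  · rw [hst']; split
    · omega
    · exact hS.le_two u hu
  · rw [hst'] at h2; split at h2
    · rename_i huv; subst huv
      rcases hx with hx | hx
      · exact hx.2
      · omega
    · exact hS.simplicial u hu h2
  · rw [hst'] at h1; split at h1
    · rename_i huv; subst huv
      rcases hx with hx | hx
      · omega
      · exact hx.2
    · exact hS.not_simplicial u hu h1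
  · refine Finset.card_lt_card (Finset.ssubset_iff_subset_ne.2 ⟨fun u hu => ?_, fun heq => ?_⟩)
    · obtain ⟨h1, h2⟩ := Finset.mem_filter.1 hu
      rw [hst'] at h2
      split at h2
      · omega
      · exact Finset.mem_filter.2 ⟨h1, h2⟩
    · have : v ∈ dirty D' A := heq ▸ Finset.mem_filter.2 ⟨hv, h0⟩
      have := (Finset.mem_filter.1 this).2
      rw [hst', if_pos rfl] at this
      omega

open scoped Classical in
-- The vertices newly of unknown status are neighbours of the deleted set `R`, so by
-- `card_touching_le` they number at most the excess, which is less than `R.card`. Hence the loss in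
-- `A` outweighs the gain in dirty vertices.
theorem StatusRep.delete (hS : StatusRep D G A) (h : DartRep D G) {v : Fin n} {D' : DartData}
    (h2 : D.status v = 2) (hle : dartExcess D v ≤ dartEqualDeg D v)
    (hst : ∀ u, D'.status u = if ∃ q < D.num, D.src q = u ∧ Marked D v u then 3 else
        if ∃ q < D.num, Marked D v (D.src q) ∧ D.tgt q = u ∧ D.status u = 1 then 0
        else D.status u) (k : ℤ) :
    ∃ A', StatusRep D' G A' ∧ RuleStep G (A, k) (A', k - dartExcess D v) ∧
      dartExcess D v + A'.card ≤ A.card ∧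
      A'.card + (dirty D' A').card < A.card + (dirty D A).card := by
  have hv : v ∈ A := (hS.mem_iff v).2 (by omega)
  have hsimp := hS.simplicial v hv h2
  rw [hS.dartExcess_eq h hv] at hle ⊢
  rw [hS.dartEqualDeg_eq h hv] at hle
  set R := closedNbhdIn G A v with hR
  have hRA : R ⊆ A := closedNbhdIn_subset hv
  have hst' : ∀ u : Fin n, D'.status u = if u ∈ R then 3 else
      if (∃ x ∈ R, G.Adj x u) ∧ D.status u = 1 then 0 else D.status u := by
    intro u
    rw [hst]
    refine if_congr ?_ rfl (if_congr ?_ rfl rfl)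
    · rw [hR, ← hS.marked_iff h]
      constructor
      · rintro ⟨q, _, _, hm⟩; exact hm
      · intro hm
        obtain ⟨q, hq, hqu⟩ := hS.exists_src h (hRA ((hS.marked_iff h v u).1 hm))
        exact ⟨q, hq, hqu, hm⟩
    · constructor
      · rintro ⟨q, hq, hm, ht, h1⟩
        obtain ⟨x, hx⟩ := h.exists_src hq
        rw [hx, hS.marked_iff h] at hm
        exact ⟨⟨x, hm, (h.adj_iff x u).2 ⟨q, hq, hx, ht⟩⟩, h1⟩
      · rintro ⟨⟨x, hx, hadj⟩, h1⟩
        obtain ⟨q, hq, hs, ht⟩ := (h.adj_iff x u).1 hadj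
        exact ⟨q, hq, by rw [hs]; exact (hS.marked_iff h v x).2 hx, ht, h1⟩
  -- Used twice: it makes the potential drop, and it bounds the decrease of the parameter by the
  -- number of deleted vertices.
  have hlt : excess G A v < R.card := by
    have := equalDeg_le_degIn (G := G) (A := A) (v := v)
    rw [hR, card_closedNbhdIn]; omega
  have hcard : (A \ R).card + R.card = A.card := Finset.card_sdiff_add_card_eq_card hRA
  refine ⟨A \ R, ⟨fun u => ?_, fun u hu => ?_, fun u hu hu2 => ?_, fun u hu hu1 => ?_,
    fun u hu => hS.not_isolated u (Finset.mem_sdiff.1 hu).1⟩, ?_, ?_, ?_⟩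
  · rw [hst', Finset.mem_sdiff, hS.mem_iff]
    by_cases hu : u ∈ R
    · simp [hu]
    · rw [if_neg hu]
      split
      · rename_i h'; simp [hu, h'.2]
      · simp [hu]
  · obtain ⟨hu1, hu2⟩ := Finset.mem_sdiff.1 hu
    have := hS.le_two u hu1
    rw [hst', if_neg hu2]
    split <;> omega
  · obtain ⟨hu1, hu2'⟩ := Finset.mem_sdiff.1 hu
    rw [hst', if_neg hu2'] at hu2
    split at hu2
    · omega
    · exact (hS.simplicial u hu1 hu2).mono Finset.sdiff_subset
  · obtain ⟨huA, huR⟩ := Finset.mem_sdiff.1 hu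
    rw [hst', if_neg huR] at hu1
    split at hu1
    · omega
    · rename_i hno
      have hno : ∀ x ∈ R, ¬ G.Adj x u := fun x hx hxu => hno ⟨⟨x, hx, hxu⟩, hu1⟩
      -- A vertex that kept the status 1 has no neighbour in `R`, so its neighbourhood is intact and
      -- it is still not simplicial.
      have heq : closedNbhdIn G (A \ R) u = closedNbhdIn G A u := by
        ext w
        rw [mem_closedNbhdIn, mem_closedNbhdIn, Finset.mem_sdiff]
        refine or_congr_right ⟨fun h => ⟨h.1.1, h.2⟩, fun h => ⟨⟨h.1, fun hw => ?_⟩, h.2⟩⟩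
        exact hno w hw h.2.symm
      intro hs
      refine hS.not_simplicial u huA hu1 ?_
      intro a ha b hb hab
      exact hs a (heq ▸ ha) b (heq ▸ hb) hab
  · exact ruleStep_closedNbhdIn hv hsimp hle k
  · omega
  · have hd : dirty D' (A \ R) ⊆
        dirty D A ∪ ((A \ R).filter fun w => ∃ u ∈ R, G.Adj u w) := by
      intro u hu
      obtain ⟨huA, hu0⟩ := Finset.mem_filter.1 hu
      have huR := (Finset.mem_sdiff.1 huA).2
      rw [hst', if_neg huR] at hu0
      split at hu0
      · rename_i hx
        exact Finset.mem_union_right _ (Finset.mem_filter.2 ⟨huA, hx.1⟩)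
      · exact Finset.mem_union_left _ (Finset.mem_filter.2 ⟨(Finset.mem_sdiff.1 huA).1, hu0⟩)
    have h3 := (Finset.card_le_card hd).trans (Finset.card_union_le _ _)
    have h4 : ((A \ R).filter fun w => ∃ u ∈ R, G.Adj u w).card ≤ excess G A v := by
      convert card_touching_le hv hsimp
    omega

/-- Every living vertex is the target of a dart, so both searches have seen it. A simplicial one can
only have status 2, and then it failed the size test. -/
theorem StatusRep.reduced (hS : StatusRep D G A) (h : DartRep D G)
    (h0 : ∀ p < D.num, D.status (D.tgt p) ≠ 0)
    (h2 : ∀ p < D.num, D.status (D.tgt p) = 2 →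
      dartEqualDeg D (D.tgt p) < dartExcess D (D.tgt p)) : Reduced (G.induce A) := by
  refine reduced_induce_of fun v hv hs => ?_
  obtain ⟨p, hp, hpv⟩ := hS.exists_tgt h hv
  have h0 := h0 p hp
  have h2 := h2 p hp
  rw [hpv] at h0 h2
  rw [hS.dartEqualDeg_eq h hv, hS.dartExcess_eq h hv] at h2
  refine h2 ?_
  have h1 : D.status v ≠ 1 := fun h1 => hS.not_simplicial v hv h1 hs
  have := hS.le_two v hv
  omega

end Representation

/-! ### Linearly many rounds suffice -/

section MainLoop

/-- Apply the reduction rule exhaustively. -/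
def reduceLoop : Program := .loop (.eq (.reg 8) (.const 0)) round

/-- The invariant of the main loop. -/
structure LoopInv (W : ℕ) {n : ℕ} (G : SimpleGraph (Fin n)) (k : ℤ) (s : State)
    (A : Finset (Fin n)) : Prop where
  dartState : DartState W s
  dartRep : DartRep s.darts G
  statusRep : StatusRep s.darts G A
  reduces : Relation.ReflTransGen (RuleStep G) (Set.univ, k) (A, k - s.reg 9)
  card_le : s.reg 9 + A.card ≤ n
  done_le : s.reg 8 ≤ 1
  reduced : s.reg 8 = 1 → Reduced (G.induce A)

/-- The potential is the number of living vertices plus the number of dirty ones plus one while the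
flag in register 8 is down; the last summand pays for the round that only raises the flag. It is at
most `2 * n + 1` and drops in every round. The invariant `card_le` keeps register 9 at most `n`, so
it never overflows. -/
theorem runs_reduceLoop {W n : ℕ} {G : SimpleGraph (Fin n)} {k : ℤ} {s : State}
    {A : Finset (Fin n)} (h : LoopInv W G k s A) (hW : n + s.reg 3 * s.reg 3 ≤ W) :
    Runs W reduceLoop s ((2 * n + 2) * ((s.reg 3 + 1) * 1010)) fun s' =>
      ∃ A', LoopInv W G k s' A' ∧ s'.reg 8 = 1 := by
  have key := Runs.loop (W := W) (s := s) (p := round) (b := .eq (.reg 8) (.const 0))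
    (B := (s.reg 3 + 1) * 1000) (j := A.card + (dirty s.darts A).card + (1 - s.reg 8))
    (fun j s' => ∃ A', LoopInv W G k s' A' ∧ s'.reg 3 = s.reg 3 ∧
      j = A'.card + (dirty s'.darts A').card + (1 - s'.reg 8)) ?_ ⟨A, h, rfl, rfl⟩
  · refine Runs.mono key ?_ ?_
    · have h1 := h.card_le
      have h2 : (dirty s.darts A).card ≤ A.card := Finset.card_filter_le _ _
      refine Nat.mul_le_mul (by omega) ?_
      simp [Test.cost, Expr.cost]
      omega
    · rintro s' ⟨⟨j, A', hA', _, _⟩, hb⟩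
      refine ⟨A', hA', ?_⟩
      have := hA'.done_le
      simp at hb
      omega
  · rintro j s₁ ⟨A₁, hI, h3, rfl⟩ hb
    have h8 : s₁.reg 8 = 0 := by simpa using hb
    have hc := hI.card_le
    refine Runs.mono (runs_round hI.dartState (by rw [h3]; omega)).frame (by rw [h3]) ?_
    rintro s' ⟨hpost, hf⟩
    have hD' := hI.dartState.of_frame hf (by decide) (by decide) (by decide)
    have e1 := hf.2 1 (by decide)
    have e2 := hf.2 2 (by decide)
    have r3 := hf.1 3 (by decide)
    have hrep : DartRep s'.darts G := by
      have := hI.dartRep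
      constructor
      · simpa only [State.darts, e1, e2, r3] using this.src_lt
      · simpa only [State.darts, e1, e2, r3] using this.tgt_lt
      · simpa only [State.darts, e1, e2, r3] using this.adj_iff
      · simpa only [State.darts, e1, e2, r3] using this.inj
    rcases hpost with ⟨v, x, hv, h0, hx, hst, h8', h9'⟩ | ⟨v, hv, h2, hle, hst, h8', h9'⟩ |
      ⟨h0, h2, hst, h8', h9'⟩
    · obtain ⟨p, hp, hpv⟩ := hv
      obtain ⟨v', hv'⟩ := hI.dartRep.exists_tgt hp
      obtain rfl : (v' : ℕ) = v := hv'.symm.trans hpv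
      obtain ⟨hS, hlt⟩ := hI.statusRep.recheck hI.dartRep (D' := s'.darts) h0 hx hst
      refine ⟨_, ?_, A₁, ⟨hD', hrep, hS, ?_, ?_, ?_, ?_⟩, r3.trans h3, rfl⟩
      · omega
      · rw [h9']; exact hI.reduces
      · rw [h9']; exact hc
      · omega
      · intro h; omega
    · obtain ⟨p, hp, hpv⟩ := hv
      obtain ⟨v', hv'⟩ := hI.dartRep.exists_tgt hp
      obtain rfl : (v' : ℕ) = v := hv'.symm.trans hpv
      obtain ⟨A', hS, hstep, hle', hlt⟩ := hI.statusRep.delete hI.dartRep (D' := s'.darts) h2 hle hst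
        (k - s₁.reg 9)
      refine ⟨_, ?_, A', ⟨hD', hrep, hS, ?_, ?_, ?_, ?_⟩, r3.trans h3, rfl⟩
      · omega
      · refine hI.reduces.tail ?_
        rw [h9']
        push_cast
        rwa [← sub_sub]
      · omega
      · omega
      · intro h; omega
    · have hd : s'.darts = s₁.darts := by
        simp only [State.darts, e1, e2, r3]
        rw [hst]; rfl
      refine ⟨_, ?_, A₁, ⟨hD', hrep, by rw [hd]; exact hI.statusRep, ?_, ?_, ?_, ?_⟩,
        r3.trans h3, rfl⟩
      · rw [hd]; omega
      · rw [h9']; exact hI.reduces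
      · rw [h9']; exact hc
      · omega
      · intro _; exact hI.statusRep.reduced hI.dartRep h0 h2

end MainLoop
end STC

namespace STC

/-! ### Listing the darts and removing isolated vertices -/

section Initialization

open Program (forLoop)

variable {W : ℕ} {s : State}

/-- List the sources of the darts in array `2`. -/
def listSources : Program :=
  .seq (.assign 3 (.add (.reg 1) (.reg 1)))
  (.seq (.assign 11 (.add (.reg 0) (.reg 3)))
  (forLoop 4 11 (.ite (.lt (.reg 10) (.read 0 (.add (.reg 5) (.const 1))))
    (.seq (.write 2 (.reg 10) (.reg 5)) (.assign 10 (.add (.reg 10) (.const 1))))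
    (.assign 5 (.add (.reg 5) (.const 1))))))

/-- The offsets of adjacency lists with `M` entries in total. -/
structure Offsets (off : ℕ → ℕ) (n M : ℕ) : Prop where
  zero : off 0 = 0
  le_succ : ∀ v < n, off v ≤ off (v + 1)
  last : off n = M

theorem Offsets.mono {off : ℕ → ℕ} {n M : ℕ} (h : Offsets off n M) {u v : ℕ} (huv : u ≤ v)
    (hv : v ≤ n) : off u ≤ off v := by
  induction v, huv using Nat.le_induction with
  | base => exact le_rfl
  | succ v huv ih => exact (ih (by omega)).trans (h.le_succ v (by omega))

/-- Each iteration advances exactly one of two pointers, the vertex in register 5 or the position in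
register 10. One loop of `n + M` iterations thus replaces two nested loops. -/
theorem runs_listSources {M : ℕ} (hM : s.reg 1 + s.reg 1 = M) (hoff : Offsets (s.arr 0) (s.reg 0) M)
    (h5 : s.reg 5 = 0) (h10 : s.reg 10 = 0) (hW : s.reg 0 + M ≤ W) :
    Runs W listSources s ((s.reg 0 + M + 1) * 100) fun s' => s'.reg 3 = M ∧
      ∀ r < M, s.arr 0 (s'.arr 2 r) ≤ r ∧ r < s.arr 0 (s'.arr 2 r + 1) ∧ s'.arr 2 r < s.reg 0 := by
  refine Runs.mono (Runs.seq (Runs.of_wlp (Q := fun s' => s'.reg 3 = M) ?_) fun s₁ h1 hf1 =>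
    Runs.seq (Runs.of_wlp (Q := fun s' => s'.reg 11 = s.reg 0 + M) ?_) fun s₂ h2 hf2 =>
    Runs.mono (Runs.frame (Runs.forLoop (N := s.reg 0 + M) (fun i s' => s'.reg 5 + s'.reg 10 = i ∧
      s'.reg 5 ≤ s.reg 0 ∧ s'.reg 10 ≤ M ∧ s.arr 0 (s'.reg 5) ≤ s'.reg 10 ∧
      ∀ r < s'.reg 10, s.arr 0 (s'.arr 2 r) ≤ r ∧ r < s.arr 0 (s'.arr 2 r + 1) ∧
        s'.arr 2 r < s.reg 0) h2 (by omega) (by decide) (by decide) (by decide) ?_ ?_)) le_rfl ?_)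
    ?_ fun _ h => h
  · simp [wlp, hM]; omega
  · simp [wlp, h1, hf1.1 0 (by decide)]; omega
  · have hf := (hf1.mono (R' := [3, 11]) (A' := []) (by decide) (by decide)).trans
      (hf2.mono (by decide) (by decide))
    simp [hf.1 5 (by decide), hf.1 10 (by decide), h5, h10, hoff.zero]
  · intro i s' hi hf h4 ⟨h1', h2', h3', h4', h5'⟩
    have hf' := ((hf1.mono (R' := [3, 4, 5, 10, 11]) (A' := [2]) (by decide) (by decide)).trans
      (hf2.mono (by decide) (by decide))).trans (hf.mono (by decide) (by decide))
    have e0 := hf'.2 0 (by decide)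
    -- Once the vertex pointer is at the end, the offset there is `M`, so the position pointer is at
    -- the end too and the loop is over.
    have hlt : s'.reg 5 < s.reg 0 := by
      by_contra h
      have h : s'.reg 5 = s.reg 0 := by omega
      rw [h, hoff.last] at h4'
      omega
    have hlast := hoff.mono (u := s'.reg 5 + 1) (v := s.reg 0) hlt le_rfl
    rw [hoff.last] at hlast
    simp only [wlp, Test.holds, Expr.eval, e0, State.setReg_reg, State.setArr_reg,
      State.setReg_arr, State.setArr_arr]
    refine ⟨fun hc => ⟨by omega, by omega, by omega, ?_⟩, fun hc => ⟨by omega, ?_⟩⟩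
    · simp
      refine ⟨by omega, by omega, by omega, by omega, fun r hr => ?_⟩
      by_cases h : r = s'.reg 10
      · simp only [h, if_true]; exact ⟨h4', hc, hlt⟩
      · simp only [h, if_false]; exact h5' r (by omega)
    · simp
      exact ⟨by omega, by omega, by omega, by omega, h5'⟩
  · rintro s' ⟨⟨h1', h2', h3', h4', h5'⟩, hf⟩
    have h10' : s'.reg 10 = M := by omega
    rw [h10'] at h5'
    exact ⟨by rw [hf.1 3 (by decide), hf2.1 3 (by decide), h1], h5'⟩
  · simp [Program.maxCost, Expr.cost, Test.cost]
    omega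

/-- Delete the isolated vertices. -/
def markIsolated : Program :=
  forLoop 4 0 (.ite (.eq (.read 0 (.reg 4)) (.read 0 (.add (.reg 4) (.const 1))))
    (.write 3 (.reg 4) (.const 3)) .skip)

theorem runs_markIsolated (hW : s.reg 0 + 3 ≤ W) :
    Runs W markIsolated s ((s.reg 0 + 1) * 100) fun s' =>
      ∀ u, s'.arr 3 u = if u < s.reg 0 ∧ s.arr 0 u = s.arr 0 (u + 1) then 3 else s.arr 3 u := by
  refine Runs.mono (Runs.forLoop (fun i s' => ∀ u, s'.arr 3 u =
    if u < i ∧ s.arr 0 u = s.arr 0 (u + 1) then 3 else s.arr 3 u) rfl (by omega) (by decide)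
    (by decide) (by decide) (by simp) ?_) (Nat.mul_le_mul_left _ (by decide)) fun _ h => h
  intro i s' hi hf h4 hI
  have e0 := hf.2 0 (by decide)
  simp only [wlp, Test.holds, Expr.eval, e0, h4, State.setReg_arr, State.setArr_arr, if_true]
  refine ⟨fun hc => ⟨by omega, by omega, fun u => ?_⟩, fun hc u => ?_⟩
  · by_cases h : u = i
    · subst h; rw [if_pos rfl, if_pos ⟨by omega, hc⟩]
    · rw [if_neg h, hI u]
      exact if_congr (and_congr_left fun _ => by omega) rfl rfl
  · rw [hI u]
    by_cases h : u = i
    · subst h; rw [if_neg fun h => hc h.2, if_neg fun h => hc h.2]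
    · exact if_congr (and_congr_left fun _ => by omega) rfl rfl

variable {n : ℕ} {G : SimpleGraph (Fin n)} {k : ℕ}

/-- The last offset is the sum of the degrees, twice the number of edges by the handshake lemma. -/
theorem Encodes.offsets (h : Encodes s G k) :
    Offsets (s.arr 0) n (G.edgeSet.ncard + G.edgeSet.ncard) := by
  classical
  refine ⟨h.off_zero, fun v hv => ?_, ?_⟩
  · have := h.off_succ ⟨v, hv⟩
    dsimp only at this
    omega
  · have h1 : ∀ i, (hi : i ≤ n) → s.arr 0 i =
        ∑ v ∈ Finset.univ.filter fun v : Fin n => (v : ℕ) < i, (G.neighborSet v).ncard := by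
      intro i
      induction i with
      | zero => intro _; simp [h.off_zero]
      | succ i ih =>
        intro hi
        have h2 := h.off_succ ⟨i, hi⟩
        dsimp only at h2
        rw [h2, ih (by omega)]
        have : (Finset.univ.filter fun v : Fin n => (v : ℕ) < i + 1) =
            insert ⟨i, hi⟩ (Finset.univ.filter fun v : Fin n => (v : ℕ) < i) := by
          ext v
          simp only [Finset.mem_filter, Finset.mem_univ, true_and, Finset.mem_insert, Fin.ext_iff]
          omega
        rw [this, Finset.sum_insert (by simp), add_comm]
    rw [h1 n le_rfl]
    have h2 := G.sum_degrees_eq_twice_card_edges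
    have h3 : G.edgeSet.ncard = G.edgeFinset.card := by
      rw [Set.ncard_eq_toFinset_card']; rfl
    rw [h3, ← two_mul, ← h2]
    refine Finset.sum_congr ?_ fun v _ => ?_
    · ext v; simp
    · rw [Set.ncard_eq_toFinset_card']; rfl

/-- The offsets are monotone, so the segments of different vertices are disjoint and a position
determines its source. -/
theorem Encodes.dartRep (h : Encodes s G k) {src : ℕ → ℕ} {st : ℕ → ℕ}
    (hsrc : ∀ r < G.edgeSet.ncard + G.edgeSet.ncard,
      s.arr 0 (src r) ≤ r ∧ r < s.arr 0 (src r + 1) ∧ src r < n) :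
    DartRep ⟨G.edgeSet.ncard + G.edgeSet.ncard, src, s.arr 1, st⟩ G := by
  have hoff := h.offsets
  set M := G.edgeSet.ncard + G.edgeSet.ncard
  have hseg : ∀ r (v : Fin n), (s.arr 0 v ≤ r ∧ r < s.arr 0 (v + 1)) ↔ r < M ∧ src r = v := by
    intro r v
    constructor
    · rintro ⟨h1, h2⟩
      have hr : r < M := by
        have := hoff.mono (u := (v : ℕ) + 1) (v := n) v.2 le_rfl
        rw [hoff.last] at this
        omega
      refine ⟨hr, ?_⟩
      obtain ⟨h3, h4, h5⟩ := hsrc r hr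
      rcases lt_trichotomy (src r) v with hlt | heq | hlt
      · have := hoff.mono (u := src r + 1) (v := v) hlt v.2.le
        omega
      · exact heq
      · have := hoff.mono (u := (v : ℕ) + 1) (v := src r) hlt h5.le
        omega
    · rintro ⟨hr, hv⟩
      obtain ⟨h3, h4, _⟩ := hsrc r hr
      rw [hv] at h3 h4
      exact ⟨h3, h4⟩
  have hadj : ∀ (v : Fin n) (x : ℕ), (∃ q < M, src q = v ∧ s.arr 1 q = x) ↔
      ∃ w : Fin n, (w : ℕ) = x ∧ G.Adj v w := by
    intro v x
    rw [← h.adj_iff v x]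
    refine exists_congr fun q => ?_
    rw [← and_assoc, ← hseg, and_assoc]
  constructor
  · exact fun q hq => (hsrc q hq).2.2
  · intro q hq
    obtain ⟨w, hw, _⟩ := (hadj ⟨src q, (hsrc q hq).2.2⟩ (s.arr 1 q)).1 ⟨q, hq, rfl, rfl⟩
    show s.arr 1 q < n
    rw [← hw]; exact w.2
  · intro v w
    show _ ↔ ∃ q < M, src q = v ∧ s.arr 1 q = w
    rw [hadj]
    constructor
    · intro hvw; exact ⟨w, rfl, hvw⟩
    · rintro ⟨w', hw', hvw⟩
      rwa [← Fin.ext hw']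
  · intro q hq q' hq' hs ht
    let v : Fin n := ⟨src q, (hsrc q hq).2.2⟩
    have himg : ((Finset.Ico (s.arr 0 v) (s.arr 0 (v + 1))).image (s.arr 1) : Set ℕ) =
        Fin.val '' G.neighborSet v := by
      ext x
      rw [Finset.coe_image, Set.mem_image]
      have := h.adj_iff v x
      simp only [Finset.coe_Ico, Set.mem_Ico, and_assoc] at this ⊢
      rw [this]
      simp only [Set.mem_image, SimpleGraph.mem_neighborSet, and_comm]
    -- The segment of `v` has as many positions as `v` has neighbours and its entries exhaust them;
    -- hence no neighbour is listed twice.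
    have hcard : ((Finset.Ico (s.arr 0 v) (s.arr 0 (v + 1))).image (s.arr 1)).card =
        (Finset.Ico (s.arr 0 v) (s.arr 0 (v + 1))).card := by
      rw [← Set.ncard_coe_finset, himg, Set.ncard_image_of_injective _ Fin.val_injective,
        Nat.card_Ico, h.off_succ v]
      omega
    have hinj := Finset.card_image_iff.1 hcard
    refine hinj ?_ ?_ ht
    · rw [Finset.coe_Ico, Set.mem_Ico]; exact (hseg q v).2 ⟨hq, rfl⟩
    · rw [Finset.coe_Ico, Set.mem_Ico]; exact (hseg q' v).2 ⟨hq', hs.symm⟩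

/-- The initialization: list the sources and delete the isolated vertices. -/
def setup : Program := .seq listSources markIsolated

/-- Removing the isolated vertices is a sequence of rule applications that leaves `k` unchanged, so
the main invariant starts with register 9 equal to 0. That the sources are sorted is recorded for
the output phase. -/
theorem runs_setup (h : IsInput s G k)
    (hW : n + (G.edgeSet.ncard + G.edgeSet.ncard) * (G.edgeSet.ncard + G.edgeSet.ncard) +
      (G.edgeSet.ncard + G.edgeSet.ncard) + 3 ≤ W) :
    Runs W setup s ((n + (G.edgeSet.ncard + G.edgeSet.ncard) + 1) * 200) fun s' =>
      ∃ A, LoopInv W G k s' A ∧ s'.reg 3 = G.edgeSet.ncard + G.edgeSet.ncard ∧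
        ∀ p q, p ≤ q → q < s'.reg 3 → s'.arr 2 p ≤ s'.arr 2 q := by
  classical
  have hE := h.toEncodes
  have hoff := hE.offsets
  have hv := hE.vertices
  have hM : s.reg 1 + s.reg 1 = G.edgeSet.ncard + G.edgeSet.ncard := by rw [hE.edges]
  have hrep := fun src st => Encodes.dartRep (src := src) (st := st) hE
  set M := G.edgeSet.ncard + G.edgeSet.ncard with hMdef
  refine Runs.mono (Runs.seq (B := (n + M + 1) * 100) (R := fun s' => s'.reg 3 = M ∧
    ∀ r < M, s.arr 0 (s'.arr 2 r) ≤ r ∧ r < s.arr 0 (s'.arr 2 r + 1) ∧ s'.arr 2 r < n) ?_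
    fun s₁ h1 hf1 => Runs.mono (Runs.frame (runs_markIsolated (s := s₁) ?_)) (B' := (n + M + 1) * 100)
    ?_ ?_) ?_ fun _ h => h
  · have := runs_listSources (W := W) (s := s) (M := M) hM (by rw [hv]; exact hoff)
      (h.reg_zero 5 (by omega)) (h.reg_zero 10 (by omega)) (by rw [hv]; nlinarith)
    rw [hv] at this
    exact this
  · rw [hf1.1 0 (by decide), hv]; omega
  · rw [hf1.1 0 (by decide), hv]; omega
  · rintro s' ⟨hst, hf2⟩
    have hf := (hf1.mono (R' := [3, 4, 5, 10, 11]) (A' := [2, 3]) (by decide) (by decide)).trans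
      (hf2.mono (by decide) (by decide))
    obtain ⟨h3, hsrc⟩ := h1
    have e1 := hf.2 1 (by decide)
    have e2 := hf2.2 2 (by decide)
    have r3 : s'.reg 3 = M := (hf2.1 3 (by decide)).trans h3
    have r8 : s'.reg 8 = 0 := (hf.1 8 (by decide)).trans (h.reg_zero 8 (by omega))
    have r9 : s'.reg 9 = 0 := (hf.1 9 (by decide)).trans (h.reg_zero 9 (by omega))
    have hD : s'.darts = ⟨M, s₁.arr 2, s.arr 1, s'.arr 3⟩ := by
      simp only [State.darts, e1, e2, r3]
    have hDR : DartRep s'.darts G := by rw [hD]; exact hrep _ _ hsrc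
    have hst' : ∀ u : Fin n, s'.darts.status u = if ∀ w, ¬ G.Adj u w then 3 else 0 := by
      intro u
      have := hst u
      rw [hf1.1 0 (by decide), hv, hf1.2 0 (by decide), hf1.2 3 (by decide),
        h.arr_zero 3 (by omega), hE.off_succ u] at this
      refine this.trans (if_congr ?_ rfl rfl)
      have h0 : (G.neighborSet u).ncard = 0 ↔ ∀ w, ¬ G.Adj u w := by
        rw [Set.ncard_eq_zero]
        simp [Set.eq_empty_iff_forall_notMem]
      rw [← h0]
      have := u.2
      omega
    refine ⟨Finset.univ \ Finset.univ.filter fun v => ∀ w, ¬ G.Adj v w, ⟨?_, hDR, ?_, ?_, ?_, ?_,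
      fun h => by omega⟩, r3, ?_⟩
    · refine ⟨by rw [r3]; omega, ?_, ?_, ?_⟩
      · intro p hp
        have := hDR.tgt_lt p hp
        exact this.le.trans (by omega)
      · intro p hp
        have := hDR.src_lt p hp
        exact this.le.trans (by omega)
      · intro p hp
        obtain ⟨v, hv⟩ := hDR.exists_src hp
        obtain ⟨w, hw⟩ := hDR.exists_tgt hp
        obtain ⟨q, hq, _, hq'⟩ := (hDR.adj_iff w v).1 ((hDR.adj_iff v w).2 ⟨p, hp, hv, hw⟩).symm
        exact ⟨q, hq, hq'.trans hv.symm⟩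
    · refine ⟨fun v => ?_, fun v _ => ?_, fun v _ hv2 => ?_, fun v _ hv1 => ?_, fun v hv => ?_⟩
      · rw [hst']; simp
      · rename_i hv'
        have hv' := (Finset.mem_sdiff.1 hv').2
        rw [Finset.mem_filter] at hv'
        rw [hst', if_neg fun h => hv' ⟨Finset.mem_univ v, h⟩]; omega
      · rw [hst'] at hv2; split at hv2 <;> omega
      · rw [hst'] at hv1; split at hv1 <;> omega
      · have hv' := (Finset.mem_sdiff.1 hv).2
        rw [Finset.mem_filter] at hv'
        by_contra hno
        push Not at hno
        exact hv' ⟨Finset.mem_univ v, hno⟩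
    · rw [r9]
      have := reflTransGen_of_isolated (G := G) k (Finset.univ.filter fun v => ∀ w, ¬ G.Adj v w)
        Finset.univ (fun v hv => (Finset.mem_filter.1 hv).2)
      simpa using this
    · have := Finset.card_le_univ (Finset.univ \ Finset.univ.filter fun v : Fin n =>
        ∀ w, ¬ G.Adj v w)
      rw [Fintype.card_fin] at this
      omega
    · omega
    · intro p q hpq hq
      rw [r3] at hq
      rw [e2]
      obtain ⟨_, h2, _⟩ := hsrc q hq
      obtain ⟨h3, _, h4⟩ := hsrc p (by omega)
      by_contra hlt
      have := hoff.mono (u := s₁.arr 2 q + 1) (v := s₁.arr 2 p) (by omega) h4.le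
      omega
  · omega

end Initialization
end STC

namespace STC

/-! ### Writing the reduced instance in place -/

section Output

open Program (forLoop)

variable {W : ℕ} {s : State}

open scoped Classical in
/-- The number of living vertices below `u`: the new name of `u`. -/
noncomputable def rank (D : DartData) (u : ℕ) : ℕ := Nat.count (fun v => D.status v ≠ 3) u

open scoped Classical in
/-- The number of living darts below `r`: the new position of `r`. -/
noncomputable def dartRank (D : DartData) (r : ℕ) : ℕ := Nat.count (LiveDart D) r

open scoped Classical in
/-- The number of living darts at vertices below `u`: the new offset of `u`. -/
noncomputable def newOffset (D : DartData) (u : ℕ) : ℕ :=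
  Nat.count (fun r => LiveDart D r ∧ D.src r < u) D.num

open scoped Classical in
/-- The number of living edges among the first `r` darts, counted at their smaller ends. -/
noncomputable def edgeRank (D : DartData) (r : ℕ) : ℕ :=
  Nat.count (fun q => LiveDart D q ∧ D.src q < D.tgt q) r

theorem newOffset_zero (D : DartData) : newOffset D 0 = 0 := by
  classical
  rw [newOffset, Nat.count_eq_card_filter_range]
  simp

theorem newOffset_succ (D : DartData) (u : ℕ) :
    newOffset D (u + 1) = newOffset D u + liveCount D u := by
  classical
  rw [newOffset, newOffset, liveCount, Nat.count_eq_card_filter_range,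
    Nat.count_eq_card_filter_range, Nat.count_eq_card_filter_range, ← Finset.card_union_of_disjoint]
  · congr 1
    ext r
    simp only [Finset.mem_filter, Finset.mem_union]
    constructor
    · rintro ⟨h1, h2, h3⟩
      rcases Nat.lt_succ_iff_lt_or_eq.1 h3 with h | h
      · exact Or.inl ⟨h1, h2, h⟩
      · exact Or.inr ⟨h1, h, h2⟩
    · rintro (⟨h1, h2, h3⟩ | ⟨h1, h2, h3⟩)
      · exact ⟨h1, h2, by omega⟩
      · exact ⟨h1, h3, by omega⟩
  · rw [Finset.disjoint_left]
    intro r h1 h2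
    have h1 := (Finset.mem_filter.1 h1).2.2
    have h2 := (Finset.mem_filter.1 h2).2.1
    omega

theorem liveCount_eq_zero {D : DartData} {u : ℕ} (h : D.status u = 3) : liveCount D u = 0 := by
  classical
  rw [liveCount, Nat.count_eq_card_filter_range, Finset.card_eq_zero, Finset.filter_eq_empty_iff]
  rintro r _ ⟨h1, h2, _⟩
  exact h2 (by rw [h1, h])

theorem newOffset_le (D : DartData) (u : ℕ) : newOffset D u ≤ D.num := by
  classical exact Nat.count_le _

theorem rank_succ_of_alive {D : DartData} {u : ℕ} (h : D.status u ≠ 3) :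
    rank D (u + 1) = rank D u + 1 := by
  classical
  rw [rank, rank, Nat.count_succ, if_pos h]

theorem rank_succ_of_dead {D : DartData} {u : ℕ} (h : D.status u = 3) :
    rank D (u + 1) = rank D u := by
  classical
  rw [rank, rank, Nat.count_succ, if_neg (by simp [h]), add_zero]

theorem rank_mono (D : DartData) : Monotone (rank D) := by
  classical exact Nat.count_monotone _

theorem rank_le (D : DartData) (u : ℕ) : rank D u ≤ u := by
  classical exact Nat.count_le _

theorem dartRank_succ_of_live {D : DartData} {r : ℕ} (h : LiveDart D r) :
    dartRank D (r + 1) = dartRank D r + 1 := by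
  classical
  rw [dartRank, dartRank, Nat.count_succ, if_pos h]

theorem dartRank_succ_of_not_live {D : DartData} {r : ℕ} (h : ¬ LiveDart D r) :
    dartRank D (r + 1) = dartRank D r := by
  classical
  rw [dartRank, dartRank, Nat.count_succ, if_neg h, add_zero]

theorem dartRank_mono (D : DartData) : Monotone (dartRank D) := by
  classical exact Nat.count_monotone _

theorem dartRank_le (D : DartData) (r : ℕ) : dartRank D r ≤ r := by
  classical exact Nat.count_le _

theorem edgeRank_le (D : DartData) (r : ℕ) : edgeRank D r ≤ r := by
  classical exact Nat.count_le _

/-- Name the living vertices in order, and count them in register `10`. -/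
def rename : Program :=
  .seq (.assign 10 (.const 0))
    (forLoop 4 0 (.ite (.not (.eq (.read 3 (.reg 4)) (.const 3)))
      (.seq (.write 8 (.reg 4) (.reg 10)) (.assign 10 (.add (.reg 10) (.const 1)))) .skip))

theorem runs_rename (hW : s.reg 0 + 1 ≤ W) :
    Runs W rename s ((s.reg 0 + 1) * 100) fun s' => s'.reg 10 = rank s.darts (s.reg 0) ∧
      ∀ u < s.reg 0, s.arr 3 u ≠ 3 → s'.arr 8 u = rank s.darts u := by
  refine Runs.mono (Runs.seq (Runs.of_wlp (Q := fun s' => s'.reg 10 = 0) (by simp [wlp]))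
    fun s₁ h1 hf1 => Runs.forLoop (N := s.reg 0) (fun i s' => s'.reg 10 = rank s.darts i ∧
      ∀ u < i, s.arr 3 u ≠ 3 → s'.arr 8 u = rank s.darts u) (hf1.1 0 (by decide)) (by omega)
      (by decide) (by decide) (by decide) (by simp [h1, rank]) ?_) ?_ fun _ h => h
  · intro i s' hi hf h4 ⟨hI1, hI2⟩
    have e3 := (hf.2 3 (by decide)).trans (hf1.2 3 (by decide))
    have hle := rank_le s.darts i
    simp only [wlp, Test.holds, Expr.eval, e3, h4, State.setReg_reg, State.setArr_reg,
      State.setReg_arr, State.setArr_arr, hI1]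
    refine ⟨fun hc => ⟨by omega, by omega, by omega, ?_⟩, fun hc => ?_⟩
    · simp
      refine ⟨(rank_succ_of_alive hc).symm, fun u hu hal => ?_⟩
      by_cases h : u = i
      · simp [h]
      · simp only [h, if_false]; exact hI2 u (by omega) hal
    · simp
      refine ⟨?_, fun u hu hal => ?_⟩
      · rw [rank_succ_of_dead (not_not.1 hc)]
      · by_cases h : u = i
        · exact absurd (h ▸ hal) hc
        · exact hI2 u (by omega) hal
  · simp [Program.maxCost, Expr.cost, Test.cost]
    omega

/-- Write the adjacency lists of the graph on the living vertices, under their new names. -/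
def relabel : Program :=
  .seq (.assign 2 (.sub (.reg 2) (.reg 9)))
  (.seq (forLoop 4 0 (.ite (.not (.eq (.read 3 (.reg 4)) (.const 3)))
    (.write 0 (.add (.read 8 (.reg 4)) (.const 1))
      (.add (.read 0 (.read 8 (.reg 4))) (.read 5 (.reg 4)))) .skip))
  (.seq (.seq (.assign 0 (.reg 10)) (.seq (.assign 10 (.const 0)) (.assign 1 (.const 0))))
  (forLoop 4 3 (.ite bothAlive
    (.seq (.ite (.lt dartSrc dartTgt) (.assign 1 (.add (.reg 1) (.const 1))) .skip)
    (.seq (.write 1 (.reg 10) (.read 8 dartTgt)) (.assign 10 (.add (.reg 10) (.const 1))))) .skip))))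

/-- Compacting in place is safe: the new position of a dart is at most its old one, so entries not
yet read are untouched (the last clause of the invariant of the second loop). The old offsets are no
longer needed, the sources being in array 2 and the degrees in array 5. The comparison of the ends
comes before the write, which may hit the current entry. -/
theorem runs_relabel (hD : DartState W s) (hW : s.reg 0 + 1 ≤ W) (hk : s.reg 2 ≤ W)
    (h0 : s.arr 0 0 = 0) (h10 : s.reg 10 = rank s.darts (s.reg 0))
    (h8 : ∀ u < s.reg 0, s.arr 3 u ≠ 3 → s.arr 8 u = rank s.darts u)
    (h5 : ∀ u < s.reg 0, s.arr 3 u ≠ 3 → s.arr 5 u = liveCount s.darts u)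
    (htgt : ∀ r < s.reg 3, s.arr 1 r < s.reg 0) :
    Runs W relabel s ((s.reg 0 + s.reg 3 + 1) * 200) fun s' =>
      s'.reg 0 = rank s.darts (s.reg 0) ∧ s'.reg 1 = edgeRank s.darts (s.reg 3) ∧
      s'.reg 2 = s.reg 2 - s.reg 9 ∧
      (∀ u ≤ s.reg 0, s'.arr 0 (rank s.darts u) = newOffset s.darts u) ∧
      ∀ r < s.reg 3, LiveDart s.darts r →
        s'.arr 1 (dartRank s.darts r) = rank s.darts (s.arr 1 r) := by
  have hM := hD.num_le
  refine Runs.mono (Runs.seq (Runs.of_wlp (Q := fun s' => s'.reg 2 = s.reg 2 - s.reg 9)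
    (by simp [wlp]; omega)) fun s₁ h1 hf1 =>
    Runs.seq (Runs.forLoop (N := s.reg 0) (fun i s' => ∀ u ≤ i,
      s'.arr 0 (rank s.darts u) = newOffset s.darts u) (hf1.1 0 (by decide)) (by omega) (by decide)
      (by decide) (by decide) ?_ ?_) fun s₂ h2 hf2 =>
    Runs.seq (Runs.of_wlp (Q := fun s' => s'.reg 0 = rank s.darts (s.reg 0) ∧ s'.reg 10 = 0 ∧
      s'.reg 1 = 0) ?_) fun s₃ h3 hf3 =>
    Runs.mono (Runs.frame (Runs.forLoop (N := s.reg 3) (fun i s' => s'.reg 10 = dartRank s.darts i ∧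
      s'.reg 1 = edgeRank s.darts i ∧ (∀ r < i, LiveDart s.darts r →
        s'.arr 1 (dartRank s.darts r) = rank s.darts (s.arr 1 r)) ∧
      ∀ r, i ≤ r → s'.arr 1 r = s.arr 1 r)
      ?_ (by omega) (by decide) (by decide) (by decide) ?_ ?_)) le_rfl ?_) ?_ fun _ h => h
  · intro u hu
    obtain rfl : u = 0 := by omega
    simp [rank, newOffset_zero, hf1.2 0 (by decide), h0]
  · intro i s' hi hf h4 hI
    have hf' := (hf1.mono (R' := [2, 4]) (A' := [0]) (by decide) (by decide)).trans
      (hf.mono (by decide) (by decide))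
    have e3 := hf'.2 3 (by decide)
    have e5 := hf'.2 5 (by decide)
    have e8 := hf'.2 8 (by decide)
    have hle := rank_le s.darts i
    simp only [wlp, Test.holds, Expr.eval, e3, e5, e8, h4, State.setReg_arr, State.setArr_arr]
    refine ⟨fun hc => ?_, fun hc u hu => ?_⟩
    · have hsum : newOffset s.darts (i + 1) = newOffset s.darts i + liveCount s.darts i :=
        newOffset_succ _ _
      have hoff := newOffset_le s.darts (i + 1)
      have hnum : s.darts.num = s.reg 3 := rfl
      rw [h8 i hi hc, h5 i hi hc, hI i le_rfl, ← hsum]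
      refine ⟨by omega, by omega, fun u hu => ?_⟩
      simp only [if_true]
      rcases Nat.le_succ_iff.1 hu with h | rfl
      · have := rank_mono s.darts h
        rw [if_neg (by omega)]
        exact hI u h
      · rw [if_pos (rank_succ_of_alive hc)]
    · have hc : s.darts.status i = 3 := not_not.1 hc
      rcases Nat.le_succ_iff.1 hu with h | rfl
      · exact hI u h
      · rw [rank_succ_of_dead hc, newOffset_succ, liveCount_eq_zero hc, add_zero]
        exact hI i le_rfl
  · have e10 : s₂.reg 10 = s.reg 10 := (hf2.1 10 (by decide)).trans (hf1.1 10 (by decide))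
    have := rank_le s.darts (s.reg 0)
    simp [wlp, e10, h10]
    omega
  · exact ((hf3.1 3 (by decide)).trans (hf2.1 3 (by decide))).trans (hf1.1 3 (by decide))
  · have hf13 := ((hf1.mono (R' := [0, 1, 2, 4, 10]) (A' := [0]) (by decide) (by decide)).trans
      (hf2.mono (by decide) (by decide))).trans (hf3.mono (by decide) (by decide))
    simp [h3.2.1, h3.2.2, dartRank, edgeRank, hf13.2 1 (by decide)]
  · intro i s' hi hf h4 ⟨hI1, hI2, hI3, hI4⟩
    have hf' := (((hf1.mono (R' := [0, 1, 2, 4, 10]) (A' := [0, 1]) (by decide) (by decide)).trans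
      (hf2.mono (by decide) (by decide))).trans (hf3.mono (by decide) (by decide))).trans
      (hf.mono (by decide) (by decide))
    have e2 := hf'.2 2 (by decide)
    have e3 := hf'.2 3 (by decide)
    have e8 := hf'.2 8 (by decide)
    have hle := dartRank_le s.darts i
    have hle' := edgeRank_le s.darts i
    have hti := hI4 i le_rfl
    have hrank := rank_le s.darts (s.arr 1 i)
    have htl := htgt i hi
    have hL : (s.arr 3 (s.arr 2 i) ≠ 3 ∧ s.arr 3 (s.arr 1 i) ≠ 3) ↔ LiveDart s.darts i := Iff.rfl
    -- Both outcomes of the edge-counting test lead here; `b` is the edge count after it.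
    have main : ∀ b, LiveDart s.darts i →
        b = edgeRank s.darts i + (if s.arr 2 i < s.arr 1 i then 1 else 0) →
        dartRank s.darts i + 1 = dartRank s.darts (i + 1) ∧ b = edgeRank s.darts (i + 1) ∧
        (∀ r < i + 1, LiveDart s.darts r →
          (if dartRank s.darts r = dartRank s.darts i then rank s.darts (s.arr 1 i)
            else s'.arr 1 (dartRank s.darts r)) = rank s.darts (s.arr 1 r)) ∧
        ∀ r, i + 1 ≤ r → (if r = dartRank s.darts i then rank s.darts (s.arr 1 i)
          else s'.arr 1 r) = s.arr 1 r := by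
      intro b hl h2
      refine ⟨by rw [dartRank_succ_of_live hl], ?_, fun r hr hlr => ?_, fun r hr => ?_⟩
      · classical
        rw [h2, edgeRank, edgeRank, Nat.count_succ]
        congr 1
        exact if_congr (and_iff_right hl).symm rfl rfl
      · rcases Nat.lt_succ_iff_lt_or_eq.1 hr with h | rfl
        · have := dartRank_succ_of_live hlr
          have := dartRank_mono s.darts (show r + 1 ≤ i by omega)
          rw [if_neg (by omega)]
          exact hI3 r h hlr
        · rw [if_pos rfl]
      · rw [if_neg (by omega)]
        exact hI4 r (by omega)
    simp only [wlp, bothAlive, Test.holds, dartSrc_eval, dartTgt_eval, Expr.eval, e2, e3, e8, hti, h4,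
      State.setReg_reg, State.setArr_reg, State.setReg_arr, State.setArr_arr, hI1, hI2]
    refine ⟨fun hc => ?_, fun hc => ?_⟩
    · have hal := h8 _ htl hc.2
      simp only [if_true, if_false, Nat.reduceEqDiff, hti, hal]
      refine ⟨fun hlt => ⟨by omega, by omega, by omega, by omega, ?_⟩,
        fun hlt => ⟨by omega, by omega, by omega, ?_⟩⟩
      · exact main _ (hL.1 hc) (by rw [if_pos hlt])
      · exact main _ (hL.1 hc) (by rw [if_neg hlt, add_zero])
    · have hnl : ¬ LiveDart s.darts i := fun h => hc (hL.2 h)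
      simp only [Nat.reduceEqDiff, if_false]
      refine ⟨by simp [dartRank_succ_of_not_live hnl], ?_, fun r hr hlr => ?_, fun r hr => ?_⟩
      · classical
        rw [edgeRank, edgeRank, Nat.count_succ, if_neg fun h => hnl h.1]
        simp
      · rcases Nat.lt_succ_iff_lt_or_eq.1 hr with h | rfl
        · exact hI3 r h hlr
        · exact absurd hlr hnl
      · exact hI4 r (by omega)
  · rintro s' ⟨⟨_, h6, h7, _⟩, hf4⟩
    refine ⟨?_, h6, ?_, fun u hu => ?_, h7⟩
    · rw [hf4.1 0 (by decide), h3.1]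
    · rw [hf4.1 2 (by decide), hf3.1 2 (by decide), hf2.1 2 (by decide), h1]
    · rw [hf4.2 0 (by decide), hf3.2 0 (by decide)]; exact h2 u hu
  · simp [Program.maxCost, Expr.cost, Test.cost, dartSrc, dartTgt, bothAlive]
    omega

end Output
end STC

namespace STC

/-! ### A fixed no-instance -/

section Claw

/-- The star with three leaves, with centre `0`. -/
def claw : SimpleGraph (Fin 4) where
  Adj i j := (i = 0 ∧ j ≠ 0) ∨ (i ≠ 0 ∧ j = 0)
  symm := ⟨fun _ _ h => h.elim (fun h => Or.inr ⟨h.2, h.1⟩) fun h => Or.inl ⟨h.2, h.1⟩⟩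
  loopless := ⟨fun _ h => h.elim (fun h => h.2 h.1) fun h => h.1 h.2⟩

instance : DecidableRel claw.Adj := fun i j =>
  inferInstanceAs (Decidable ((i = 0 ∧ j ≠ 0) ∨ (i ≠ 0 ∧ j = 0)))

/-- The leaves are pairwise non-adjacent, so at most one edge is strong and two are weak. Parameter
1 is the least possible for a no-instance within the size bound: with parameter 0 the graph would be
empty and a yes-instance. -/
theorem not_hasSTCLabeling_claw : ¬ HasSTCLabeling claw 1 := by
  rw [hasSTCLabeling_iff]
  rintro ⟨S, hSE, hS, hk⟩
  have key : ∀ i j : Fin 4, i ≠ 0 → j ≠ 0 → i ≠ j → s(0, i) ∈ S → s(0, j) ∉ S := by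
    intro i j hi hj hij h1 h2
    rcases hS i 0 j hij (by rw [Sym2.eq_swap]; exact h1) h2 with h | h
    · exact hi h.1
    · exact hj h.2
  have two : ∀ i j : Fin 4, i ≠ 0 → j ≠ 0 → i ≠ j → s(0, i) ∉ S → s(0, j) ∉ S → False := by
    intro i j hi hj hij h1 h2
    have hsub : ({s(0, i), s(0, j)} : Set (Sym2 (Fin 4))) ⊆ claw.edgeSet \ S := by
      rintro e (rfl | rfl)
      · exact ⟨Or.inl ⟨rfl, hi⟩, h1⟩
      · exact ⟨Or.inl ⟨rfl, hj⟩, h2⟩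
    have := Set.ncard_le_ncard hsub (Set.toFinite _)
    rw [Set.ncard_pair fun h => (Sym2.eq_iff.1 h).elim (fun h => hij h.2)
      fun h => hij (h.2.trans h.1)] at this
    omega
  by_cases h1 : s(0, 1) ∈ S
  · exact two 2 3 (by decide) (by decide) (by decide) (key 1 2 (by decide) (by decide) (by decide) h1)
      (key 1 3 (by decide) (by decide) (by decide) h1)
  · by_cases h2 : s(0, 2) ∈ S
    · exact two 1 3 (by decide) (by decide) (by decide) h1
        (key 2 3 (by decide) (by decide) (by decide) h2)
    · exact two 1 2 (by decide) (by decide) (by decide) h1 h2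

/-- Write the no-instance `(claw, 1)`. -/
def writeClaw : Program :=
  .seq (.seq (.assign 0 (.const 4)) (.seq (.assign 1 (.const 3)) (.assign 2 (.const 1))))
  (.seq (.seq (.write 0 (.const 0) (.const 0)) (.seq (.write 0 (.const 1) (.const 3))
    (.seq (.write 0 (.const 2) (.const 4)) (.seq (.write 0 (.const 3) (.const 5))
      (.write 0 (.const 4) (.const 6))))))
  (.seq (.write 1 (.const 0) (.const 1)) (.seq (.write 1 (.const 1) (.const 2))
    (.seq (.write 1 (.const 2) (.const 3)) (.seq (.write 1 (.const 3) (.const 0))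
      (.seq (.write 1 (.const 4) (.const 0)) (.write 1 (.const 5) (.const 0))))))))

theorem runs_writeClaw {W : ℕ} (hW : 6 ≤ W) (s : State) :
    Runs W writeClaw s 100 fun s' => Encodes s' claw 1 := by
  refine Runs.mono (Runs.of_wlp (Q := fun s' => (s'.reg 0 = 4 ∧ s'.reg 1 = 3 ∧ s'.reg 2 = 1) ∧
    (s'.arr 0 0 = 0 ∧ s'.arr 0 1 = 3 ∧ s'.arr 0 2 = 4 ∧ s'.arr 0 3 = 5 ∧ s'.arr 0 4 = 6) ∧
    s'.arr 1 0 = 1 ∧ s'.arr 1 1 = 2 ∧ s'.arr 1 2 = 3 ∧ s'.arr 1 3 = 0 ∧ s'.arr 1 4 = 0 ∧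
    s'.arr 1 5 = 0) ?_) (by decide) ?_
  · simp [writeClaw, wlp]; omega
  · rintro s' ⟨⟨r0, r1, r2⟩, ⟨a0, a1, a2, a3, a4⟩, b0, b1, b2, b3, b4, b5⟩
    refine ⟨r0, ?_, r2, a0, ?_, ?_⟩
    · rw [r1, Set.ncard_eq_toFinset_card']
      decide
    · intro v
      rw [Set.ncard_eq_toFinset_card']
      have : ∀ v : Fin 4, (claw.neighborSet v).toFinset.card = if v = 0 then 3 else 1 := by decide
      rw [this]
      fin_cases v <;> simp [a0, a1, a2, a3, a4]
    · intro v x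
      have hr : (∃ w : Fin 4, (w : ℕ) = x ∧ claw.Adj v w) ↔
          if v = 0 then x = 1 ∨ x = 2 ∨ x = 3 else x = 0 := by
        constructor
        · rintro ⟨w, rfl, h | h⟩
          · rw [if_pos h.1]; have := w.2; have := Fin.val_ne_of_ne h.2; simp at this; omega
          · rw [if_neg h.1, h.2]; rfl
        · intro h
          split at h
          · rename_i hv
            refine ⟨⟨x, by omega⟩, rfl, Or.inl ⟨hv, ?_⟩⟩
            intro h'; have := congrArg Fin.val h'; simp at this; omega
          · rename_i hv
            exact ⟨0, h.symm, Or.inr ⟨hv, rfl⟩⟩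
      rw [hr]
      fin_cases v <;> simp [a0, a1, a2, a3, a4]
      · constructor
        · rintro ⟨i, hi, rfl⟩; interval_cases i <;> simp [b0, b1, b2]
        · rintro (rfl | rfl | rfl)
          · exact ⟨0, by omega, b0⟩
          · exact ⟨1, by omega, b1⟩
          · exact ⟨2, by omega, b2⟩
      · constructor
        · rintro ⟨i, h1, h2, rfl⟩; obtain rfl : i = 3 := by omega
          exact b3
        · rintro rfl; exact ⟨3, by omega, by omega, b3⟩
      · constructor
        · rintro ⟨i, h1, h2, rfl⟩; obtain rfl : i = 4 := by omega
          exact b4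
        · rintro rfl; exact ⟨4, by omega, by omega, b4⟩
      · constructor
        · rintro ⟨i, h1, h2, rfl⟩; obtain rfl : i = 5 := by omega
          exact b5
        · rintro rfl; exact ⟨5, by omega, by omega, b5⟩

end Claw

/-! ### The output encodes a copy of G[A] -/

section Relabeling

variable {D : DartData} {n : ℕ} {G : SimpleGraph (Fin n)} {A : Finset (Fin n)}

theorem StatusRep.rank_eq_card (hS : StatusRep D G A) : rank D n = A.card := by
  classical
  rw [rank, Nat.count_eq_card_filter_range, ← Finset.card_map Fin.valEmbedding]
  congr 1
  ext u
  simp only [Finset.mem_filter, Finset.mem_range, Finset.mem_map, Fin.valEmbedding_apply]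
  constructor
  · rintro ⟨h1, h2⟩; exact ⟨⟨u, h1⟩, (hS.mem_iff _).2 h2, rfl⟩
  · rintro ⟨v, hv, rfl⟩; exact ⟨v.2, (hS.mem_iff v).1 hv⟩

theorem rank_lt_of_alive {u v : ℕ} (hu : D.status u ≠ 3) (huv : u < v) : rank D u < rank D v := by
  have := rank_mono D (show u + 1 ≤ v from huv)
  rw [rank_succ_of_alive hu] at this
  omega

/-- The renaming of the living vertices. -/
noncomputable def StatusRep.renaming (hS : StatusRep D G A) :
    (A : Set (Fin n)) ≃ Fin (rank D n) :=
  Equiv.ofBijective (fun u => ⟨rank D u.1, rank_lt_of_alive ((hS.mem_iff u.1).1 u.2) u.1.2⟩) (by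
    rw [Fintype.bijective_iff_injective_and_card]
    refine ⟨fun u v h => ?_, by simp [hS.rank_eq_card]⟩
    have h : rank D u.1 = rank D v.1 := congrArg Fin.val h
    refine Subtype.ext (Fin.ext ?_)
    rcases lt_trichotomy (u.1 : ℕ) v.1 with hlt | heq | hlt
    · have := rank_lt_of_alive ((hS.mem_iff u.1).1 u.2) hlt; omega
    · exact heq
    · have := rank_lt_of_alive ((hS.mem_iff v.1).1 v.2) hlt; omega)

theorem StatusRep.renaming_val (hS : StatusRep D G A) (u : (A : Set (Fin n))) :
    (hS.renaming u : ℕ) = rank D u.1 := rfl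

/-- `G[A]` under the new names. -/
noncomputable def StatusRep.renamed (hS : StatusRep D G A) : SimpleGraph (Fin (rank D n)) :=
  (G.induce (A : Set (Fin n))).comap hS.renaming.symm

theorem StatusRep.renamed_adj (hS : StatusRep D G A) (u v : (A : Set (Fin n))) :
    hS.renamed.Adj (hS.renaming u) (hS.renaming v) ↔ G.Adj u.1 v.1 := by
  simp [StatusRep.renamed]

theorem DartRep.exists_live (h : DartRep D G) (hS : StatusRep D G A) {r : ℕ} (hr : r < D.num)
    (hl : LiveDart D r) : ∃ u v : (A : Set (Fin n)), D.src r = u.1 ∧ D.tgt r = v.1 ∧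
      G.Adj u.1 v.1 := by
  obtain ⟨u, hu⟩ := h.exists_src hr
  obtain ⟨v, hv⟩ := h.exists_tgt hr
  refine ⟨⟨u, (hS.mem_iff u).2 (hu ▸ hl.1)⟩, ⟨v, (hS.mem_iff v).2 (hv ▸ hl.2)⟩, hu, hv,
    (h.adj_iff u v).2 ⟨r, hr, hu, hv⟩⟩

theorem DartRep.exists_dart (h : DartRep D G) (hS : StatusRep D G A) {u v : (A : Set (Fin n))}
    (huv : G.Adj u.1 v.1) : ∃ r < D.num, LiveDart D r ∧ D.src r = u.1 ∧ D.tgt r = v.1 := by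
  obtain ⟨r, hr, h1, h2⟩ := (h.adj_iff _ _).1 huv
  refine ⟨r, hr, ⟨?_, ?_⟩, h1, h2⟩
  · rw [h1]; exact (hS.mem_iff _).1 u.2
  · rw [h2]; exact (hS.mem_iff _).1 v.2

/-- An edge of G[A] is represented by two living darts, exactly one of which goes from the smaller
to the larger old number. -/
theorem StatusRep.ncard_edgeSet_renamed (hS : StatusRep D G A) (h : DartRep D G) :
    hS.renamed.edgeSet.ncard = edgeRank D D.num := by
  classical
  rw [edgeRank, Nat.count_eq_card_filter_range, ← Set.ncard_coe_finset]
  symm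
  have hex : ∀ r ∈ ((Finset.range D.num).filter fun q => LiveDart D q ∧ D.src q < D.tgt q : Set ℕ),
      ∃ p : ↥(A : Set (Fin n)) × ↥(A : Set (Fin n)), D.src r = p.1.1 ∧ D.tgt r = p.2.1 ∧
        G.Adj p.1.1 p.2.1 := by
    intro r hr
    rw [Finset.mem_coe, Finset.mem_filter, Finset.mem_range] at hr
    obtain ⟨u, v, huv⟩ := h.exists_live hS hr.1 hr.2.1
    exact ⟨(u, v), huv⟩
  choose p hp1 hp2 hp3 using hex
  refine Set.ncard_congr (fun r hr => s(hS.renaming (p r hr).1, hS.renaming (p r hr).2)) ?_ ?_ ?_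
  · intro r hr
    exact (hS.renamed_adj _ _).2 (hp3 r hr)
  · intro r r' hr hr' heq
    have hm := hr
    have hm' := hr'
    rw [Finset.mem_coe, Finset.mem_filter, Finset.mem_range] at hm hm'
    have e1 := hp1 r hr
    have e2 := hp2 r hr
    have e1' := hp1 r' hr'
    have e2' := hp2 r' hr'
    rcases Sym2.eq_iff.1 heq with ⟨h1, h2⟩ | ⟨h1, h2⟩
    · rw [hS.renaming.apply_eq_iff_eq] at h1 h2
      exact h.inj r hm.1 r' hm'.1 (by rw [e1, e1', h1]) (by rw [e2, e2', h2])
    · rw [hS.renaming.apply_eq_iff_eq] at h1 h2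
      rw [h1] at e1; rw [h2] at e2
      omega
  · intro e he
    induction e with | _ a b => ?_
    obtain ⟨u, rfl⟩ := hS.renaming.surjective a
    obtain ⟨v, rfl⟩ := hS.renaming.surjective b
    have huv : G.Adj u.1 v.1 := (hS.renamed_adj u v).1 he
    have main : ∀ u v : (A : Set (Fin n)), G.Adj u.1 v.1 → u.1 < v.1 →
        ∃ r, ∃ hr : r ∈ ((Finset.range D.num).filter fun q => LiveDart D q ∧ D.src q < D.tgt q : Set ℕ),
          s(hS.renaming (p r hr).1, hS.renaming (p r hr).2) = s(hS.renaming u, hS.renaming v) := by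
      intro u v huv hlt
      obtain ⟨r, hr, hl, h1, h2⟩ := h.exists_dart hS huv
      have hm : r ∈ ((Finset.range D.num).filter fun q => LiveDart D q ∧ D.src q < D.tgt q : Set ℕ) := by
        rw [Finset.mem_coe, Finset.mem_filter, Finset.mem_range]
        exact ⟨hr, hl, by rw [h1, h2]; exact hlt⟩
      refine ⟨r, hm, ?_⟩
      have e1 : (p r hm).1 = u := Subtype.ext (Fin.ext ((hp1 r hm).symm.trans h1))
      have e2 : (p r hm).2 = v := Subtype.ext (Fin.ext ((hp2 r hm).symm.trans h2))
      rw [e1, e2]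
    rcases lt_or_gt_of_ne huv.ne with hlt | hlt
    · exact main u v huv hlt
    · obtain ⟨r, hr, hre⟩ := main v u huv.symm hlt
      exact ⟨r, hr, hre.trans Sym2.eq_swap⟩

theorem StatusRep.ncard_neighborSet_renamed (hS : StatusRep D G A) (h : DartRep D G)
    (u : (A : Set (Fin n))) : (hS.renamed.neighborSet (hS.renaming u)).ncard = liveCount D u.1 := by
  have himg : hS.renamed.neighborSet (hS.renaming u) =
      hS.renaming '' (Subtype.val ⁻¹' (nbhdIn G A u.1 : Set (Fin n))) := by
    ext w
    obtain ⟨v, rfl⟩ := hS.renaming.surjective w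
    rw [SimpleGraph.mem_neighborSet, hS.renamed_adj, hS.renaming.injective.mem_set_image,
      Set.mem_preimage, Finset.mem_coe, mem_nbhdIn]
    exact (and_iff_right v.2).symm
  rw [himg, Set.ncard_image_of_injective _ hS.renaming.injective,
    Set.ncard_preimage_of_injective_subset_range Subtype.val_injective, Set.ncard_coe_finset,
    hS.liveCount_eq h u.2, degIn]
  intro w hw
  exact ⟨⟨w, (mem_nbhdIn.1 hw).1⟩, rfl⟩

theorem newOffset_le_dartRank {u r : ℕ}
    (h : ∀ q < D.num, LiveDart D q → D.src q < u → q < r) : newOffset D u ≤ dartRank D r := by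
  classical
  rw [newOffset, dartRank, Nat.count_eq_card_filter_range, Nat.count_eq_card_filter_range]
  refine Finset.card_le_card fun q hq => ?_
  obtain ⟨h1, h2, h3⟩ := Finset.mem_filter.1 hq
  exact Finset.mem_filter.2 ⟨Finset.mem_range.2 (h q (Finset.mem_range.1 h1) h2 h3), h2⟩

theorem dartRank_le_newOffset {u r : ℕ} (hr : r ≤ D.num)
    (h : ∀ q < r, LiveDart D q → D.src q < u) : dartRank D r ≤ newOffset D u := by
  classical
  rw [newOffset, dartRank, Nat.count_eq_card_filter_range, Nat.count_eq_card_filter_range]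
  refine Finset.card_le_card fun q hq => ?_
  obtain ⟨h1, h2⟩ := Finset.mem_filter.1 hq
  have h1 := Finset.mem_range.1 h1
  exact Finset.mem_filter.2 ⟨Finset.mem_range.2 (by omega), h2, h q h1 h2⟩

theorem exists_dartRank_eq {N i : ℕ} (hi : i < dartRank D N) :
    ∃ r < N, LiveDart D r ∧ dartRank D r = i := by
  induction N with
  | zero => simp [dartRank] at hi
  | succ N ih =>
    by_cases hl : LiveDart D N
    · rw [dartRank_succ_of_live hl] at hi
      rcases Nat.lt_succ_iff_lt_or_eq.1 hi with h | h
      · obtain ⟨r, hr, h'⟩ := ih h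
        exact ⟨r, by omega, h'⟩
      · exact ⟨N, by omega, hl, h.symm⟩
    · rw [dartRank_succ_of_not_live hl] at hi
      obtain ⟨r, hr, h'⟩ := ih hi
      exact ⟨r, by omega, h'⟩

/-- With sorted darts, the new adjacency list of `u` holds exactly the living darts at `u`. -/
theorem newOffset_le_dartRank_iff (hsort : ∀ p q, p ≤ q → q < D.num → D.src p ≤ D.src q) {r u : ℕ}
    (hr : r < D.num) (hl : LiveDart D r) :
    newOffset D u ≤ dartRank D r ∧ dartRank D r < newOffset D (u + 1) ↔ D.src r = u := by
  have hsucc := dartRank_succ_of_live hl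
  constructor
  · rintro ⟨h1, h2⟩
    rcases lt_trichotomy (D.src r) u with hlt | heq | hlt
    · have := dartRank_le_newOffset (D := D) (u := u) (r := r + 1) hr fun q hq _ =>
        lt_of_le_of_lt (hsort q r (by omega) hr) hlt
      omega
    · exact heq
    · have := newOffset_le_dartRank (D := D) (u := u + 1) (r := r) fun q hq _ hqu => by
        by_contra hle
        have := hsort r q (by omega) hq
        omega
      omega
  · rintro rfl
    constructor
    · refine newOffset_le_dartRank fun q hq _ hqu => ?_
      by_contra hle
      have := hsort r q (by omega) hq
      omega
    · have := dartRank_le_newOffset (D := D) (u := D.src r + 1) (r := r + 1) hr fun q hq _ =>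
        Nat.lt_succ_of_le (hsort q r (by omega) hr)
      omega

/-- Because the sources are sorted, the living darts at a vertex stay contiguous after compaction
and fill exactly its new segment (`newOffset_le_dartRank_iff`). -/
theorem StatusRep.encodes_renamed (hS : StatusRep D G A) (h : DartRep D G)
    (hsort : ∀ p q, p ≤ q → q < D.num → D.src p ≤ D.src q) {s : State} {k : ℕ}
    (h0 : s.reg 0 = rank D n) (h1 : s.reg 1 = edgeRank D D.num) (h2 : s.reg 2 = k)
    (hoff : ∀ u ≤ n, s.arr 0 (rank D u) = newOffset D u)
    (hadj : ∀ r < D.num, LiveDart D r → s.arr 1 (dartRank D r) = rank D (D.tgt r)) :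
    Encodes s hS.renamed k := by
  have hnext : ∀ u : (A : Set (Fin n)), s.arr 0 (hS.renaming u + 1) = newOffset D (u.1 + 1) := by
    intro u
    rw [hS.renaming_val, ← rank_succ_of_alive ((hS.mem_iff _).1 u.2)]
    exact hoff _ u.1.2
  have hthis : ∀ u : (A : Set (Fin n)), s.arr 0 (hS.renaming u) = newOffset D u.1 :=
    fun u => hoff _ u.1.2.le
  refine ⟨h0, ?_, h2, ?_, ?_, ?_⟩
  · rw [h1, hS.ncard_edgeSet_renamed h]
  · have := hoff 0 (Nat.zero_le n)
    rw [newOffset_zero] at this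
    simpa [rank] using this
  · intro v
    obtain ⟨u, rfl⟩ := hS.renaming.surjective v
    rw [hnext, hthis, newOffset_succ, hS.ncard_neighborSet_renamed h]
  · intro v x
    obtain ⟨u, rfl⟩ := hS.renaming.surjective v
    rw [hnext, hthis]
    constructor
    · rintro ⟨i, hi1, hi2, rfl⟩
      have hi : i < dartRank D D.num := by
        refine lt_of_lt_of_le hi2 (newOffset_le_dartRank fun q hq _ _ => hq)
      obtain ⟨r, hr, hl, rfl⟩ := exists_dartRank_eq hi
      have hsrc := (newOffset_le_dartRank_iff hsort hr hl).1 ⟨hi1, hi2⟩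
      obtain ⟨u', w, hu', hw, hadj'⟩ := h.exists_live hS hr hl
      obtain rfl : u' = u := Subtype.ext (Fin.ext (hu'.symm.trans hsrc))
      refine ⟨hS.renaming w, ?_, (hS.renamed_adj _ _).2 hadj'⟩
      rw [hadj r hr hl, hw, hS.renaming_val]
    · rintro ⟨w', rfl, hadj'⟩
      obtain ⟨w, rfl⟩ := hS.renaming.surjective w'
      obtain ⟨r, hr, hl, hs, ht⟩ := h.exists_dart hS ((hS.renamed_adj _ _).1 hadj')
      obtain ⟨h3, h4⟩ := (newOffset_le_dartRank_iff hsort hr hl).2 hs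
      exact ⟨dartRank D r, h3, h4, by rw [hadj r hr hl, ht, hS.renaming_val]⟩

end Relabeling
end STC

namespace STC

/-! ### The kernelization program and its running time -/

section KernelProgram

/-- The memory holds a kernel of `(G, k)`. -/
def HoldsKernel {n : ℕ} (G : SimpleGraph (Fin n)) (k : ℕ) (s : State) : Prop :=
  ∃ (n' : ℕ) (G' : SimpleGraph (Fin n')) (k' : ℕ), Encodes s G' k' ∧
    (HasSTCLabeling G k ↔ HasSTCLabeling G' k') ∧ n' ≤ 4 * k' ∧ k' ≤ max k 1 ∧
    ∃ (A : Set (Fin n)) (l : ℤ), ReducesTo G k A l ∧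
      (l = k' ∧ Nonempty (G' ≃g G.induce A) ∨ 4 * l < A.ncard)

variable {n k : ℕ} {G : SimpleGraph (Fin n)} {s : State} {A : Finset (Fin n)} {l : ℤ}

/-- A reduced instance with more than 4l vertices is a no-instance by `kernel_properties`, hence
equivalent to the claw with parameter 1. -/
theorem holdsKernel_of_encodes_claw (hr : ReducesTo G k A l) (hl : 4 * l < A.card)
    (hs : Encodes s claw 1) : HoldsKernel G k s := by
  have hk := kernel_properties hr
  rw [Set.ncard_coe_finset] at hk
  refine ⟨4, claw, 1, hs, iff_of_false (fun h => ?_) not_hasSTCLabeling_claw, le_rfl,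
    le_max_right _ _, A, l, hr, Or.inr (by rwa [Set.ncard_coe_finset])⟩
  have := hk.2.2 (hk.1.1 h)
  omega

theorem holdsKernel_of_encodes_iso {n' k' : ℕ} {G' : SimpleGraph (Fin n')}
    (hr : ReducesTo G k A k') (hk' : k' ≤ k) (hn : n' ≤ 4 * k') (e : G' ≃g G.induce A)
    (hs : Encodes s G' k') : HoldsKernel G k s :=
  ⟨n', G', k', hs, (kernel_properties hr).1.trans (hasSTCLabeling_congr e _).symm, hn,
    hk'.trans (le_max_left _ _), A, k', hr, Or.inl ⟨rfl, ⟨e⟩⟩⟩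

/-- Write the reduced instance, or a no-instance if it has too many vertices. -/
def output : Program :=
  .seq computeDeg (.seq rename
    (.ite (.lt (.add (.add (.reg 2) (.reg 2)) (.add (.reg 2) (.reg 2)))
      (.add (.reg 10) (.add (.add (.reg 9) (.reg 9)) (.add (.reg 9) (.reg 9)))))
      writeClaw relabel))

/-- With c the total decrease in register 9, the program compares 4k with |A| + 4c. This decides |A|
> 4(k - c) without signed arithmetic, also when k - c is negative. -/
theorem runs_output {W : ℕ} (h : LoopInv W G k s A) (h8 : s.reg 8 = 1) (h0 : s.reg 0 = n)
    (h2 : s.reg 2 = k) (ha : s.arr 0 0 = 0)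
    (hsort : ∀ p q, p ≤ q → q < s.reg 3 → s.arr 2 p ≤ s.arr 2 q)
    (hn : n + 1 ≤ W) (hk : k ≤ W) (hW : 6 ≤ W) :
    Runs W output s ((n + s.reg 3 + 1) * 1000) (HoldsKernel G k) := by
  have hr : ReducesTo G k A ((k : ℤ) - s.reg 9) := ⟨h.reduces, h.reduced h8⟩
  have hS := h.statusRep
  have hrank := hS.rank_eq_card
  refine Runs.mono (Runs.seq (runs_computeDeg h.dartState) fun s₁ h1 hf1 => Runs.seq
    (Runs.mono (B' := (n + 1) * 100) (runs_rename (W := W) (s := s₁)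
      (by have := hf1.1 0 (by decide); omega)) (by rw [hf1.1 0 (by decide), h0]) fun _ h => h)
    fun s₂ h2' hf2 =>
    Runs.ite (B := (n + s.reg 3 + 1) * 200) (fun hb => ?_) fun hb => ?_) ?_ fun _ h => h
  · have e9 : s₂.reg 9 = s.reg 9 := (hf2.1 9 (by decide)).trans (hf1.1 9 (by decide))
    have e2 : s₂.reg 2 = k := ((hf2.1 2 (by decide)).trans (hf1.1 2 (by decide))).trans h2
    have ed : s₁.darts = s.darts :=
      State.darts_eq_of_frame hf1 (by decide) (by decide) (by decide) (by decide)
    have e10 : s₂.reg 10 = A.card := by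
      rw [h2'.1, ed, hf1.1 0 (by decide), h0, hrank]
    simp only [Test.holds, Expr.eval, e9, e2, e10] at hb
    exact Runs.mono (runs_writeClaw hW s₂) (by omega) fun s' hs' =>
      holdsKernel_of_encodes_claw hr (by omega) hs'
  · have hf := (hf1.mono (R' := [4, 10]) (A' := [5, 6, 7, 8]) (by decide) (by decide)).trans
      (hf2.mono (by decide) (by decide))
    have e0 : s₂.reg 0 = n := (hf.1 0 (by decide)).trans h0
    have e2 : s₂.reg 2 = k := (hf.1 2 (by decide)).trans h2
    have e3 := hf.1 3 (by decide)
    have e9 := hf.1 9 (by decide)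
    have ea := hf.2 3 (by decide)
    have et := hf.2 1 (by decide)
    have ed1 : s₁.darts = s.darts :=
      State.darts_eq_of_frame hf1 (by decide) (by decide) (by decide) (by decide)
    have ed : s₂.darts = s.darts :=
      State.darts_eq_of_frame hf (by decide) (by decide) (by decide) (by decide)
    have e10 : s₂.reg 10 = rank s.darts n := by
      rw [h2'.1, ed1, hf1.1 0 (by decide), h0]
    simp only [Test.holds, Expr.eval, e9, e2, e10, hrank, not_lt] at hb
    refine Runs.mono (runs_relabel (h.dartState.of_frame hf (by decide) (by decide) (by decide))
      (by omega) (by omega) (by rw [hf.2 0 (by decide), ha]) (by rw [e0, e10, ed]) ?_ ?_ ?_)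
      (by rw [e0, e3]) ?_
    · intro u hu hal
      rw [ed, ← ed1]
      refine h2'.2 u ?_ ?_
      · rw [hf1.1 0 (by decide)]; omega
      · rwa [ea, ← hf1.2 3 (by decide)] at hal
    · intro u hu hal
      rw [e0] at hu
      rw [ea] at hal
      -- Degrees were computed at targets of darts only; a living vertex is one because it is not
      -- isolated in `G`.
      obtain ⟨p, hp, hpu⟩ := hS.exists_tgt h.dartRep (v := ⟨u, hu⟩) ((hS.mem_iff _).2 hal)
      have hpu : s.arr 1 p = u := hpu
      have := (h1 p hp).1
      rw [hpu] at this
      rw [hf2.2 5 (by decide), this, ed]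
    · intro r hr
      rw [e0, et]
      exact h.dartRep.tgt_lt r (hr.trans_eq e3)
    · rintro s' ⟨r0, r1, r2, hoff, hadj⟩
      rw [e0, ed] at r0
      rw [e3, ed] at r1
      rw [e2, e9] at r2
      rw [e0, ed] at hoff
      rw [e3, ed, et] at hadj
      -- From the failed size test; it makes the truncated subtraction of the new parameter exact.
      have hle : s.reg 9 ≤ k := by omega
      have hr' : ReducesTo G k A ((k - s.reg 9 : ℕ) : ℤ) := by rwa [Nat.cast_sub hle]
      refine holdsKernel_of_encodes_iso hr' (by omega) (by rw [hrank]; omega) ?_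
        (hS.encodes_renamed h.dartRep hsort r0 r1 r2 hoff hadj)
      exact ⟨hS.renaming.symm, by simp [StatusRep.renamed]⟩
  · have h3 : (s.reg 3 + 1) * 200 ≤ (n + s.reg 3 + 1) * 200 := by omega
    simp [Test.cost, Expr.cost]
    omega

/-- The kernelization program. -/
def kernelize : Program :=
  .ite (.eq (.reg 1) (.const 0)) (.assign 0 (.const 0)) (.seq setup (.seq reduceLoop output))

theorem holdsKernel_of_edgeSet_eq_empty (hG : G.edgeSet = ∅) (h0 : s.reg 0 = 0) (h1 : s.reg 1 = 0)
    (h2 : s.reg 2 = k) (ha : s.arr 0 0 = 0) : HoldsKernel G k s := by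
  have hadj : ∀ v w, ¬ G.Adj v w := fun v w h => by
    have : s(v, w) ∈ G.edgeSet := h
    simp [hG] at this
  have hsteps := reflTransGen_of_isolated (G := G) k Finset.univ Finset.univ fun v _ w => hadj v w
  rw [Finset.sdiff_self, Finset.coe_univ] at hsteps
  refine holdsKernel_of_encodes_iso (n' := 0) (k' := k) (G' := ⊥) (A := ∅)
    ⟨hsteps, fun K hK => ?_⟩ le_rfl (Nat.zero_le _) ?_ ?_
  · have : K.1.ncard = 0 := by
      rw [Set.eq_empty_of_forall_notMem (s := K.1) fun v _ => Finset.notMem_empty _ v.2,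
        Set.ncard_empty]
    have := hK.2
    omega
  · have : IsEmpty ((∅ : Finset (Fin n)) : Set (Fin n)) := ⟨fun v => Finset.notMem_empty _ v.2⟩
    exact ⟨Equiv.equivOfIsEmpty _ _, fun {a} => a.elim0⟩
  · exact ⟨h0, by simp [h1], h2, ha, fun v => v.elim0, fun v => v.elim0⟩

/-- Without edges only constant time is allowed, which does not suffice to visit the vertices; all
of them are isolated, so setting their number to 0 is enough. With an edge, `n` and `m` are both at
most `n * m`, which absorbs all linear terms. -/
theorem runs_kernelize {W m : ℕ} (h : IsInput s G k) (hm : G.edgeSet.ncard = m)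
    (hW : n + (m + m) * (m + m) + (m + m) + 6 ≤ W) (hk : k ≤ W) :
    Runs W kernelize s (20000 * (n * m + 1)) (HoldsKernel G k) := by
  by_cases h0 : m = 0
  · have h1 : s.reg 1 = 0 := by rw [h.edges, hm, h0]
    refine ⟨s.setReg 0 0, _, .ite_true (by simpa using h1) (.assign s 0 (.const 0) (Nat.zero_le _)),
      ?_, holdsKernel_of_edgeSet_eq_empty ?_ (by simp) (by simpa using h1) (by simpa using h.parameter)
        h.off_zero⟩
    · simp [Test.cost, Expr.cost, h0]
    · rw [← Set.ncard_eq_zero (Set.toFinite _), hm, h0]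
  · have hn : 0 < n := by
      obtain ⟨e, _⟩ := Set.nonempty_of_ncard_ne_zero (hm.trans_ne h0)
      induction e with | _ v w => exact v.pos
    have hnm : 1 ≤ n * m := Nat.mul_pos hn (Nat.pos_of_ne_zero h0)
    have hnn : n ≤ n * m := Nat.le_mul_of_pos_right n (Nat.pos_of_ne_zero h0)
    have hmm : m ≤ n * m := Nat.le_mul_of_pos_left m hn
    have hsetup := runs_setup (W := W) h (by rw [hm]; omega)
    rw [hm] at hsetup
    refine Runs.mono (Runs.ite (B := (n + (m + m) + 1) * 200 +
      ((2 * n + 2) * ((m + m + 1) * 1010) + (n + (m + m) + 1) * 1000))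
      (fun hb => absurd ((h.edges.symm.trans hb).symm.trans hm).symm h0) fun _ =>
      Runs.seq hsetup fun s₁ h1 hf1 => ?_) ?_ fun _ h => h
    · obtain ⟨A, hA, e3, hsort⟩ := h1
      refine Runs.seq (Runs.mono (runs_reduceLoop hA (by rw [e3]; omega)) (by rw [e3])
        fun _ h => h) fun s₂ h2 hf2 => ?_
      obtain ⟨A', hA', h8⟩ := h2
      have e3' := hf2.1 3 (by decide)
      have hf := (hf1.mono (R' := setup.modR ++ reduceLoop.modR)
        (A' := setup.modA ++ reduceLoop.modA) (List.subset_append_left _ _)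
        (List.subset_append_left _ _)).trans (hf2.mono (List.subset_append_right _ _)
        (List.subset_append_right _ _))
      refine Runs.mono (runs_output hA' h8 ((hf.1 0 (by decide)).trans h.vertices)
        ((hf.1 2 (by decide)).trans h.parameter) ?_ ?_ (by omega) hk (by omega))
        (by rw [e3', e3]) fun _ h => h
      · rw [hf.2 0 (by decide), h.off_zero]
      · rw [e3', hf2.2 2 (by decide)]
        exact hsort
    · have : (2 * n + 2) * ((m + m + 1) * 1010) = (4 * (n * m) + 2 * n + 4 * m + 2) * 1010 := by ring
      simp only [Test.cost, Expr.cost]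
      omega

/-- The largest numbers stored are quadratic in the input size; with base at least 2, the fourth
power also absorbs the factor 4 from counting darts. A polynomial bound on the words means
logarithmically many bits. -/
theorem memory_le_pow (n m k : ℕ) {c : ℕ} (hc : 4 ≤ c) :
    n + (m + m) * (m + m) + (m + m) + 6 ≤ (n + m + k + 2) ^ c ∧ k ≤ (n + m + k + 2) ^ c := by
  have h := Nat.pow_le_pow_right (show 0 < n + m + k + 2 by omega) hc
  have h2 : 4 * (n + m + k + 2) ^ 2 ≤ (n + m + k + 2) ^ 4 := by
    have : 2 ^ 2 ≤ (n + m + k + 2) ^ 2 := Nat.pow_le_pow_left (by omega) 2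
    calc _ ≤ (n + m + k + 2) ^ 2 * (n + m + k + 2) ^ 2 := Nat.mul_le_mul_right _ this
      _ = _ := by ring
  constructor <;> nlinarith [Nat.zero_le (n * m), Nat.zero_le (n * k), Nat.zero_le (m * k),
    Nat.zero_le (n * n), Nat.zero_le (k * k)]

end KernelProgram
end STC

theorem theorem1 :
    (∀ (V : Type*) [Finite V] (G : SimpleGraph V) (k l : ℤ) (A : Set V),
      STC.ReducesTo G k A l →
        (STC.HasSTCLabeling G k ↔ STC.HasSTCLabeling (G.induce A) l) ∧ l ≤ k ∧
        (STC.HasSTCLabeling (G.induce A) l → (A.ncard : ℤ) ≤ 4 * l)) ∧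
    ∃ (P : STC.Program) (c : ℕ), ∀ (n : ℕ) (G : SimpleGraph (Fin n)) (k : ℕ) (s : STC.State),
      STC.IsInput s G k →
        ∃ (s' : STC.State) (t n' : ℕ) (G' : SimpleGraph (Fin n')) (k' : ℕ),
          STC.Exec ((n + G.edgeSet.ncard + k + 2) ^ c) P s s' t ∧
          t ≤ c * (n * G.edgeSet.ncard + 1) ∧
          STC.Encodes s' G' k' ∧
          (STC.HasSTCLabeling G k ↔ STC.HasSTCLabeling G' k') ∧
          n' ≤ 4 * k' ∧ k' ≤ max k 1 ∧
          ∃ (A : Set (Fin n)) (l : ℤ), STC.ReducesTo G k A l ∧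
            (l = k' ∧ Nonempty (G' ≃g G.induce A) ∨ 4 * l < A.ncard) := by
  refine ⟨fun V _ G k l A h => STC.kernel_properties h, STC.kernelize, 20000, ?_⟩
  intro n G k s h
  -- The one constant serves as time factor and as exponent of the word bound; any exponent from 4
  -- on would do.
  obtain ⟨hW, hk⟩ := STC.memory_le_pow n G.edgeSet.ncard k (c := 20000) (by decide)
  obtain ⟨s', t, h1, h2, n', G', k', h3⟩ := STC.runs_kernelize h rfl hW hk
  exact ⟨s', t, n', G', k', h1, h2, h3⟩
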